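/- **Theorem (odd powers of Riesz transforms).** Let $d\ge 1$. For a Banach space $X$, a *step function* on $\mathbb R$ (resp. $\mathbb R^d$) with values in $X$ is a finite linear combination, with coefficients in $X$, of indicators of intervals of finite length (resp. of rectangles, i.e. products of $d$ intervals of finite length). For step functions $f:\mathbb R\to X$ let $$\mathcal H^{\mathbb R}_Xf(t)=\frac1\pi\,\mathrm{p.v.}\!\int_{\mathbb R}\frac{f(s)}{t-s}\,ds ,$$ and for $1\le j\le d$ let $R_{j,X}$ be the Riesz transform $$R_{j,X}f(x)=\frac{\Gamma(\frac{d+1}2)}{\pi^{(d+1)/2}}\,\mathrm{p.v.}\!\int_{\mathbb R^d}\frac{y_j}{|y|^{d+1}}f(x-y)\,dy ,$$ with powers $R_{j,X}^m=R_{j,X}\circ\dots\circ R_{j,X}$ ($m$ factors) applied to step functions $f:\mathbb R^d\to X$ (the principal values exist almost everywhere). For an operator $T$ defined on step functions on $E\in\{\mathbb R,\mathbb R^d\}$ and $\Phi,\Psi:X\to[0,\infty)$, put $$|T|_{\Phi,\Psi}=\inf\Big\{c\in[0,\infty]:\int_E\Psi(Tf)\,dx\le c\int_E\Phi(f)\,dx\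 \text{ for all step functions } f:E\to X\Big\},$$ and let $\|T\|_{L^p\to L^p}$ be the least $c\in[0,\infty]$ with $\|Tf\|_{L^p(E;X)}\le c\|f\|_{L^p(E;X)}$ for all step functions $f:E\to X$. Let $$c_{m,d}=\frac{2\,\Gamma(\frac{m+d}2)}{\Gamma(\frac d2)\,\Gamma(\frac m2)} .$$ 1. Let $m\ge1$ be odd with $(m,d)\neq(1,1)$, let $j\in\{1,\dots,d\}$, let $X$ be a Banach space, and let $\Phi,\Psi:X\to[0,\infty)$ be convex and continuous with $\Psi$ even. Then $$|R_{j,X}^m|_{\Phi,\Psi}\le\big|c_{m,d}\,\mathcal H^{\mathbb R}_X\big|_{\Phi,\Psi}.$$ 2. For fixed $d$, $c_{m,d}$ is of the exact order $m^{d/2}$ as $m\to\infty$. 3. There is a constant $K_d>0$, depending only on $d$, such that for all odd $m\ge1$, all $j\in\{1,\dots,d\}$, all Banach spaces $X$ and all $1<p<\infty$, $$\|R_{j,X}^m\|_{L^p(\mathbb R^d;X)\to L^p(\mathbb R^d;X)}\le K_d\,m^{d/2}\,\|\mathcal H^{\mathbb R}_X\|_{L^p(\mathbb R;X)\to L^p(\mathbb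 R;X)} .$$ -/

import Mathlib

open MeasureTheory Filter Topology
open scoped ENNReal

universe u

namespace RieszPowers

noncomputable section

/-- The principal value `p.v. ∫ F(y) dy` with singularity at the point `a`: the limit as `ε ↓ 0` of
the integrals of `F` over the complements of the balls of radius `ε` around `a`. -/
def pvIntegral {E X : Type*} [NormedAddCommGroup E] [MeasureSpace E]
    [NormedAddCommGroup X] [NormedSpace ℝ X] (a : E) (F : E → X) : X :=
  limUnder (𝓝[>] (0 : ℝ)) fun ε : ℝ => ∫ y in {y : E | ε < dist y a}, F y

/-- A step function `ℝ → X`: a finite linear combination of indicators of intervals of finite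
measure (open, closed, half-open or degenerate). -/
def IsStepR {X : Type*} [NormedAddCommGroup X] (f : ℝ → X) : Prop :=
  ∃ (N : ℕ) (v : Fin N → X) (I : Fin N → Set ℝ),
    (∀ k, (I k).OrdConnected ∧ volume (I k) < ∞) ∧
    ∀ t, f t = ∑ k, (I k).indicator (fun _ => v k) t

/-- A step function `ℝᵈ → X`: a finite linear combination of indicators of rectangles, that is, of
products of `d` intervals of finite length. -/
def IsStepRd {X : Type*} [NormedAddCommGroup X] (d : ℕ) (f : EuclideanSpace ℝ (Fin d) → X) :
    Prop :=
  ∃ (N : ℕ) (v : Fin N → X) (I : Fin N → Fin d → Set ℝ),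
    (∀ k i, (I k i).OrdConnected ∧ volume (I k i) < ∞) ∧
    ∀ x, f x = ∑ k, {y : EuclideanSpace ℝ (Fin d) | ∀ i, y i ∈ I k i}.indicator (fun _ => v k) x

/-- The Hilbert transform on the line, `(H f)(t) = (1/π) p.v. ∫ f(s)/(t - s) ds`. -/
def hilbertR {X : Type*} [NormedAddCommGroup X] [NormedSpace ℝ X] (f : ℝ → X) (t : ℝ) : X :=
  (1 / Real.pi) • pvIntegral t fun s : ℝ => (1 / (t - s)) • f s

/-- The `j`-th Riesz transform on `ℝᵈ`,
`(R_j f)(x) = Γ((d+1)/2) / π^((d+1)/2) · p.v. ∫ (y_j / |y|^(d+1)) f(x - y) dy`. -/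
def riesz {X : Type*} [NormedAddCommGroup X] [NormedSpace ℝ X] {d : ℕ} (j : Fin d)
    (f : EuclideanSpace ℝ (Fin d) → X) (x : EuclideanSpace ℝ (Fin d)) : X :=
  (Real.Gamma (((d : ℝ) + 1) / 2) / Real.pi ^ (((d : ℝ) + 1) / 2)) •
    pvIntegral 0 fun y : EuclideanSpace ℝ (Fin d) => (y j / ‖y‖ ^ (d + 1)) • f (x - y)

/-- The `m`-th power `R_j^m = R_j ∘ ⋯ ∘ R_j` of the Riesz transform. -/
def rieszPow {X : Type*} [NormedAddCommGroup X] [NormedSpace ℝ X] {d : ℕ} (j : Fin d) (m : ℕ) :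
    (EuclideanSpace ℝ (Fin d) → X) → EuclideanSpace ℝ (Fin d) → X :=
  (riesz j)^[m]

/-- The `Φ,Ψ`-norm of an operator `T` with domain the class `S` of functions: the least `c ∈ [0,∞]`
with `∫ Ψ(T f) ≤ c ∫ Φ(f)` for all `f` in `S`. -/
def phiPsiNorm {E X : Type*} [MeasureSpace E] (S : (E → X) → Prop) (T : (E → X) → E → X)
    (Φ Ψ : X → ℝ) : ℝ≥0∞ :=
  sInf {c : ℝ≥0∞ | ∀ f, S f →
    ∫⁻ s, ENNReal.ofReal (Ψ (T f s)) ≤ c * ∫⁻ s, ENNReal.ofReal (Φ (f s))}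

/-- The `Lᵖ → Lᵖ` norm of an operator given on a (dense) class `S` of functions: the least
`c ∈ [0,∞]` with `‖T f‖_p ≤ c ‖f‖_p` for all `f` in `S`. -/
def lpOpNorm {E X : Type*} [MeasureSpace E] [NormedAddCommGroup X] (S : (E → X) → Prop)
    (T : (E → X) → E → X) (p : ℝ≥0∞) : ℝ≥0∞ :=
  sInf {c : ℝ≥0∞ | ∀ f, S f → eLpNorm (T f) p volume ≤ c * eLpNorm f p volume}

/-- The constant `c_{m,d} = 2 Γ((m+d)/2) / (Γ(d/2) Γ(m/2))`. -/
def rieszConst (m d : ℕ) : ℝ :=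
  2 * Real.Gamma (((m : ℝ) + d) / 2) / (Real.Gamma ((d : ℝ) / 2) * Real.Gamma ((m : ℝ) / 2))

end

end RieszPowers

/-! Write m = 2n + 1 and t = ξ_j/|ξ|. The multiplier of R_j^m is (-i t)^m = -i (-1)^n t^m, while the
Hilbert transform along a direction g has the multiplier -i sgn⟨g, ξ⟩. So R_j^m is an average of
directional Hilbert transforms as soon as some weight H satisfies ∫ H(g) sgn⟨g, ξ⟩ dγ(g) = (-1)^n
t^m for all ξ ≠ 0. For the standard Gaussian measure γ one can take H(g) = h(g_j) with h a multiple
of the Hermite polynomial He_m. Indeed the coordinates of g along e_j and along ξ/|ξ| are jointly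
Gaussian with correlation t, so the mean of He_m(g_j) given that the second coordinate is x equals
t^m He_m(x), and integrating He_m against the sign gives 2 (-1)^n (2n-1)!! φ(0), with φ the Gaussian
density, which fixes the factor (`exists_gaussian_multiplier`).

The mass ∫ |h| is at most m (`integral_abs_hermiteWeight_le`). For d = 1 one has t = ±1, so the
weight of the first power, up to sign, serves every odd power with mass at most 1. On the other side
c_{m,d} ≥ m for d ≥ 2, with equality at d = 2, and c_{m,1} ≥ 1 for odd m ≥ 3; the case excluded from
the first claim is c_{1,1} = 2/π < 1. The norm estimate does not pass through c_{m,d}: since m ≤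
m^(d/2) for d ≥ 2 and 1 ≤ m^(1/2), it holds with K = 1.

Given the average, the one-dimensional inequality is integrated over all lines parallel to g
(`lintegral_dirHilbert_le`). Then Jensen's inequality for the probability density |H| / ∫|H| passes
to the average; convexity and evenness of Ψ absorb the sign of H and replace the mass by the larger
constant (`ofReal_integral_smul_le`).

The analytic work is to justify the multipliers for iterated pointwise principal values.
Coefficients in X enter linearly, so scalar indicators of bounded convex sets suffice. Such an
indicator is locally Hölder off the frontier, a null set, and the Riesz transform preserves local
Hölder continuity at a point at the cost of a smaller exponent (`LocHolder.riesz`). Hence all powers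
exist off the same null set. Their multipliers come from smooth truncations: the Riesz kernel is a
superposition of Gaussians, and cutting the superposition parameter gives kernels with explicit
Fourier transforms (`fourier_truncKernel`). Passing to the limit both pointwise and in L² identifies
the transforms, and injectivity of the L² Fourier transform gives the identity almost everywhere
(`IsBody.rieszPow_ae_eq_average`). -/

namespace RieszPowers

/-! ### Fourier transforms in L² and multipliers of limits and convolutions. -/

section FourierL2

open FourierTransform SchwartzMap

variable {E : Type*} [NormedAddCommGroup E] [InnerProductSpace ℝ E] [FiniteDimensional ℝ E]
  [MeasurableSpace E] [BorelSpace E]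

/-- `u` is the `L²` Fourier transform of the square integrable function `g`. -/
def HasFT (g u : E → ℂ) : Prop :=
  ∃ (hg : MemLp g 2 volume) (hu : MemLp u 2 volume), 𝓕 (hg.toLp g) = hu.toLp u

/-- Plancherel makes the transform injective; this is how equality of multipliers becomes equality
of operators almost everywhere. -/
theorem HasFT.ae_eq {g g' u : E → ℂ} (h : HasFT g u) (h' : HasFT g' u) : g =ᵐ[volume] g' := by
  obtain ⟨hg, hu, e⟩ := h
  obtain ⟨hg', hu', e'⟩ := h'
  have h3 : (Lp.fourierTransformₗᵢ E ℂ) (hg.toLp g) = (Lp.fourierTransformₗᵢ E ℂ) (hg'.toLp g') :=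
    e.trans e'.symm
  exact (MemLp.toLp_eq_toLp_iff hg hg').1 ((Lp.fourierTransformₗᵢ E ℂ).injective h3)

theorem HasFT.congr {g g' u u' : E → ℂ} (h : HasFT g u) (hg : g =ᵐ[volume] g')
    (hu : u =ᵐ[volume] u') : HasFT g' u' := by
  obtain ⟨h1, h2, e⟩ := h
  refine ⟨h1.ae_eq hg, h2.ae_eq hu, ?_⟩
  rw [← (MemLp.toLp_eq_toLp_iff h1 (h1.ae_eq hg)).2 hg, e]
  exact (MemLp.toLp_eq_toLp_iff h2 (h2.ae_eq hu)).2 hu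

/-- On `L¹ ∩ L²` the `L²` Fourier transform is the Fourier integral. -/
theorem hasFT_fourierIntegral {h : E → ℂ} (h1 : Integrable h) (h2 : MemLp h 2 volume) :
    HasFT h (𝓕 h) := by
  have hc : Continuous (𝓕 h) := by
    have := VectorFourier.fourierIntegral_continuous (e := Real.fourierChar) (μ := volume)
      (L := innerₗ E) Real.continuous_fourierChar (by exact continuous_inner) h1
    exact this
  -- The two versions are compared as distributions: against a test function both reduce to the
  -- multiplication formula for Fourier integrals.
  have key : (𝓕 (h2.toLp h) : Lp ℂ 2 (volume : Measure E)) =ᵐ[volume] 𝓕 h := by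
    refine ae_eq_of_integral_contDiff_smul_eq
      ((Lp.memLp (𝓕 (h2.toLp h))).locallyIntegrable (by norm_num)) hc.locallyIntegrable ?_
    intro φ hφ hφc
    have hφ1 : HasCompactSupport (Complex.ofRealCLM ∘ φ) := hφc.comp_left rfl
    have hφ2 : ContDiff ℝ (⊤ : ℕ∞) (Complex.ofRealCLM ∘ φ) := by fun_prop
    have e1 := congrArg (fun T : 𝓢'(E, ℂ) => T (hφ1.toSchwartzMap hφ2))
      (Lp.fourier_toTemperedDistribution_eq (h2.toLp h))
    simp only [TemperedDistribution.fourier_apply, Lp.toTemperedDistribution_apply] at e1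
    have e2 : ∫ x, (𝓕 (hφ1.toSchwartzMap hφ2)) x • (h2.toLp h) x = ∫ x, 𝓕 (hφ1.toSchwartzMap hφ2) x • h x := by
      refine integral_congr_ae ?_
      filter_upwards [h2.coeFn_toLp] with x hx
      rw [hx]
    have e3 := VectorFourier.integral_fourierIntegral_smul_eq_flip (e := Real.fourierChar)
      (μ := volume) (ν := volume) (L := innerₗ E) Real.continuous_fourierChar
      (by exact continuous_inner) ((hφ1.toSchwartzMap hφ2).integrable (μ := volume)) h1
    rw [flip_innerₗ] at e3
    have e4 : ∫ x, 𝓕 (hφ1.toSchwartzMap hφ2) x • h x = ∫ x, (hφ1.toSchwartzMap hφ2) x • 𝓕 h x := by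
      rw [SchwartzMap.fourier_coe]
      exact e3
    rw [e2, e4] at e1
    simpa using e1.symm
  exact ⟨h2, (Lp.memLp (𝓕 (h2.toLp h))).ae_eq key, Lp.ext (key.trans (MemLp.coeFn_toLp _).symm)⟩

/-- On `L¹ ∩ L²` the `L²` inverse Fourier transform is the inverse Fourier integral. -/
theorem hasFT_fourierInv {v : E → ℂ} (h1 : Integrable v) (h2 : MemLp v 2 volume) :
    HasFT (𝓕⁻ v) v := by
  have hL : Continuous fun p : E × E => (-innerₗ E) p.1 p.2 := by
    simp only [LinearMap.neg_apply, innerₗ_apply_apply]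
    fun_prop
  have hc : Continuous (𝓕⁻ v) :=
    VectorFourier.fourierIntegral_continuous (e := Real.fourierChar) (μ := volume)
      (L := -innerₗ E) Real.continuous_fourierChar hL h1
  have key : (𝓕⁻ (h2.toLp v) : Lp ℂ 2 (volume : Measure E)) =ᵐ[volume] 𝓕⁻ v := by
    refine ae_eq_of_integral_contDiff_smul_eq
      ((Lp.memLp (𝓕⁻ (h2.toLp v))).locallyIntegrable (by norm_num)) hc.locallyIntegrable ?_
    intro φ hφ hφc
    have hφ1 : HasCompactSupport (Complex.ofRealCLM ∘ φ) := hφc.comp_left rfl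
    have hφ2 : ContDiff ℝ (⊤ : ℕ∞) (Complex.ofRealCLM ∘ φ) := by fun_prop
    have e1 := congrArg (fun T : 𝓢'(E, ℂ) => T (hφ1.toSchwartzMap hφ2))
      (Lp.fourierInv_toTemperedDistribution_eq (h2.toLp v))
    simp only [TemperedDistribution.fourierInv_apply, Lp.toTemperedDistribution_apply] at e1
    have e2 : ∫ x, (𝓕⁻ (hφ1.toSchwartzMap hφ2)) x • (h2.toLp v) x =
        ∫ x, 𝓕⁻ (hφ1.toSchwartzMap hφ2) x • v x := by
      refine integral_congr_ae ?_
      filter_upwards [h2.coeFn_toLp] with x hx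
      rw [hx]
    have e3 := VectorFourier.integral_fourierIntegral_smul_eq_flip (e := Real.fourierChar)
      (μ := volume) (ν := volume) (L := -innerₗ E) Real.continuous_fourierChar
      hL ((hφ1.toSchwartzMap hφ2).integrable (μ := volume)) h1
    have hflip : (-innerₗ E).flip = -innerₗ E := by
      ext a b
      simp [real_inner_comm]
    rw [hflip] at e3
    have e4 : ∫ x, 𝓕⁻ (hφ1.toSchwartzMap hφ2) x • v x =
        ∫ x, (hφ1.toSchwartzMap hφ2) x • 𝓕⁻ v x := by
      rw [SchwartzMap.fourierInv_coe]
      exact e3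
    rw [e2, e4] at e1
    simpa using e1.symm
  have hm : MemLp (𝓕⁻ v) 2 volume := (Lp.memLp (𝓕⁻ (h2.toLp v))).ae_eq key
  refine ⟨hm, h2, ?_⟩
  have : 𝓕⁻ (h2.toLp v) = hm.toLp (𝓕⁻ v) := Lp.ext (key.trans (MemLp.coeFn_toLp _).symm)
  rw [← this]
  exact fourier_fourierInv_eq _

/-- Dominated convergence in `L²`. -/
theorem tendsto_eLpNorm_two_of_dominated {f : ℕ → E → ℂ} {F : E → ℂ} {b : E → ℂ}
    (hf : ∀ n, AEStronglyMeasurable (f n) volume) (hb : MemLp b 2 volume)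
    (hle : ∀ n, ∀ᵐ x ∂(volume : Measure E), ‖f n x - F x‖ ≤ ‖b x‖)
    (hF : ∀ᵐ x ∂(volume : Measure E), Tendsto (fun n => f n x) atTop (𝓝 (F x))) :
    Tendsto (fun n => eLpNorm (f n - F) 2 volume) atTop (𝓝 0) := by
  have hFm : AEStronglyMeasurable F volume := aestronglyMeasurable_of_tendsto_ae _ hf hF
  have h0 : Tendsto (fun n => ∫⁻ x, ‖(f n - F) x‖ₑ ^ (2 : ℝ)) atTop
      (𝓝 (∫⁻ _ : E, 0)) := by
    refine tendsto_lintegral_of_dominated_convergence' (fun x => ‖b x‖ₑ ^ (2 : ℝ)) ?_ ?_ ?_ ?_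
    · intro n
      exact ((hf n).sub hFm).enorm.pow_const _
    · intro n
      filter_upwards [hle n] with x hx
      refine ENNReal.rpow_le_rpow ?_ (by norm_num)
      exact enorm_le_iff_norm_le.2 hx
    · have := lintegral_rpow_enorm_lt_top_of_eLpNorm_lt_top (p := 2) (by norm_num) (by norm_num) hb.2
      simpa using this.ne
    · filter_upwards [hF] with x hx
      have h1 : Tendsto (fun n => ‖(f n - F) x‖ₑ) atTop (𝓝 0) := by
        have := (hx.sub_const (F x)).enorm
        simpa using this
      have h2 := h1.ennrpow_const 2
      simpa using h2
  have h3 := h0.ennrpow_const (1 / 2)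
  simp only [lintegral_zero] at h3
  rw [ENNReal.zero_rpow_of_pos (by norm_num)] at h3
  refine h3.congr fun n => ?_
  rw [eLpNorm_eq_lintegral_rpow_enorm_toReal (by norm_num) (by norm_num)]
  simp

/-- The limit of `L²` functions whose Fourier transforms are `p n * u` with uniformly bounded,
pointwise convergent multipliers `p n`. -/
theorem HasFT.of_tendsto {w : ℕ → E → ℂ} {p : ℕ → E → ℂ} {G u q : E → ℂ} {C : ℝ}
    (hw : ∀ n, HasFT (w n) (fun ξ => p n ξ * u ξ))
    (hu : MemLp u 2 volume) (hpm : ∀ n, AEStronglyMeasurable (p n) volume)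
    (hpC : ∀ n ξ, ‖p n ξ‖ ≤ C)
    (hp : ∀ᵐ ξ ∂(volume : Measure E), Tendsto (fun n => p n ξ) atTop (𝓝 (q ξ)))
    (hG : ∀ᵐ x ∂(volume : Measure E), Tendsto (fun n => w n x) atTop (𝓝 (G x))) :
    HasFT G (fun ξ => q ξ * u ξ) := by
  have hqm : AEStronglyMeasurable q volume := aestronglyMeasurable_of_tendsto_ae _ hpm hp
  have hqC : ∀ᵐ ξ ∂(volume : Measure E), ‖q ξ‖ ≤ C := by
    filter_upwards [hp] with ξ h
    exact le_of_tendsto h.norm (Eventually.of_forall fun n => hpC n ξ)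
  have hqu : MemLp (fun ξ => q ξ * u ξ) 2 volume :=
    MemLp.of_le_mul (c := C) hu (hqm.mul hu.1) (by
      filter_upwards [hqC] with ξ h
      rw [norm_mul]; gcongr)
  choose hw1 hw2 hw3 using hw
  -- The transforms converge in L², dominated by 2C|u|, so by Plancherel the functions do too. An
  -- almost everywhere convergent subsequence then identifies the L² limit with the pointwise limit.
  have hlim : Tendsto (fun n => (hw2 n).toLp _) atTop (𝓝 (hqu.toLp _)) := by
    rw [Lp.tendsto_Lp_iff_tendsto_eLpNorm'']
    refine tendsto_eLpNorm_two_of_dominated (b := fun ξ => ((2 * C : ℝ) : ℂ) * u ξ)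
      (fun n => (hw2 n).1) (hu.const_mul _) ?_ ?_
    · intro n
      filter_upwards [hqC] with ξ h
      have hC : 0 ≤ C := (norm_nonneg _).trans h
      rw [← sub_mul, norm_mul, norm_mul, Complex.norm_real, Real.norm_of_nonneg (by positivity)]
      gcongr
      calc ‖p n ξ - q ξ‖ ≤ ‖p n ξ‖ + ‖q ξ‖ := norm_sub_le _ _
        _ ≤ 2 * C := by linarith [hpC n ξ]
    · filter_upwards [hp] with ξ h
      exact h.mul_const _
  let W : Lp ℂ 2 (volume : Measure E) := (Lp.fourierTransformₗᵢ E ℂ).symm (hqu.toLp _)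
  have hlim2 : Tendsto (fun n => (hw1 n).toLp (w n)) atTop (𝓝 W) := by
    have h5 := ((Lp.fourierTransformₗᵢ E ℂ).symm.continuous.tendsto _).comp hlim
    refine h5.congr fun n => ?_
    have h6 : (Lp.fourierTransformₗᵢ E ℂ) ((hw1 n).toLp (w n)) = (hw2 n).toLp _ := hw3 n
    simp [← h6]
  obtain ⟨ns, hns, hae⟩ := (tendstoInMeasure_of_tendsto_Lp hlim2).exists_seq_tendsto_ae
  have hall : ∀ᵐ x ∂(volume : Measure E), ∀ n, (hw1 n).toLp (w n) x = w n x :=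
    ae_all_iff.2 fun n => (hw1 n).coeFn_toLp
  have hWG : (W : E → ℂ) =ᵐ[volume] G := by
    filter_upwards [hae, hG, hall] with x h1 h2 h3
    refine tendsto_nhds_unique h1 ?_
    simpa only [h3, Function.comp_def] using h2.comp hns.tendsto_atTop
  have hGm : MemLp G 2 volume := (Lp.memLp W).ae_eq hWG
  refine ⟨hGm, hqu, ?_⟩
  have : hGm.toLp G = W := Lp.ext ((MemLp.coeFn_toLp _).trans hWG.symm)
  rw [this]
  exact (Lp.fourierTransformₗᵢ E ℂ).apply_symm_apply _

theorem fourier_norm_le {k : E → ℂ} (ξ : E) : ‖𝓕 k ξ‖ ≤ ∫ y, ‖k y‖ :=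
  VectorFourier.norm_fourierIntegral_le_integral_norm _ _ _ _ _

theorem fourier_continuous {k : E → ℂ} (hk : Integrable k) : Continuous (𝓕 k) :=
  VectorFourier.fourierIntegral_continuous (e := Real.fourierChar) (μ := volume)
      (L := innerₗ E) Real.continuous_fourierChar (by exact continuous_inner) hk

/-- Convolution of an `L²` function with a real kernel in `L¹ ∩ L²`. -/
theorem HasFT.convolution {g u : E → ℂ} (hgu : HasFT g u) {k : E → ℝ} (hk1 : Integrable k)
    (hk2 : MemLp k 2 volume) :
    HasFT (fun x => ∫ y, (k y : ℂ) * g (x - y)) (fun ξ => 𝓕 (fun y => (k y : ℂ)) ξ * u ξ) := by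
  obtain ⟨hg, hu, hFT⟩ := hgu
  have hk1' : Integrable (fun y => (k y : ℂ)) := hk1.ofReal
  have hk2' : MemLp (fun y => (k y : ℂ)) 2 volume := hk2.ofReal
  obtain ⟨-, hkF, -⟩ := hasFT_fourierIntegral hk1' hk2'
  have hv1 : Integrable (fun ξ => 𝓕 (fun y => (k y : ℂ)) ξ * u ξ) := hkF.integrable_mul hu
  have hv2 : MemLp (fun ξ => 𝓕 (fun y => (k y : ℂ)) ξ * u ξ) 2 volume :=
    MemLp.of_le_mul (c := ∫ y, ‖(k y : ℂ)‖) hu hv1.1 (Eventually.of_forall fun ξ => by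
      rw [norm_mul]; gcongr; exact fourier_norm_le ξ)
  -- For each fixed x this is Parseval's identity for the reflected translate y ↦ k(x - y) and g;
  -- since k is real, the conjugation only turns the transform of the reflection back into that of
  -- k.
  have key : 𝓕⁻ (fun ξ => 𝓕 (fun y => (k y : ℂ)) ξ * u ξ) = fun x => ∫ y, (k y : ℂ) * g (x - y) := by
    funext x
    have hA1 : Integrable (fun y => (k (x - y) : ℂ)) := hk1'.comp_sub_left x
    have hA2 : MemLp (fun y => (k (x - y) : ℂ)) 2 volume :=
      hk2'.comp_measurePreserving (Measure.measurePreserving_sub_left volume x)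
    obtain ⟨hA2', hAF, hA3⟩ := hasFT_fourierIntegral hA1 hA2
    have e1 := Lp.inner_fourier_eq (hA2.toLp _) (hg.toLp g)
    rw [hA3, hFT, L2.inner_def, L2.inner_def] at e1
    have e2 : ∫ y, inner ℂ (hA2.toLp _ y) (hg.toLp g y) = ∫ y, (k y : ℂ) * g (x - y) := by
      rw [← integral_sub_left_eq_self (fun y => (k y : ℂ) * g (x - y)) volume x]
      refine integral_congr_ae ?_
      filter_upwards [hA2.coeFn_toLp, hg.coeFn_toLp] with y h1 h2
      rw [h1, h2]
      simp [mul_comm]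
    have e3 : ∫ ξ, inner ℂ (hAF.toLp _ ξ) (hu.toLp u ξ) =
        𝓕⁻ (fun ξ => 𝓕 (fun y => (k y : ℂ)) ξ * u ξ) x := by
      rw [Real.fourierInv_eq]
      refine integral_congr_ae ?_
      filter_upwards [hAF.coeFn_toLp, hu.coeFn_toLp] with ξ h1 h2
      rw [h1, h2]
      have e4 : (starRingEnd ℂ) (𝓕 (fun y => (k (x - y) : ℂ)) ξ) =
          (Real.fourierChar (inner ℝ ξ x) : ℂ) * 𝓕 (fun y => (k y : ℂ)) ξ := by
        rw [Real.fourier_eq, Real.fourier_eq, ← integral_conj, ← integral_const_mul,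
          ← integral_sub_left_eq_self _ volume x]
        refine integral_congr_ae (Eventually.of_forall fun y => ?_)
        simp only [sub_sub_cancel, Circle.smul_def, smul_eq_mul, map_mul, Complex.conj_ofReal,
          ← mul_assoc]
        congr 1
        rw [← Circle.coe_inv_eq_conj, ← AddChar.map_neg_eq_inv, ← Circle.coe_mul,
          ← AddChar.map_add_eq_mul]
        congr 2
        rw [neg_neg, inner_sub_left, real_inner_comm x ξ]
        ring
      rw [RCLike.inner_apply, e4, Circle.smul_def, smul_eq_mul]
      ring
    rw [← e3, e1, e2]
  rw [← key]
  exact hasFT_fourierInv hv1 hv2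

end FourierL2

end RieszPowers

namespace RieszPowers

/-! ### Riesz kernels as superpositions of Gaussians, and their smooth truncations. -/

section GaussianKernels

open FourierTransform

/-- The constant `Γ((D+1)/2) / π^((D+1)/2)` of the Riesz kernel. -/
noncomputable def rieszKernelConst (D : ℕ) : ℝ :=
  Real.Gamma (((D : ℝ) + 1) / 2) / Real.pi ^ (((D : ℝ) + 1) / 2)

theorem rieszKernelConst_pos (D : ℕ) : 0 < rieszKernelConst D := by
  unfold rieszKernelConst
  have := Real.Gamma_pos_of_pos (s := ((D : ℝ) + 1) / 2) (by positivity)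
  have := Real.pi_pos
  positivity

/-- The Fourier side always involves the profile with D = 0, which therefore tends to 1/r with no
constant; the limiting multiplier is exactly -i⟨a, ξ⟩/|ξ|. -/
theorem rieszKernelConst_zero : rieszKernelConst 0 = 1 := by
  simp only [rieszKernelConst, CharP.cast_eq_zero, zero_add]
  rw [Real.Gamma_one_half_eq, Real.sqrt_eq_rpow]
  exact div_self (by have := Real.pi_pos; positivity)

/-- A smooth truncation of `r ↦ rieszKernelConst D / r ^ (D + 1)`. -/
noncomputable def truncProfile (D n : ℕ) (r : ℝ) : ℝ :=
  ∫ s in Set.Ioc (1 / ((n : ℝ) + 1)) ((n : ℝ) + 1), 2 * s ^ D * Real.exp (-(Real.pi * s ^ 2 * r ^ 2))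

theorem integrableOn_pow_mul_gaussian (D : ℕ) {r : ℝ} (hr : 0 < r) :
    IntegrableOn (fun s : ℝ => 2 * s ^ D * Real.exp (-(Real.pi * s ^ 2 * r ^ 2))) (Set.Ioi 0) := by
  have h := (integrable_rpow_mul_exp_neg_mul_sq (b := Real.pi * r ^ 2) (by positivity) (s := D)
    (by have : (0 : ℝ) ≤ D := D.cast_nonneg
        linarith)).const_mul 2
  refine (h.congr (Eventually.of_forall fun s => ?_)).integrableOn
  simp only [Real.rpow_natCast]
  rw [← mul_assoc]
  congr 2
  ring

/-- A Gamma integral. It shows why the truncation is made in the Gaussian parameter s: the full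
range of s reproduces the Riesz kernel with its exact constant. -/
theorem integral_pow_mul_gaussian (D : ℕ) {r : ℝ} (hr : 0 < r) :
    ∫ s in Set.Ioi (0 : ℝ), 2 * s ^ D * Real.exp (-(Real.pi * s ^ 2 * r ^ 2)) =
      rieszKernelConst D / r ^ (D + 1) := by
  have h := integral_rpow_mul_exp_neg_mul_rpow (p := 2) (q := D) (b := Real.pi * r ^ 2) (by norm_num)
    (by have : (0 : ℝ) ≤ D := D.cast_nonneg
        linarith) (by positivity)
  have h2 : ∫ s in Set.Ioi (0 : ℝ), 2 * s ^ D * Real.exp (-(Real.pi * s ^ 2 * r ^ 2)) =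
      2 * ∫ s in Set.Ioi (0 : ℝ), s ^ (D : ℝ) * Real.exp (-(Real.pi * r ^ 2) * s ^ (2 : ℝ)) := by
    rw [← integral_const_mul]
    refine integral_congr_ae (Eventually.of_forall fun s => ?_)
    simp only [Real.rpow_natCast, Real.rpow_ofNat]
    rw [← mul_assoc]
    congr 2
    ring
  rw [h2, h, rieszKernelConst, neg_div, Real.rpow_neg (by positivity),
    Real.mul_rpow Real.pi_pos.le (by positivity), ← Real.rpow_natCast r 2, ← Real.rpow_mul hr.le,
    ← Real.rpow_natCast r (D + 1)]
  have e : ((2 : ℕ) : ℝ) * ((D + 1) / 2) = ((D + 1 : ℕ) : ℝ) := by push_cast; ring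
  rw [e]
  have := Real.rpow_pos_of_pos Real.pi_pos (((D : ℝ) + 1) / 2)
  have := Real.rpow_pos_of_pos hr ((D + 1 : ℕ) : ℝ)
  field_simp

theorem truncProfile_nonneg (D n : ℕ) (r : ℝ) : 0 ≤ truncProfile D n r := by
  refine setIntegral_nonneg measurableSet_Ioc fun s hs => ?_
  have : 0 < s := lt_trans (by positivity) hs.1
  positivity

theorem truncProfile_le (D n : ℕ) {r : ℝ} (hr : 0 < r) :
    truncProfile D n r ≤ rieszKernelConst D / r ^ (D + 1) := by
  rw [← integral_pow_mul_gaussian D hr]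
  refine setIntegral_mono_set (integrableOn_pow_mul_gaussian D hr) ?_ ?_
  · filter_upwards [ae_restrict_mem measurableSet_Ioi] with s hs
    have : 0 < s := hs
    positivity
  · refine LE.le.eventuallyLE fun s hs => ?_
    exact lt_trans (by positivity) hs.1

theorem tendsto_truncProfile (D : ℕ) {r : ℝ} (hr : 0 < r) :
    Tendsto (fun n => truncProfile D n r) atTop (𝓝 (rieszKernelConst D / r ^ (D + 1))) := by
  rw [← integral_pow_mul_gaussian D hr]
  have hU : (⋃ n : ℕ, Set.Ioc (1 / ((n : ℝ) + 1)) ((n : ℝ) + 1)) = Set.Ioi 0 := by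
    ext s
    simp only [Set.mem_iUnion, Set.mem_Ioc, Set.mem_Ioi]
    constructor
    · rintro ⟨n, h, -⟩
      exact lt_trans (by positivity) h
    · intro h
      obtain ⟨n, hn⟩ := exists_nat_one_div_lt h
      obtain ⟨k, hk⟩ := exists_nat_ge s
      refine ⟨max n k, lt_of_le_of_lt ?_ hn, ?_⟩
      · have : (n : ℝ) ≤ (max n k : ℕ) := by exact_mod_cast le_max_left n k
        gcongr
      · have : (k : ℝ) ≤ (max n k : ℕ) := by exact_mod_cast le_max_right n k
        linarith
  rw [← hU]
  refine tendsto_setIntegral_of_monotone (fun n => measurableSet_Ioc) ?_ ?_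
  · intro n k hnk
    have : (n : ℝ) ≤ k := by exact_mod_cast hnk
    refine Set.Ioc_subset_Ioc ?_ ?_
    · gcongr
    · linarith
  · rw [hU]
    exact integrableOn_pow_mul_gaussian D hr

/-- Substitute s ↦ 1/s. The truncation interval is symmetric under inversion, so the Fourier
transform of a truncated kernel is expressed by a profile with the same n. -/
theorem truncProfile_zero_eq (n : ℕ) (r : ℝ) :
    ∫ s in Set.Ioc (1 / ((n : ℝ) + 1)) ((n : ℝ) + 1),
      2 * (s ^ 2)⁻¹ * Real.exp (-(Real.pi * r ^ 2 / s ^ 2)) = truncProfile 0 n r := by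
  have hN : (0 : ℝ) < (n : ℝ) + 1 := by positivity
  have hle : 1 / ((n : ℝ) + 1) ≤ (n : ℝ) + 1 := by
    rw [div_le_iff₀ hN]
    nlinarith [n.cast_nonneg (α := ℝ)]
  unfold truncProfile
  rw [← intervalIntegral.integral_of_le hle, ← intervalIntegral.integral_of_le hle]
  have h := intervalIntegral.integral_comp_mul_deriv (a := 1 / ((n : ℝ) + 1)) (b := (n : ℝ) + 1)
    (f := fun s => s⁻¹) (f' := fun s => -(s ^ 2)⁻¹)
    (g := fun s : ℝ => 2 * s ^ 0 * Real.exp (-(Real.pi * s ^ 2 * r ^ 2))) ?_ ?_ (by fun_prop)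
  · rw [one_div, inv_inv] at h
    have h' := h.trans (intervalIntegral.integral_symm _ _)
    rw [one_div, ← neg_eq_iff_eq_neg.2 h', ← intervalIntegral.integral_neg]
    refine intervalIntegral.integral_congr fun s _ => ?_
    simp only [Function.comp]
    have : Real.pi * s⁻¹ ^ 2 * r ^ 2 = Real.pi * r ^ 2 / s ^ 2 := by
      rw [inv_pow]; ring
    rw [this]
    ring
  · intro s hs
    rw [Set.uIcc_of_le hle] at hs
    exact hasDerivAt_inv (lt_of_lt_of_le (by positivity) hs.1).ne'
  · refine ContinuousOn.neg (ContinuousOn.inv₀ (by fun_prop) ?_)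
    intro s hs
    rw [Set.uIcc_of_le hle] at hs
    exact pow_ne_zero _ (lt_of_lt_of_le (by positivity) hs.1).ne'

variable {V : Type*} [NormedAddCommGroup V] [InnerProductSpace ℝ V] [FiniteDimensional ℝ V]
  [MeasurableSpace V] [BorelSpace V]

theorem integrable_pow_mul_exp_neg_sq_norm (k : ℕ) {c : ℝ} (hc : 0 < c) :
    Integrable (fun v : V => ‖v‖ ^ k * Real.exp (-(c * ‖v‖ ^ 2))) := by
  have h1 : Integrable (fun v : V => Real.exp (-(c / 2 * ‖v‖ ^ 2))) := by
    have h := (GaussianFourier.integrable_cexp_neg_mul_sq_norm_add (V := V) (b := ((c / 2 : ℝ) : ℂ))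
      (by simpa using hc) 0 0).norm
    refine h.congr (Eventually.of_forall fun v => ?_)
    simp only [zero_mul, add_zero, Complex.norm_exp]
    congr 1
    norm_cast
    simp
  -- Half of the exponent absorbs the power; the other half remains integrable.
  obtain ⟨B, hB⟩ : ∃ B, ∀ r : ℝ, 0 ≤ r → r ^ k * Real.exp (-(c / 2 * r ^ 2)) ≤ B := by
    have hcont : Continuous fun r : ℝ => r ^ k * Real.exp (-(c / 2 * r ^ 2)) := by fun_prop
    have hlim : Tendsto (fun r : ℝ => r ^ k * Real.exp (-(c / 2 * r ^ 2))) atTop (𝓝 0) := by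
      have h := (rpow_mul_exp_neg_mul_sq_isLittleO_exp_neg (b := c / 2) (by positivity) k).trans_tendsto
        (Real.tendsto_exp_atBot.comp (tendsto_id.const_mul_atTop_of_neg (by norm_num)))
      refine h.congr fun r => ?_
      simp only [Real.rpow_natCast, neg_mul]
    have hev := hlim.eventually (gt_mem_nhds (zero_lt_one' ℝ))
    obtain ⟨R, hR⟩ := eventually_atTop.1 hev
    obtain ⟨B, hB⟩ := (isCompact_Icc (a := (0 : ℝ)) (b := R)).bddAbove_image hcont.continuousOn
    refine ⟨max B 1, fun r hr => ?_⟩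
    rcases le_total r R with h | h
    · exact (hB ⟨r, ⟨hr, h⟩, rfl⟩).trans (le_max_left _ _)
    · exact (hR r h).le.trans (le_max_right _ _)
  refine (h1.const_mul B).mono' (by fun_prop) (Eventually.of_forall fun v => ?_)
  rw [Real.norm_of_nonneg (by positivity)]
  have h2 : Real.exp (-(c * ‖v‖ ^ 2)) =
      Real.exp (-(c / 2 * ‖v‖ ^ 2)) * Real.exp (-(c / 2 * ‖v‖ ^ 2)) := by
    rw [← Real.exp_add]; congr 1; ring
  rw [h2, ← mul_assoc]
  exact mul_le_mul_of_nonneg_right (hB _ (norm_nonneg v)) (Real.exp_pos _).le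

theorem fourier_gaussian_real {s : ℝ} (hs : 0 < s) (ξ : V) :
    𝓕 (fun v : V => ((Real.exp (-(Real.pi * s ^ 2 * ‖v‖ ^ 2)) : ℝ) : ℂ)) ξ =
      (((s ^ Module.finrank ℝ V)⁻¹ * Real.exp (-(Real.pi * ‖ξ‖ ^ 2 / s ^ 2)) : ℝ) : ℂ) := by
  have h := fourier_gaussian_innerProductSpace (V := V) (b := ((Real.pi * s ^ 2 : ℝ) : ℂ))
    (by simp only [Complex.ofReal_re]; have := Real.pi_pos; positivity) ξ
  have e1 : (fun v : V => ((Real.exp (-(Real.pi * s ^ 2 * ‖v‖ ^ 2)) : ℝ) : ℂ)) =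
      fun v : V => Complex.exp (-((Real.pi * s ^ 2 : ℝ) : ℂ) * ‖v‖ ^ 2) := by
    funext v; push_cast; congr 1; ring
  rw [e1, h]
  push_cast
  congr 1
  · have hpi : (Real.pi : ℂ) ≠ 0 := by exact_mod_cast Real.pi_ne_zero
    have hsc : (s : ℂ) ≠ 0 := by exact_mod_cast hs.ne'
    have e2 : (Real.pi : ℂ) / (Real.pi * s ^ 2) = (((s ^ 2)⁻¹ : ℝ) : ℂ) := by
      push_cast; field_simp
    have e3 : ((Module.finrank ℝ V : ℂ) / 2) = (((Module.finrank ℝ V : ℝ) / 2 : ℝ) : ℂ) := by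
      push_cast; rfl
    rw [e2, e3, ← Complex.ofReal_cpow (by positivity), Real.inv_rpow (by positivity),
      ← Real.rpow_natCast s 2, ← Real.rpow_mul hs.le]
    have e4 : ((2 : ℕ) : ℝ) * ((Module.finrank ℝ V : ℝ) / 2) = (Module.finrank ℝ V : ℝ) := by
      push_cast; ring
    rw [e4, Real.rpow_natCast]
    push_cast; rfl
  · congr 1
    have hpi : (Real.pi : ℂ) ≠ 0 := by exact_mod_cast Real.pi_ne_zero
    have hsc : (s : ℂ) ≠ 0 := by exact_mod_cast hs.ne'
    field_simp

/-- The Fourier transform of `⟨a, v⟩ exp(-π s² |v|²)`. -/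
theorem fourier_inner_mul_gaussian (a : V) {s : ℝ} (hs : 0 < s) (ξ : V) :
    𝓕 (fun v : V => ((inner ℝ a v * Real.exp (-(Real.pi * s ^ 2 * ‖v‖ ^ 2)) : ℝ) : ℂ)) ξ =
      -Complex.I * ((inner ℝ a ξ * ((s ^ (Module.finrank ℝ V + 2))⁻¹ *
        Real.exp (-(Real.pi * ‖ξ‖ ^ 2 / s ^ 2))) : ℝ) : ℂ) := by
  have hc : 0 < Real.pi * s ^ 2 := by have := Real.pi_pos; positivity
  set f : V → ℂ := fun v => ((Real.exp (-(Real.pi * s ^ 2 * ‖v‖ ^ 2)) : ℝ) : ℂ) with hf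
  set D : V → V →L[ℝ] ℂ := fun v => Complex.ofRealCLM.comp
    (Real.exp (-(Real.pi * s ^ 2 * ‖v‖ ^ 2)) • -((Real.pi * s ^ 2) • (2 • innerSL ℝ v))) with hD
  have hder : ∀ v, HasFDerivAt f (D v) v := by
    intro v
    have h1 : HasFDerivAt (fun v : V => ‖v‖ ^ 2) (2 • innerSL ℝ v) v := (hasStrictFDerivAt_norm_sq v).hasFDerivAt
    have h2 := ((h1.const_mul (Real.pi * s ^ 2)).neg).exp
    exact Complex.ofRealCLM.hasFDerivAt.comp v h2
  have hfd : fderiv ℝ f = D := funext fun v => (hder v).fderiv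
  have hfi : Integrable f := by
    have := integrable_pow_mul_exp_neg_sq_norm (V := V) 0 hc
    simp only [pow_zero, one_mul] at this
    exact this.ofReal
  have hDi : Integrable D := by
    refine ((integrable_pow_mul_exp_neg_sq_norm (V := V) 1 hc).const_mul (2 * (Real.pi * s ^ 2))).mono'
      (by fun_prop) (Eventually.of_forall fun v => ?_)
    refine ContinuousLinearMap.opNorm_le_bound _ (by positivity) fun w => ?_
    simp only [hD, ContinuousLinearMap.comp_apply, Complex.ofRealCLM_apply, Complex.norm_real,
      smul_apply, neg_apply, innerSL_apply_apply, norm_smul,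
      norm_neg, Real.norm_of_nonneg (Real.exp_pos _).le, Real.norm_of_nonneg hc.le, pow_one, nsmul_eq_mul,
      norm_mul]
    have := norm_inner_le_norm (𝕜 := ℝ) v w
    have h3 : ‖((2 : ℕ) : ℝ)‖ = 2 := by norm_num
    rw [h3]
    calc _ = 2 * (Real.pi * s ^ 2) * Real.exp (-(Real.pi * s ^ 2 * ‖v‖ ^ 2)) * ‖inner ℝ v w‖ := by ring
      _ ≤ 2 * (Real.pi * s ^ 2) * Real.exp (-(Real.pi * s ^ 2 * ‖v‖ ^ 2)) * (‖v‖ * ‖w‖) := by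
        gcongr
      _ = _ := by ring
  -- The derivative of the Gaussian along a is -2πs² times the function in question, and the Fourier
  -- transform turns that derivative into multiplication by 2πi⟨a, ξ⟩.
  have h := congrArg (fun F => F ξ a) (Real.fourier_fderiv hfi (fun v => (hder v).differentiableAt)
    (by rw [hfd]; exact hDi))
  rw [hfd] at h
  have h4 : 𝓕 D ξ a = 𝓕 (fun v => D v a) ξ :=
    Real.fourier_continuousLinearMap_apply hDi
  rw [h4] at h
  have h5 : (fun v => D v a) = fun v => (-(2 * (Real.pi * s ^ 2)) : ℂ) •
      ((inner ℝ a v * Real.exp (-(Real.pi * s ^ 2 * ‖v‖ ^ 2)) : ℝ) : ℂ) := by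
    funext v
    simp only [hD, ContinuousLinearMap.comp_apply, Complex.ofRealCLM_apply,
      smul_apply, neg_apply, innerSL_apply_apply,
      real_inner_comm v a, smul_eq_mul, nsmul_eq_mul]
    push_cast
    ring
  have h6 : 𝓕 (fun v => D v a) ξ = (-(2 * (Real.pi * s ^ 2)) : ℂ) *
      𝓕 (fun v : V => ((inner ℝ a v * Real.exp (-(Real.pi * s ^ 2 * ‖v‖ ^ 2)) : ℝ) : ℂ)) ξ := by
    rw [h5, Real.fourier_eq, Real.fourier_eq, ← integral_const_mul]
    refine integral_congr_ae (Eventually.of_forall fun v => ?_)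
    simp only [Circle.smul_def, smul_eq_mul]
    ring
  rw [h6, VectorFourier.fourierSMulRight_apply, hf, fourier_gaussian_real hs] at h
  have hne : (-(2 * (Real.pi * s ^ 2)) : ℂ) ≠ 0 := by
    have := hc.ne'
    rw [neg_ne_zero]
    exact mul_ne_zero two_ne_zero (by exact_mod_cast this)
  refine mul_left_cancel₀ hne (h.trans ?_)
  have hsc : (s : ℂ) ≠ 0 := by exact_mod_cast hs.ne'
  have h7 : (-innerSL ℝ) ξ a = -inner ℝ a ξ := by
    rw [neg_apply, neg_apply, innerSL_apply_apply, real_inner_comm]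
  rw [h7]
  simp only [Complex.real_smul, smul_eq_mul, pow_add]
  push_cast
  field_simp

/-- The smoothly truncated Riesz kernel in the direction `a`. -/
noncomputable def truncKernel (a : V) (n : ℕ) (v : V) : ℝ :=
  inner ℝ a v * truncProfile (Module.finrank ℝ V) n ‖v‖

theorem integrable_prod_truncKernel (a : V) (n : ℕ) :
    Integrable (fun p : V × ℝ => inner ℝ a p.1 * (2 * p.2 ^ Module.finrank ℝ V *
      Real.exp (-(Real.pi * p.2 ^ 2 * ‖p.1‖ ^ 2))))
      (volume.prod (volume.restrict (Set.Ioc (1 / ((n : ℝ) + 1)) ((n : ℝ) + 1)))) := by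
  have hc : 0 < Real.pi * (1 / ((n : ℝ) + 1)) ^ 2 := by have := Real.pi_pos; positivity
  have h := ((integrable_pow_mul_exp_neg_sq_norm (V := V) 1 hc).const_mul
    (2 * ((n : ℝ) + 1) ^ Module.finrank ℝ V * ‖a‖)).mul_prod
    (integrable_const (1 : ℝ) (μ := volume.restrict (Set.Ioc (1 / ((n : ℝ) + 1)) ((n : ℝ) + 1))))
  refine h.mono' (Continuous.aestronglyMeasurable (by fun_prop)) ?_
  have hmem : ∀ᵐ p ∂((volume : Measure V).prod
      (volume.restrict (Set.Ioc (1 / ((n : ℝ) + 1)) ((n : ℝ) + 1)))),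
      p.2 ∈ Set.Ioc (1 / ((n : ℝ) + 1)) ((n : ℝ) + 1) :=
    Measure.quasiMeasurePreserving_snd.ae (ae_restrict_mem measurableSet_Ioc)
  filter_upwards [hmem] with p hp
  have hp0 : 0 < p.2 := lt_trans (by positivity) hp.1
  rw [norm_mul, Real.norm_of_nonneg (r := 2 * _ * _) (by positivity)]
  have h1 := norm_inner_le_norm (𝕜 := ℝ) a p.1
  have h2 := hp.1.le
  have h3 := hp.2
  calc _ ≤ (‖a‖ * ‖p.1‖) * (2 * ((n : ℝ) + 1) ^ Module.finrank ℝ V *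
      Real.exp (-(Real.pi * (1 / ((n : ℝ) + 1)) ^ 2 * ‖p.1‖ ^ 2))) := by gcongr
    _ = _ := by ring

theorem integrable_truncKernel (a : V) (n : ℕ) : Integrable (truncKernel a n) := by
  refine (integrable_prod_truncKernel a n).integral_prod_left.congr (Eventually.of_forall fun v => ?_)
  simp only [truncKernel, truncProfile]
  rw [integral_const_mul]

theorem memLp_truncKernel (a : V) (n : ℕ) : MemLp (truncKernel a n) 2 volume := by
  set N : ℝ := (n : ℝ) + 1 with hN
  have hN0 : 0 < N := by positivity
  set c : ℝ := Real.pi * (1 / N) ^ 2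
  have hc : 0 < c := by have := Real.pi_pos; positivity
  have h1 : MemLp (fun v : V => ‖v‖ * Real.exp (-(c * ‖v‖ ^ 2))) 2 volume := by
    rw [memLp_two_iff_integrable_sq (by fun_prop)]
    refine (integrable_pow_mul_exp_neg_sq_norm (V := V) 2 (c := 2 * c) (by positivity)).congr
      (Eventually.of_forall fun v => ?_)
    simp only [mul_pow, ← Real.exp_nat_mul]
    congr 2
    push_cast
    ring
  refine h1.of_le_mul (c := ‖a‖ * (2 * N ^ Module.finrank ℝ V * N)) (integrable_truncKernel a n).1
    (Eventually.of_forall fun v => ?_)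
  rw [truncKernel, norm_mul, Real.norm_of_nonneg (r := ‖v‖ * _) (by positivity)]
  have h2 : ‖truncProfile (Module.finrank ℝ V) n ‖v‖‖ ≤
      (2 * N ^ Module.finrank ℝ V * Real.exp (-(c * ‖v‖ ^ 2))) * (N - 1 / N) := by
    have hle : 1 / N ≤ N := by
      rw [div_le_iff₀ hN0]
      nlinarith [n.cast_nonneg (α := ℝ)]
    have h3 := norm_setIntegral_le_of_norm_le_const (μ := volume) (s := Set.Ioc (1 / N) N)
      (f := fun s => 2 * s ^ Module.finrank ℝ V * Real.exp (-(Real.pi * s ^ 2 * ‖v‖ ^ 2)))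
      (C := 2 * N ^ Module.finrank ℝ V * Real.exp (-(c * ‖v‖ ^ 2))) (by simp) (fun s hs => by
        have hs0 : 0 < s := lt_trans (by positivity) hs.1
        rw [Real.norm_of_nonneg (by positivity)]
        have h4 := hs.1.le
        have h5 := hs.2
        simp only [c]
        gcongr)
    rw [Real.volume_real_Ioc_of_le hle] at h3
    exact h3
  calc _ ≤ (‖a‖ * ‖v‖) * ((2 * N ^ Module.finrank ℝ V * Real.exp (-(c * ‖v‖ ^ 2))) * (N - 1 / N)) := by
        gcongr
        exact norm_inner_le_norm a v
    _ ≤ (‖a‖ * ‖v‖) * ((2 * N ^ Module.finrank ℝ V * Real.exp (-(c * ‖v‖ ^ 2))) * N) := by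
        gcongr
        have : 0 ≤ 1 / N := by positivity
        linarith
    _ = _ := by ring

/-- The Fourier transform of `truncKernel`. -/
theorem fourier_truncKernel (a : V) (n : ℕ) (ξ : V) :
    𝓕 (fun v => (truncKernel a n v : ℂ)) ξ =
      -Complex.I * ((inner ℝ a ξ * truncProfile 0 n ‖ξ‖ : ℝ) : ℂ) := by
  have hint := (integrable_prod_truncKernel a n).ofReal (𝕜 := ℂ)
  have hint2 : Integrable (fun p : V × ℝ => Real.fourierChar (-inner ℝ p.1 ξ) •
      ((inner ℝ a p.1 * (2 * p.2 ^ Module.finrank ℝ V *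
      Real.exp (-(Real.pi * p.2 ^ 2 * ‖p.1‖ ^ 2))) : ℝ) : ℂ))
      (volume.prod (volume.restrict (Set.Ioc (1 / ((n : ℝ) + 1)) ((n : ℝ) + 1)))) := by
    refine hint.mono ?_ (Eventually.of_forall fun p => by
      rw [Circle.smul_def, norm_smul, Circle.norm_coe, one_mul]
      exact le_rfl)
    refine AEStronglyMeasurable.smul (f := fun p : V × ℝ => Real.fourierChar (-inner ℝ p.1 ξ)) ?_ hint.1
    have : Continuous fun p : V × ℝ => Real.fourierChar (-inner ℝ p.1 ξ) :=
      Real.continuous_fourierChar.comp (by fun_prop)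
    exact this.aestronglyMeasurable
  have hswap := integral_integral_swap
    (f := fun (v : V) (s : ℝ) => Real.fourierChar (-inner ℝ v ξ) •
      ((inner ℝ a v * (2 * s ^ Module.finrank ℝ V *
      Real.exp (-(Real.pi * s ^ 2 * ‖v‖ ^ 2))) : ℝ) : ℂ)) hint2
  rw [Real.fourier_eq]
  have e1 : ∫ v : V, Real.fourierChar (-inner ℝ v ξ) • (truncKernel a n v : ℂ) =
      ∫ v : V, ∫ s in Set.Ioc (1 / ((n : ℝ) + 1)) ((n : ℝ) + 1),
        Real.fourierChar (-inner ℝ v ξ) • ((inner ℝ a v * (2 * s ^ Module.finrank ℝ V *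
      Real.exp (-(Real.pi * s ^ 2 * ‖v‖ ^ 2))) : ℝ) : ℂ) := by
    refine integral_congr_ae (Eventually.of_forall fun v => ?_)
    simp only [Circle.smul_def]
    rw [integral_smul, integral_complex_ofReal, integral_const_mul]
    rfl
  -- The weight 2 s^D meets the factor s^-(D+2) from the Gaussian and leaves 2 s^-2 whatever the
  -- dimension D; this is the inverted form of the profile with index 0.
  rw [e1, hswap, ← truncProfile_zero_eq, ← integral_const_mul, ← integral_complex_ofReal,
    ← integral_const_mul]
  refine setIntegral_congr_fun measurableSet_Ioc fun s hs => ?_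
  have hs0 : 0 < s := lt_trans (by positivity) hs.1
  have h := fourier_inner_mul_gaussian a hs0 ξ
  rw [Real.fourier_eq] at h
  have e2 : ∫ v : V, Real.fourierChar (-inner ℝ v ξ) • ((inner ℝ a v * (2 * s ^ Module.finrank ℝ V *
      Real.exp (-(Real.pi * s ^ 2 * ‖v‖ ^ 2))) : ℝ) : ℂ) = (2 * s ^ Module.finrank ℝ V : ℂ) *
      ∫ v : V, Real.fourierChar (-inner ℝ v ξ) • ((inner ℝ a v *
      Real.exp (-(Real.pi * s ^ 2 * ‖v‖ ^ 2)) : ℝ) : ℂ) := by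
    rw [← integral_const_mul]
    refine integral_congr_ae (Eventually.of_forall fun v => ?_)
    simp only [Circle.smul_def, smul_eq_mul]
    push_cast
    ring
  rw [e2, h]
  have hsc : (s : ℂ) ≠ 0 := by exact_mod_cast hs0.ne'
  push_cast
  rw [pow_add]
  field_simp

end GaussianKernels

end RieszPowers

namespace RieszPowers

/-! ### Principal values of locally Hölder functions. -/

section LocalHolder

variable {d : ℕ}

local notation "𝔼" => EuclideanSpace ℝ (Fin d)

/-- The kernel `y_j / |y|^(d+1)`. -/
noncomputable def rieszKernel (j : Fin d) (y : EuclideanSpace ℝ (Fin d)) : ℝ := y j / ‖y‖ ^ (d + 1)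

/-- The kernel `y_j / max(|y|, ρ)^(d+1)`. -/
noncomputable def cutKernel (j : Fin d) (ρ : ℝ) (y : EuclideanSpace ℝ (Fin d)) : ℝ :=
  y j / max ‖y‖ ρ ^ (d + 1)

/-- Local Hölder continuity near a point. -/
def LocHolder (g : EuclideanSpace ℝ (Fin d) → ℝ) (x : EuclideanSpace ℝ (Fin d)) : Prop :=
  ∃ r C α : ℝ, 0 < r ∧ 0 ≤ C ∧ 0 < α ∧ α ≤ 1 ∧
    ∀ y ∈ Metric.ball x r, ∀ z ∈ Metric.ball x r, |g y - g z| ≤ C * ‖y - z‖ ^ α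

theorem abs_coord_le (j : Fin d) (y : 𝔼) : |y j| ≤ ‖y‖ := PiLp.norm_apply_le y j

theorem rieszKernel_neg (j : Fin d) (y : 𝔼) : rieszKernel j (-y) = -rieszKernel j y := by
  simp [rieszKernel, neg_div]

theorem cutKernel_neg (j : Fin d) (ρ : ℝ) (y : 𝔼) : cutKernel j ρ (-y) = -cutKernel j ρ y := by
  simp [cutKernel, neg_div]

theorem measurable_rieszKernel (j : Fin d) : Measurable (rieszKernel j) := by
  unfold rieszKernel
  fun_prop

theorem measurable_cutKernel (j : Fin d) (ρ : ℝ) : Measurable (cutKernel j ρ) := by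
  unfold cutKernel
  fun_prop

theorem abs_rieszKernel_le (j : Fin d) (y : 𝔼) : |rieszKernel j y| ≤ (‖y‖ ^ d)⁻¹ := by
  rw [rieszKernel, abs_div, abs_of_nonneg (a := ‖y‖ ^ (d + 1)) (by positivity)]
  rcases (norm_nonneg y).eq_or_lt with h | h
  · rw [← h]; simp
  · rw [div_le_iff₀ (by positivity), pow_succ, ← mul_assoc, inv_mul_cancel₀ (by positivity), one_mul]
    exact abs_coord_le j y

theorem abs_cutKernel_le (j : Fin d) {ρ : ℝ} (hρ : 0 < ρ) (y : 𝔼) :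
    |cutKernel j ρ y| ≤ (max ‖y‖ ρ ^ d)⁻¹ := by
  have h : 0 < max ‖y‖ ρ := lt_max_of_lt_right hρ
  rw [cutKernel, abs_div, abs_of_nonneg (a := max ‖y‖ ρ ^ (d + 1)) (by positivity),
    div_le_iff₀ (by positivity), pow_succ, ← mul_assoc, inv_mul_cancel₀ (by positivity), one_mul]
  exact (abs_coord_le j y).trans (le_max_left _ _)

/-- The kernels agree outside the ball of radius ρ. A Riesz integral thus splits into a near part,
where Hölder continuity compensates |y|^-d, and a far part with a square integrable kernel. -/
theorem abs_rieszKernel_sub_cutKernel_le (j : Fin d) (ρ : ℝ) (y : 𝔼) :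
    |rieszKernel j y - cutKernel j ρ y| ≤ (Metric.ball (0 : 𝔼) ρ).indicator (fun y => (‖y‖ ^ d)⁻¹) y := by
  by_cases hy : y ∈ Metric.ball (0 : 𝔼) ρ
  · rw [Set.indicator_of_mem hy]
    refine le_trans ?_ (abs_rieszKernel_le j y)
    have hy' : ‖y‖ ≤ ρ := by simpa using (mem_ball_zero_iff.1 hy).le
    rw [rieszKernel, cutKernel, max_eq_right hy']
    rcases (norm_nonneg y).eq_or_lt with h | h
    · have : y = 0 := norm_eq_zero.1 h.symm
      simp [this]
    · rw [div_eq_mul_inv, div_eq_mul_inv, ← mul_sub, abs_mul, abs_mul]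
      refine mul_le_mul_of_nonneg_left ?_ (abs_nonneg _)
      have h1 : (ρ ^ (d + 1))⁻¹ ≤ (‖y‖ ^ (d + 1))⁻¹ := by gcongr
      have h2 : 0 ≤ (ρ ^ (d + 1))⁻¹ := by
        have := h.trans_le hy'
        positivity
      rw [abs_of_nonneg (by linarith), abs_of_nonneg (by positivity)]
      linarith
  · have hy' : ρ ≤ ‖y‖ := by simpa using hy
    rw [Set.indicator_of_notMem hy, rieszKernel, cutKernel, max_eq_left hy']
    simp

theorem integrable_ball_norm_rpow (j : Fin d) {β : ℝ} (hβ : 0 < β) (ρ : ℝ) :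
    Integrable (fun y : 𝔼 => (Metric.ball (0 : 𝔼) ρ).indicator (fun y => (‖y‖ ^ d)⁻¹ * ‖y‖ ^ β) y) := by
  have : Nonempty (Fin d) := ⟨j⟩
  have hd : 1 ≤ d := Fin.pos j
  have h := (integrable_fun_norm_addHaar (volume : Measure 𝔼)
    (f := (Set.Iio ρ).indicator fun r => (r ^ d)⁻¹ * r ^ β)).2 ?_
  · refine h.congr (Eventually.of_forall fun y => ?_)
    simp only [Set.indicator, Set.mem_Iio, mem_ball_zero_iff]
  · simp only [finrank_euclideanSpace, Fintype.card_fin]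
    have h2 : IntegrableOn ((Set.Iio ρ).indicator fun r : ℝ => r ^ (β - 1)) (Set.Ioi 0) := by
      rw [integrableOn_indicator_iff measurableSet_Iio]
      rcases le_total ρ 0 with h0 | h0
      · have : Set.Iio ρ ∩ Set.Ioi 0 = ∅ := by
          ext s; simp only [Set.mem_inter_iff, Set.mem_Iio, Set.mem_Ioi, Set.mem_empty_iff_false]
          constructor
          · rintro ⟨h1, h2⟩; linarith
          · simp
        rw [this]; exact integrableOn_empty
      have h3 := (intervalIntegral.intervalIntegrable_rpow' (a := 0) (b := ρ) (r := β - 1) (by linarith))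
      rw [intervalIntegrable_iff_integrableOn_Ioo_of_le h0] at h3
      refine h3.mono_set ?_
      rintro s ⟨h1, h2⟩
      exact ⟨h2, h1⟩
    refine h2.congr_fun (fun r hr => ?_) measurableSet_Ioi
    have hr0 : (0 : ℝ) < r := hr
    simp only [Set.indicator, smul_eq_mul]
    split_ifs
    · rw [← mul_assoc, Real.rpow_sub hr0, Real.rpow_one]
      have : r ^ d = r ^ (d - 1) * r := by rw [← pow_succ, Nat.sub_add_cancel hd]
      rw [this]
      field_simp
    · simp

theorem memLp_max_norm_pow_inv {ρ : ℝ} (hρ : 0 < ρ) {k : ℕ} (hk : d < 2 * k) :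
    MemLp (fun y : 𝔼 => (max ‖y‖ ρ ^ k)⁻¹) 2 volume := by
  rw [memLp_two_iff_integrable_sq (Measurable.aestronglyMeasurable (by fun_prop))]
  have h := (integrable_one_add_norm (E := 𝔼) (μ := volume) (r := ((2 * k : ℕ) : ℝ)) (by
    simp only [finrank_euclideanSpace, Fintype.card_fin]; exact_mod_cast hk)).const_mul
      (((ρ / (1 + ρ)) ^ (2 * k))⁻¹)
  refine h.mono' (Measurable.aestronglyMeasurable (by fun_prop)) (Eventually.of_forall fun y => ?_)
  rw [Real.norm_of_nonneg (by positivity), Real.rpow_neg (by positivity), Real.rpow_natCast,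
    ← mul_inv, ← mul_pow, inv_pow, ← pow_mul, mul_comm k 2]
  have hp : 0 < ρ / (1 + ρ) * (1 + ‖y‖) := by positivity
  have : ρ / (1 + ρ) * (1 + ‖y‖) ≤ max ‖y‖ ρ := by
    rw [div_mul_eq_mul_div, div_le_iff₀ (by positivity)]
    rcases le_total ‖y‖ ρ with h1 | h1
    · rw [max_eq_right h1]; nlinarith
    · rw [max_eq_left h1]; nlinarith
  gcongr

theorem memLp_cutKernel (j : Fin d) {ρ : ℝ} (hρ : 0 < ρ) : MemLp (cutKernel j ρ) 2 volume := by
  have hd : 1 ≤ d := Fin.pos j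
  refine (memLp_max_norm_pow_inv (d := d) hρ (k := d) (by omega)).of_le
    (measurable_cutKernel j ρ).aestronglyMeasurable (Eventually.of_forall fun y => ?_)
  rw [Real.norm_eq_abs, Real.norm_of_nonneg (by positivity)]
  exact abs_cutKernel_le j hρ y

/-- The symmetrized difference is integrable against the Riesz kernel minus the cut kernel. -/
theorem LocHolder.integrable_near {g : 𝔼 → ℝ} {x : 𝔼} (hg : AEStronglyMeasurable g volume)
    (j : Fin d) {r C α : ℝ} (hα : 0 < α)
    (hH : ∀ y ∈ Metric.ball x r, ∀ z ∈ Metric.ball x r, |g y - g z| ≤ C * ‖y - z‖ ^ α) :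
    Integrable (fun y => (rieszKernel j y - cutKernel j r y) * (g (x - y) - g (x + y))) := by
  refine ((integrable_ball_norm_rpow j hα r).const_mul (C * 2 ^ α)).mono' ?_
    (Eventually.of_forall fun y => ?_)
  · exact ((measurable_rieszKernel j).sub (measurable_cutKernel j r)).aestronglyMeasurable.mul
      ((hg.comp_quasiMeasurePreserving (Measure.measurePreserving_sub_left volume x).quasiMeasurePreserving).sub
      (hg.comp_quasiMeasurePreserving (measurePreserving_add_left volume x).quasiMeasurePreserving))
  · rw [norm_mul, Real.norm_eq_abs, Real.norm_eq_abs]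
    have h1 := abs_rieszKernel_sub_cutKernel_le j r y
    by_cases hy : y ∈ Metric.ball (0 : 𝔼) r
    · rw [Set.indicator_of_mem hy] at h1 ⊢
      have hy' : ‖y‖ < r := by simpa using hy
      have h2 := hH (x - y) (by simpa [dist_eq_norm] using hy') (x + y) (by simpa [dist_eq_norm] using hy')
      have h3 : ‖x - y - (x + y)‖ = 2 * ‖y‖ := by
        have : x - y - (x + y) = (-2 : ℝ) • y := by module
        rw [this, norm_smul]; norm_num
      rw [h3, Real.mul_rpow (by norm_num) (norm_nonneg y)] at h2
      calc _ ≤ (‖y‖ ^ d)⁻¹ * (C * (2 ^ α * ‖y‖ ^ α)) := by gcongr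
        _ = _ := by ring
    · rw [Set.indicator_of_notMem hy] at h1 ⊢
      have : |rieszKernel j y - cutKernel j r y| = 0 := le_antisymm h1 (abs_nonneg _)
      rw [this]; simp

theorem memLp_comp_sub_left {g : 𝔼 → ℝ} (hg : MemLp g 2 volume) (x : 𝔼) :
    MemLp (fun y => g (x - y)) 2 volume :=
  hg.comp_measurePreserving (Measure.measurePreserving_sub_left volume x)

theorem memLp_comp_add_left {g : 𝔼 → ℝ} (hg : MemLp g 2 volume) (x : 𝔼) :
    MemLp (fun y => g (x + y)) 2 volume :=
  hg.comp_measurePreserving (measurePreserving_add_left volume x)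

theorem LocHolder.integrable {g : 𝔼 → ℝ} {x : 𝔼} (h : LocHolder g x) (hg : MemLp g 2 volume)
    (j : Fin d) : Integrable (fun y => rieszKernel j y * (g (x - y) - g (x + y))) := by
  obtain ⟨r, C, α, hr, hC, hα, -, hH⟩ := h
  have h1 := LocHolder.integrable_near hg.1 j hα hH
  have h2 : Integrable (fun y => cutKernel j r y * (g (x - y) - g (x + y))) :=
    (memLp_cutKernel j hr).integrable_mul ((memLp_comp_sub_left hg x).sub (memLp_comp_add_left hg x))
  refine (h1.add h2).congr (Eventually.of_forall fun y => ?_)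
  simp only [Pi.add_apply]
  ring

/-- Symmetrization of an integral against an even multiple of the Riesz kernel. -/
theorem integral_even_mul_rieszKernel {g : 𝔼 → ℝ} (x : 𝔼) (j : Fin d) {ρ : 𝔼 → ℝ}
    (hρ : ∀ y, ρ (-y) = ρ y) (hi : Integrable (fun y => ρ y * rieszKernel j y * g (x - y))) :
    ∫ y, ρ y * rieszKernel j y * g (x - y) =
      ∫ y, ρ y * (1 / 2 * (rieszKernel j y * (g (x - y) - g (x + y)))) := by
  have h1 : ∫ y, ρ y * rieszKernel j y * g (x - y) = ∫ y, -(ρ y * rieszKernel j y * g (x + y)) := by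
    rw [← integral_neg_eq_self]
    refine integral_congr_ae (Eventually.of_forall fun y => ?_)
    simp only [hρ, rieszKernel_neg, sub_neg_eq_add]
    ring
  have h2 : Integrable (fun y => -(ρ y * rieszKernel j y * g (x + y))) := by
    refine hi.comp_neg.congr (Eventually.of_forall fun y => ?_)
    simp only [hρ, rieszKernel_neg, sub_neg_eq_add]
    ring
  have h3 : ∫ y, ρ y * rieszKernel j y * g (x - y) = 1 / 2 * (∫ y, ρ y * rieszKernel j y * g (x - y)) +
      1 / 2 * ∫ y, -(ρ y * rieszKernel j y * g (x + y)) := by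
    rw [← h1]; ring
  rw [h3, ← integral_const_mul, ← integral_const_mul, ← integral_add (hi.const_mul _) (h2.const_mul _)]
  refine integral_congr_ae (Eventually.of_forall fun y => ?_)
  simp only
  ring

/-- Dominated convergence for the symmetrized integral. -/
theorem LocHolder.tendsto_integral {ι : Type*} {l : Filter ι} [l.IsCountablyGenerated]
    {g : 𝔼 → ℝ} {x : 𝔼} (h : LocHolder g x)
    (hg : MemLp g 2 volume) (j : Fin d) {ρ : ι → 𝔼 → ℝ} {B c : ℝ}
    (hm : ∀ᶠ i in l, Measurable (ρ i)) (hB : ∀ᶠ i in l, ∀ y, |ρ i y| ≤ B)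
    (hlim : ∀ y, y ≠ 0 → Tendsto (fun i => ρ i y) l (𝓝 c)) :
    Tendsto (fun i => ∫ y, ρ i y * (1 / 2 * (rieszKernel j y * (g (x - y) - g (x + y))))) l
      (𝓝 (c * (1 / 2 * ∫ y, rieszKernel j y * (g (x - y) - g (x + y))))) := by
  have hint := (h.integrable hg j).const_mul (1 / 2)
  rw [← integral_const_mul, ← integral_const_mul]
  refine tendsto_integral_filter_of_dominated_convergence
    (fun y => B * ‖1 / 2 * (rieszKernel j y * (g (x - y) - g (x + y)))‖) ?_ ?_ (hint.norm.const_mul B) ?_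
  · filter_upwards [hm] with i hi
    exact hi.aestronglyMeasurable.mul hint.1
  · filter_upwards [hB] with i hi
    refine Eventually.of_forall fun y => ?_
    rw [norm_mul]
    gcongr
    exact hi y
  · refine Eventually.of_forall fun y => ?_
    rcases eq_or_ne y 0 with rfl | hy
    · simpa [rieszKernel] using tendsto_const_nhds
    · exact (hlim y hy).mul_const _

/-- The truncated integral is an absolutely convergent symmetrized integral. -/
theorem integrableOn_rieszKernel_mul {g : 𝔼 → ℝ} (hg : MemLp g 2 volume) (j : Fin d) (x : 𝔼) {ε : ℝ}
    (hε : 0 < ε) : IntegrableOn (fun y => rieszKernel j y * g (x - y)) {y | ε < dist y 0} := by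
  have h : Integrable (fun y => cutKernel j ε y * g (x - y)) :=
    (memLp_cutKernel j hε).integrable_mul (memLp_comp_sub_left hg x)
  refine h.integrableOn.congr_fun (fun y hy => ?_) (measurableSet_lt measurable_const (by fun_prop))
  have hy' : ε < ‖y‖ := by simpa using hy
  simp only [cutKernel, rieszKernel, max_eq_left hy'.le]

/-- The cutoff |y| > ε is an even factor bounded by 1 and tending to 1. Oddness of the kernel
symmetrizes the integral, and dominated convergence applies. -/
theorem LocHolder.tendsto_pv {g : 𝔼 → ℝ} {x : 𝔼} (h : LocHolder g x) (hg : MemLp g 2 volume)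
    (j : Fin d) :
    Tendsto (fun ε : ℝ => ∫ y in {y : 𝔼 | ε < dist y 0}, rieszKernel j y * g (x - y)) (𝓝[>] 0)
      (𝓝 (1 / 2 * ∫ y, rieszKernel j y * (g (x - y) - g (x + y)))) := by
  have hset : ∀ ε : ℝ, MeasurableSet {y : 𝔼 | ε < dist y 0} := fun ε =>
    measurableSet_lt measurable_const (by fun_prop)
  have h1 := h.tendsto_integral (l := 𝓝[>] (0 : ℝ)) hg j (B := 1) (c := 1)
    (ρ := fun ε => {y : 𝔼 | ε < dist y 0}.indicator fun _ => 1)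
    (Eventually.of_forall fun ε => measurable_const.indicator (hset ε))
    (Eventually.of_forall fun ε y => by
      simp only [Set.indicator]; split_ifs <;> simp) (fun y hy => by
      refine tendsto_const_nhds.congr' ?_
      have hy0 : 0 < ‖y‖ := norm_pos_iff.2 hy
      filter_upwards [Ioo_mem_nhdsGT hy0] with ε hε
      rw [Set.indicator_of_mem]
      simpa using hε.2)
  rw [one_mul] at h1
  refine h1.congr' ?_
  filter_upwards [self_mem_nhdsWithin] with ε hε
  have hε0 : 0 < ε := hε
  have hi := (integrable_indicator_iff (hset ε)).2 (integrableOn_rieszKernel_mul hg j x hε0)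
  rw [← integral_even_mul_rieszKernel]
  · rw [← integral_indicator (hset ε)]
    refine integral_congr_ae (Eventually.of_forall fun y => ?_)
    simp only [Set.indicator]
    split_ifs <;> simp
  · intro y
    simp [Set.indicator]
  · refine hi.congr (Eventually.of_forall fun y => ?_)
    simp only [Set.indicator]
    split_ifs <;> simp

theorem LocHolder.riesz_eq {g : 𝔼 → ℝ} {x : 𝔼} (h : LocHolder g x) (hg : MemLp g 2 volume)
    (j : Fin d) : riesz j g x =
      rieszKernelConst d * (1 / 2 * ∫ y, rieszKernel j y * (g (x - y) - g (x + y))) := by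
  unfold riesz pvIntegral
  rw [smul_eq_mul]
  congr 1
  exact (h.tendsto_pv hg j).limUnder_eq

end LocalHolder

end RieszPowers

namespace RieszPowers

/-! ### Local Hölder continuity survives the Riesz transform. -/

section HolderPropagation

variable {d : ℕ}

local notation "𝔼" => EuclideanSpace ℝ (Fin d)

/-- The smooth truncation equals the Riesz kernel times a radial factor between 0 and
`rieszKernelConst d` that tends to this constant; dominated convergence gives the same limit as the
sharp cutoff. -/
theorem LocHolder.tendsto_trunc {g : 𝔼 → ℝ} {x : 𝔼} (h : LocHolder g x) (hg : MemLp g 2 volume)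
    (j : Fin d) :
    Tendsto (fun n : ℕ => ∫ y, truncKernel (EuclideanSpace.single j (1 : ℝ)) n y * g (x - y)) atTop
      (𝓝 (riesz j g x)) := by
  have hfr : Module.finrank ℝ 𝔼 = d := by simp
  rw [h.riesz_eq hg j]
  have hK : ∀ n (y : 𝔼), truncKernel (EuclideanSpace.single j (1 : ℝ)) n y =
      (truncProfile d n ‖y‖ * ‖y‖ ^ (d + 1)) * rieszKernel j y := by
    intro n y
    rw [truncKernel, hfr, EuclideanSpace.inner_single_left, rieszKernel]
    rcases eq_or_ne y 0 with rfl | hy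
    · simp
    · have hy0 : ‖y‖ ≠ 0 := norm_ne_zero_iff.2 hy
      field_simp
      simp
  have hmp : ∀ n, Measurable (truncProfile d n) := by
    intro n
    have : StronglyMeasurable (truncProfile d n) := by
      refine StronglyMeasurable.integral_prod_right' (f := fun p : ℝ × ℝ =>
        2 * p.2 ^ d * Real.exp (-(Real.pi * p.2 ^ 2 * p.1 ^ 2))) ?_
      exact Continuous.stronglyMeasurable (by fun_prop)
    exact this.measurable
  have hC := rieszKernelConst_pos d
  have h1 := h.tendsto_integral (l := atTop) hg j (B := rieszKernelConst d) (c := rieszKernelConst d)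
    (ρ := fun n y => truncProfile d n ‖y‖ * ‖y‖ ^ (d + 1))
    (Eventually.of_forall fun n => by have := hmp n; fun_prop)
    (Eventually.of_forall fun n y => by
      rcases (norm_nonneg y).eq_or_lt with h0 | h0
      · rw [← h0]; simpa using hC.le
      · rw [abs_of_nonneg (mul_nonneg (truncProfile_nonneg _ _ _) (by positivity))]
        exact (le_div_iff₀ (by positivity)).1 (truncProfile_le d n h0))
    (fun y hy => by
      have h0 : 0 < ‖y‖ := norm_pos_iff.2 hy
      have := (tendsto_truncProfile d h0).mul_const (‖y‖ ^ (d + 1))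
      rwa [div_mul_cancel₀ _ (by positivity)] at this)
  refine h1.congr fun n => ?_
  rw [← integral_even_mul_rieszKernel]
  · simp only [hK]
  · intro y; simp
  · have := (memLp_truncKernel (EuclideanSpace.single j (1 : ℝ)) n).integrable_mul
      (memLp_comp_sub_left hg x)
    refine this.congr (Eventually.of_forall fun y => ?_)
    simp only [Pi.mul_apply, hK]

theorem abs_inv_pow_sub_inv_pow_le {m m' δ : ℝ} (hm : 0 < m) (hm' : m / 2 ≤ m') (hm2 : m' ≤ 2 * m)
    (hδ : |m - m'| ≤ δ) (D : ℕ) :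
    |(m ^ (D + 1))⁻¹ - (m' ^ (D + 1))⁻¹| ≤ (D + 1) * 8 ^ (D + 1) * δ * (m ^ (D + 2))⁻¹ := by
  have hm0 : 0 < m' := by linarith
  rw [inv_sub_inv (by positivity) (by positivity), abs_div,
    abs_of_pos (a := m ^ (D + 1) * m' ^ (D + 1)) (by positivity), div_le_iff₀ (by positivity), abs_sub_comm]
  have h1 : |m ^ (D + 1) - m' ^ (D + 1)| ≤ δ * ((D + 1) * (2 * m) ^ D) := by
    have h2 := abs_pow_sub_pow_le m m' (D + 1)
    rw [abs_of_pos hm, abs_of_pos hm0] at h2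
    calc _ ≤ _ := h2
      _ ≤ δ * ((D + 1 : ℕ) : ℝ) * (2 * m) ^ D := by
        have hδ0 : 0 ≤ δ := (abs_nonneg _).trans hδ
        simp only [Nat.add_sub_cancel]
        have h3 : max m m' ≤ 2 * m := max_le (by linarith) hm2
        have h4 : 0 ≤ max m m' := hm.le.trans (le_max_left _ _)
        gcongr
      _ = _ := by push_cast; ring
  have hδ0 : 0 ≤ δ := (abs_nonneg _).trans hδ
  have h5 : (m ^ (D + 1)) * (m / 2) ^ (D + 1) ≤ m ^ (D + 1) * m' ^ (D + 1) := by gcongr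
  refine h1.trans ?_
  calc δ * ((D + 1) * (2 * m) ^ D)
      ≤ ((D + 1) * 8 ^ (D + 1) * δ * (m ^ (D + 2))⁻¹) * ((m ^ (D + 1)) * (m / 2) ^ (D + 1)) := by
        have e : ((D + 1) * 8 ^ (D + 1) * δ * (m ^ (D + 2))⁻¹) * ((m ^ (D + 1)) * (m / 2) ^ (D + 1)) =
            δ * ((D + 1) * ((8 / 2) ^ (D + 1) * m ^ D)) := by
          rw [div_pow, div_pow]
          field_simp
          ring
        rw [e, mul_pow]
        gcongr
        calc (2 : ℝ) ^ D ≤ (8 / 2) ^ D := by gcongr; norm_num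
          _ ≤ (8 / 2) ^ (D + 1) := by
            apply pow_le_pow_right₀ (by norm_num); omega
    _ ≤ _ := by gcongr

theorem abs_cutKernel_sub_le (j : Fin d) {ρ : ℝ} (hρ : 0 < ρ) {y y' : 𝔼} (h : ‖y - y'‖ ≤ ρ / 2) :
    |cutKernel j ρ y - cutKernel j ρ y'| ≤
      (1 + 2 * ((d + 1) * 8 ^ (d + 1))) * ‖y - y'‖ * (max ‖y‖ ρ ^ (d + 1))⁻¹ := by
  set m := max ‖y‖ ρ with hm
  set m' := max ‖y'‖ ρ with hm'
  have hmρ : ρ ≤ m := le_max_right _ _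
  have hm0 : 0 < m := hρ.trans_le hmρ
  have hmm : |m - m'| ≤ ‖y - y'‖ := by
    rw [hm, hm']
    exact (abs_max_sub_max_le_abs _ _ _).trans (abs_norm_sub_norm_le _ _)
  have h1 := abs_le.1 hmm
  have hb := abs_inv_pow_sub_inv_pow_le (m := m) (m' := m') hm0 (by linarith [h1.2]) (by linarith [h1.1])
    hmm d
  have hy' : |y' j| ≤ 2 * m := (abs_coord_le j y').trans ((le_max_left _ ρ).trans (by
    rw [← hm']; linarith [h1.1]))
  have hyy : |y j - y' j| ≤ ‖y - y'‖ := by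
    have := abs_coord_le j (y - y')
    simpa using this
  have e : cutKernel j ρ y - cutKernel j ρ y' = (y j - y' j) * (m ^ (d + 1))⁻¹ +
      y' j * ((m ^ (d + 1))⁻¹ - (m' ^ (d + 1))⁻¹) := by
    simp only [cutKernel, ← hm, ← hm', div_eq_mul_inv]; ring
  rw [e]
  calc _ ≤ |y j - y' j| * (m ^ (d + 1))⁻¹ + |y' j| * |(m ^ (d + 1))⁻¹ - (m' ^ (d + 1))⁻¹| := by
        refine (abs_add_le _ _).trans ?_
        rw [abs_mul, abs_mul, abs_of_pos (a := (m ^ (d + 1))⁻¹) (by positivity)]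
    _ ≤ ‖y - y'‖ * (m ^ (d + 1))⁻¹ +
        (2 * m) * ((d + 1) * 8 ^ (d + 1) * ‖y - y'‖ * (m ^ (d + 2))⁻¹) := by gcongr
    _ = _ := by
      field_simp
      ring

/-- The far part of the Riesz transform is Lipschitz. -/
theorem cut_convolution_sub_le {g : 𝔼 → ℝ} (hg : MemLp g 2 volume) (j : Fin d) {ρ : ℝ} (hρ : 0 < ρ)
    (x₀ : 𝔼) : ∃ C, 0 ≤ C ∧ ∀ x ∈ Metric.ball x₀ (ρ / 4), ∀ x' ∈ Metric.ball x₀ (ρ / 4),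
      |(∫ y, cutKernel j ρ y * (g (x - y) - g (x + y))) -
        ∫ y, cutKernel j ρ y * (g (x' - y) - g (x' + y))| ≤ C * ‖x - x'‖ := by
  have hd : 1 ≤ d := Fin.pos j
  have hmax : MemLp (fun z : 𝔼 => (max ‖x₀ - z‖ ρ ^ (d + 1))⁻¹) 2 volume :=
    (memLp_max_norm_pow_inv (d := d) hρ (k := d + 1) (by omega)).comp_measurePreserving
      (Measure.measurePreserving_sub_left volume x₀)
  have hI : Integrable (fun z : 𝔼 => (max ‖x₀ - z‖ ρ ^ (d + 1))⁻¹ * ‖g z‖) := hmax.integrable_mul hg.norm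
  -- The first factor is the Lipschitz constant of the cut kernel; 2^(d+1) is the price of replacing
  -- the moving centre x by x₀ in the decay factor.
  set A : ℝ := (1 + 2 * ((d + 1) * 8 ^ (d + 1))) * 2 ^ (d + 1)
  have e : ∀ x : 𝔼, ∫ y, cutKernel j ρ y * (g (x - y) - g (x + y)) =
      2 * ∫ z, cutKernel j ρ (x - z) * g z := by
    intro x
    have h1 : Integrable (fun y => cutKernel j ρ y * g (x - y)) :=
      (memLp_cutKernel j hρ).integrable_mul (memLp_comp_sub_left hg x)
    have h2 : Integrable (fun y => cutKernel j ρ y * g (x + y)) :=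
      (memLp_cutKernel j hρ).integrable_mul (memLp_comp_add_left hg x)
    have h3 : ∫ y, cutKernel j ρ y * g (x - y) = ∫ z, cutKernel j ρ (x - z) * g z := by
      rw [← integral_sub_left_eq_self (fun y => cutKernel j ρ y * g (x - y)) volume x]
      simp
    have h4 : ∫ y, cutKernel j ρ y * g (x + y) = -∫ z, cutKernel j ρ (x - z) * g z := by
      rw [← h3, ← integral_neg, ← integral_neg_eq_self]
      simp [cutKernel_neg, sub_eq_add_neg]
    simp only [mul_sub]
    rw [integral_sub h1 h2, h3, h4]
    ring
  refine ⟨2 * (A * ∫ z, (max ‖x₀ - z‖ ρ ^ (d + 1))⁻¹ * ‖g z‖), ?_, fun x hx x' hx' => ?_⟩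
  · have : 0 ≤ ∫ z, (max ‖x₀ - z‖ ρ ^ (d + 1))⁻¹ * ‖g z‖ := integral_nonneg fun z => by positivity
    positivity
  · have hi : ∀ x : 𝔼, Integrable (fun z => cutKernel j ρ (x - z) * g z) := fun x =>
      ((memLp_cutKernel j hρ).comp_measurePreserving
        (Measure.measurePreserving_sub_left volume x)).integrable_mul hg
    rw [e, e, ← mul_sub, ← integral_sub (hi x) (hi x'), abs_mul, abs_two, mul_assoc]
    refine mul_le_mul_of_nonneg_left ?_ (by norm_num)
    rw [mul_right_comm, ← integral_const_mul, ← Real.norm_eq_abs]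
    refine norm_integral_le_of_norm_le (hI.const_mul _) (Eventually.of_forall fun z => ?_)
    rw [← sub_mul, norm_mul, Real.norm_eq_abs]
    have hx1 : ‖x - x₀‖ < ρ / 4 := by simpa [dist_eq_norm] using hx
    have hx1' : ‖x' - x₀‖ < ρ / 4 := by simpa [dist_eq_norm] using hx'
    have hxx : ‖(x - z) - (x' - z)‖ ≤ ρ / 2 := by
      have : (x - z) - (x' - z) = (x - x₀) - (x' - x₀) := by abel
      rw [this]
      refine (norm_sub_le _ _).trans (by linarith)
    have h1 := abs_cutKernel_sub_le j hρ hxx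
    rw [sub_sub_sub_cancel_right] at h1
    have h2 : max ‖x₀ - z‖ ρ / 2 ≤ max ‖x - z‖ ρ := by
      have h3 : ‖x₀ - z‖ ≤ ‖x - z‖ + ρ / 4 := by
        have : x₀ - z = (x - z) - (x - x₀) := by abel
        rw [this]
        refine (norm_sub_le _ _).trans (by linarith)
      have h4 : ‖x - z‖ ≤ max ‖x - z‖ ρ := le_max_left _ _
      have h5 : ρ ≤ max ‖x - z‖ ρ := le_max_right _ _
      have h6 : max ‖x₀ - z‖ ρ ≤ 2 * max ‖x - z‖ ρ := max_le (by linarith) (by linarith)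
      linarith
    have h0 : 0 < max ‖x₀ - z‖ ρ := lt_max_of_lt_right hρ
    have h7 : (max ‖x - z‖ ρ ^ (d + 1))⁻¹ ≤ 2 ^ (d + 1) * (max ‖x₀ - z‖ ρ ^ (d + 1))⁻¹ := by
      calc (max ‖x - z‖ ρ ^ (d + 1))⁻¹ ≤ ((max ‖x₀ - z‖ ρ / 2) ^ (d + 1))⁻¹ := by gcongr
        _ = _ := by rw [div_pow]; field_simp
    calc _ ≤ ((1 + 2 * ((d + 1) * 8 ^ (d + 1))) * ‖x - x'‖ *
          (2 ^ (d + 1) * (max ‖x₀ - z‖ ρ ^ (d + 1))⁻¹)) * ‖g z‖ := by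
          refine mul_le_mul_of_nonneg_right (h1.trans ?_) (norm_nonneg _)
          gcongr
      _ = _ := by simp only [A]; ring

/-- The near part of the Riesz transform of a locally Hölder function is locally Hölder. -/
theorem near_convolution_sub_le {g : 𝔼 → ℝ} (hg : AEStronglyMeasurable g volume) (j : Fin d)
    {r C α : ℝ} {x₀ : 𝔼} (hC : 0 ≤ C) (hα : 0 < α) (hα1 : α ≤ 1)
    (hH : ∀ y ∈ Metric.ball x₀ r, ∀ z ∈ Metric.ball x₀ r, |g y - g z| ≤ C * ‖y - z‖ ^ α) :
    ∃ C', 0 ≤ C' ∧ ∀ x ∈ Metric.ball x₀ (r / 4), ∀ x' ∈ Metric.ball x₀ (r / 4),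
      |(∫ y, (rieszKernel j y - cutKernel j (r / 2) y) * (g (x - y) - g (x + y))) -
        ∫ y, (rieszKernel j y - cutKernel j (r / 2) y) * (g (x' - y) - g (x' + y))| ≤
        C' * ‖x - x'‖ ^ (α / 2) := by
  have hI := integrable_ball_norm_rpow j (half_pos hα) (r / 2)
  have hsub : ∀ x ∈ Metric.ball x₀ (r / 4), Integrable (fun y =>
      (rieszKernel j y - cutKernel j (r / 2) y) * (g (x - y) - g (x + y))) := by
    intro x hx
    refine LocHolder.integrable_near hg j hα (C := C) fun y hy z hz => hH y ?_ z ?_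
    · have h1 := Metric.mem_ball.1 hx
      have h2 := Metric.mem_ball.1 hy
      have := dist_triangle y x x₀
      have := dist_nonneg (x := x) (y := x₀)
      exact Metric.mem_ball.2 (by linarith)
    · have h1 := Metric.mem_ball.1 hx
      have h2 := Metric.mem_ball.1 hz
      have := dist_triangle z x x₀
      have := dist_nonneg (x := x) (y := x₀)
      exact Metric.mem_ball.2 (by linarith)
  refine ⟨4 * C * ∫ y, (Metric.ball (0 : 𝔼) (r / 2)).indicator
    (fun y => (‖y‖ ^ d)⁻¹ * ‖y‖ ^ (α / 2)) y, ?_, fun x hx x' hx' => ?_⟩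
  · have : 0 ≤ ∫ y, (Metric.ball (0 : 𝔼) (r / 2)).indicator
        (fun y => (‖y‖ ^ d)⁻¹ * ‖y‖ ^ (α / 2)) y :=
      integral_nonneg fun y => Set.indicator_nonneg (fun y _ => by positivity) y
    positivity
  · rw [← integral_sub (hsub x hx) (hsub x' hx'), mul_right_comm, ← integral_const_mul, ← Real.norm_eq_abs]
    refine norm_integral_le_of_norm_le (hI.const_mul _) (Eventually.of_forall fun y => ?_)
    rw [← mul_sub, norm_mul, Real.norm_eq_abs, Real.norm_eq_abs]
    have h1 := abs_rieszKernel_sub_cutKernel_le j (r / 2) y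
    by_cases hy : y ∈ Metric.ball (0 : 𝔼) (r / 2)
    · rw [Set.indicator_of_mem hy] at h1 ⊢
      have hy' : ‖y‖ < r / 2 := by simpa using hy
      have hx1 : ‖x - x₀‖ < r / 4 := by simpa [dist_eq_norm] using hx
      have hx1' : ‖x' - x₀‖ < r / 4 := by simpa [dist_eq_norm] using hx'
      have hmem : ∀ w, ‖w - x₀‖ < r / 4 → w - y ∈ Metric.ball x₀ r ∧ w + y ∈ Metric.ball x₀ r := by
        intro w hw
        have h0 := norm_nonneg (w - x₀)
        constructor
        · rw [Metric.mem_ball, dist_eq_norm, sub_right_comm]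
          refine (norm_sub_le _ _).trans_lt (by linarith)
        · rw [Metric.mem_ball, dist_eq_norm, add_sub_right_comm]
          refine (norm_add_le _ _).trans_lt (by linarith)
      have hb : |g (x - y) - g (x + y) - (g (x' - y) - g (x' + y))| ≤ 2 * C * ‖x - x'‖ ^ α := by
        have a1 := hH _ (hmem x hx1).1 _ (hmem x' hx1').1
        have a2 := hH _ (hmem x hx1).2 _ (hmem x' hx1').2
        rw [sub_sub_sub_cancel_right] at a1
        rw [add_sub_add_right_eq_sub] at a2
        have : g (x - y) - g (x + y) - (g (x' - y) - g (x' + y)) =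
          (g (x - y) - g (x' - y)) - (g (x + y) - g (x' + y)) := by ring
        rw [this]
        refine (abs_sub _ _).trans ?_
        linarith
      have ha : |g (x - y) - g (x + y) - (g (x' - y) - g (x' + y))| ≤ 4 * C * ‖y‖ ^ α := by
        have hd : ∀ w, ‖w - x₀‖ < r / 4 → |g (w - y) - g (w + y)| ≤ 2 * C * ‖y‖ ^ α := by
          intro w hw
          have h2 := hH _ (hmem w hw).1 _ (hmem w hw).2
          have h3 : ‖w - y - (w + y)‖ = 2 * ‖y‖ := by
            have : w - y - (w + y) = (-2 : ℝ) • y := by module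
            rw [this, norm_smul]; norm_num
          rw [h3, Real.mul_rpow (by norm_num) (norm_nonneg y)] at h2
          have h4 : (2 : ℝ) ^ α ≤ 2 := by
            calc (2 : ℝ) ^ α ≤ 2 ^ (1 : ℝ) := Real.rpow_le_rpow_of_exponent_le (by norm_num) hα1
              _ = 2 := Real.rpow_one 2
          calc _ ≤ _ := h2
            _ ≤ C * (2 * ‖y‖ ^ α) := by gcongr
            _ = _ := by ring
        refine (abs_sub _ _).trans ?_
        linarith [hd x hx1, hd x' hx1']
      -- Both |x - x'|^α and |y|^α control the difference, so their geometric mean does. Half of the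
      -- exponent gives continuity in x and the other half keeps |y|^(α/2 - d) integrable.
      have hmin : |g (x - y) - g (x + y) - (g (x' - y) - g (x' + y))| ≤
          4 * C * (‖x - x'‖ ^ (α / 2) * ‖y‖ ^ (α / 2)) := by
        have e1 : ‖x - x'‖ ^ α = ‖x - x'‖ ^ (α / 2) * ‖x - x'‖ ^ (α / 2) := by
          rw [← Real.rpow_add_of_nonneg (norm_nonneg _) (by positivity) (by positivity)]; congr 1; ring
        have e2 : ‖y‖ ^ α = ‖y‖ ^ (α / 2) * ‖y‖ ^ (α / 2) := by
          rw [← Real.rpow_add_of_nonneg (norm_nonneg _) (by positivity) (by positivity)]; congr 1; ring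
        have p1 : 0 ≤ ‖x - x'‖ ^ (α / 2) := by positivity
        have p2 : 0 ≤ ‖y‖ ^ (α / 2) := by positivity
        rcases le_total (‖x - x'‖ ^ (α / 2)) (‖y‖ ^ (α / 2)) with hle | hle
        · refine hb.trans ?_
          rw [e1]
          have : ‖x - x'‖ ^ (α / 2) * ‖x - x'‖ ^ (α / 2) ≤ ‖x - x'‖ ^ (α / 2) * ‖y‖ ^ (α / 2) := by gcongr
          nlinarith [mul_nonneg hC (mul_nonneg p1 p2), mul_le_mul_of_nonneg_left this hC]
        · refine ha.trans ?_
          rw [e2]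
          gcongr
      calc _ ≤ (‖y‖ ^ d)⁻¹ * (4 * C * (‖x - x'‖ ^ (α / 2) * ‖y‖ ^ (α / 2))) := by gcongr
        _ = _ := by ring
    · rw [Set.indicator_of_notMem hy] at h1 ⊢
      have : |rieszKernel j y - cutKernel j (r / 2) y| = 0 := le_antisymm h1 (abs_nonneg _)
      rw [this]; simp

theorem LocHolder.of_mem_ball {g : 𝔼 → ℝ} {x : 𝔼} {r C α : ℝ} (hC : 0 ≤ C) (hα : 0 < α)
    (hα1 : α ≤ 1)
    (hH : ∀ y ∈ Metric.ball x r, ∀ z ∈ Metric.ball x r, |g y - g z| ≤ C * ‖y - z‖ ^ α)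
    {w : 𝔼} (hw : w ∈ Metric.ball x r) : LocHolder g w := by
  have hw' := Metric.mem_ball.1 hw
  have hsub : Metric.ball w (r - dist w x) ⊆ Metric.ball x r := Metric.ball_subset_ball' (by linarith)
  exact ⟨r - dist w x, C, α, by linarith, hC, hα, hα1, fun y hy z hz => hH y (hsub hy) z (hsub hz)⟩

/-- The near part is Hölder with half the exponent and the far part is Lipschitz. Since the
regularity is kept at the same point, principal values can be iterated without enlarging the
exceptional set. -/
theorem LocHolder.riesz {g : 𝔼 → ℝ} {x : 𝔼} (h : LocHolder g x) (hg : MemLp g 2 volume)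
    (j : Fin d) : LocHolder (riesz j g) x := by
  obtain ⟨r, C, α, hr, hC, hα, hα1, hH⟩ := h
  obtain ⟨C1, hC1, h1⟩ := near_convolution_sub_le hg.1 j hC hα hα1 hH
  obtain ⟨C2, hC2, h2⟩ := cut_convolution_sub_le hg j (half_pos hr) x
  have hK := rieszKernelConst_pos d
  -- The far estimate with cutoff r/2 holds on radius r/8; the bound 1/2 forces |y - z| ≤ 1, so a
  -- Lipschitz bound is also a Hölder bound.
  refine ⟨min (r / 8) (1 / 2), rieszKernelConst d * (1 / 2 * (C1 + C2)), α / 2, by positivity,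
    by positivity, by positivity, by linarith, fun y hy z hz => ?_⟩
  have hyr : dist y x < r / 8 := lt_of_lt_of_le hy (min_le_left _ _)
  have hzr : dist z x < r / 8 := lt_of_lt_of_le hz (min_le_left _ _)
  have hyz : ‖y - z‖ ≤ 1 := by
    have a1 : dist y x < 1 / 2 := lt_of_lt_of_le hy (min_le_right _ _)
    have a2 : dist z x < 1 / 2 := lt_of_lt_of_le hz (min_le_right _ _)
    have := dist_triangle_right y z x
    rw [← dist_eq_norm]; linarith
  have hsplit : ∀ w, dist w x < r / 8 → RieszPowers.riesz j g w = rieszKernelConst d * (1 / 2 *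
      ((∫ y, (rieszKernel j y - cutKernel j (r / 2) y) * (g (w - y) - g (w + y))) +
        ∫ y, cutKernel j (r / 2) y * (g (w - y) - g (w + y)))) := by
    intro w hw
    have hwr : w ∈ Metric.ball x r := Metric.mem_ball.2 (by linarith)
    rw [(LocHolder.of_mem_ball hC hα hα1 hH hwr).riesz_eq hg j, ← integral_add]
    · congr 3
      funext y
      ring
    · refine LocHolder.integrable_near hg.1 j hα (C := C) fun y hy z hz => hH y ?_ z ?_
      · have := Metric.mem_ball.1 hy
        have := dist_triangle y w x
        exact Metric.mem_ball.2 (by linarith)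
      · have := Metric.mem_ball.1 hz
        have := dist_triangle z w x
        exact Metric.mem_ball.2 (by linarith)
    · exact (memLp_cutKernel j (half_pos hr)).integrable_mul
        ((memLp_comp_sub_left hg w).sub (memLp_comp_add_left hg w))
  rw [hsplit y hyr, hsplit z hzr, ← mul_sub, ← mul_sub, abs_mul, abs_mul, abs_of_pos hK,
    abs_of_pos (by norm_num : (0 : ℝ) < 1 / 2), mul_assoc, mul_assoc]
  have b1 := h1 y (Metric.mem_ball.2 (by linarith)) z (Metric.mem_ball.2 (by linarith))
  have b2 := h2 y (Metric.mem_ball.2 (by linarith)) z (Metric.mem_ball.2 (by linarith))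
  have b3 : ‖y - z‖ ≤ ‖y - z‖ ^ (α / 2) := by
    calc ‖y - z‖ = ‖y - z‖ ^ (1 : ℝ) := (Real.rpow_one _).symm
      _ ≤ _ := by
        rcases (norm_nonneg (y - z)).eq_or_lt with h0 | h0
        · rw [← h0, Real.zero_rpow one_ne_zero]; positivity
        · exact Real.rpow_le_rpow_of_exponent_ge h0 hyz (by linarith)
  gcongr
  rw [add_sub_add_comm, add_mul]
  refine (abs_add_le _ _).trans (add_le_add b1 (b2.trans ?_))
  gcongr

end HolderPropagation

end RieszPowers

namespace RieszPowers

/-! ### Multipliers and existence of the powers of the Riesz transform. -/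

section Iteration

open FourierTransform

variable {d : ℕ}

local notation "𝔼" => EuclideanSpace ℝ (Fin d)

theorem abs_inner_mul_truncProfile_le (a ξ : 𝔼) (n : ℕ) :
    |inner ℝ a ξ * truncProfile 0 n ‖ξ‖| ≤ ‖a‖ := by
  rcases eq_or_ne ξ 0 with rfl | hξ
  · simp
  · have h0 : 0 < ‖ξ‖ := norm_pos_iff.2 hξ
    have h1 := truncProfile_le 0 n h0
    rw [rieszKernelConst_zero, zero_add, pow_one] at h1
    rw [abs_mul, abs_of_nonneg (truncProfile_nonneg _ _ _)]
    calc _ ≤ (‖a‖ * ‖ξ‖) * (1 / ‖ξ‖) := by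
          gcongr
          · exact truncProfile_nonneg _ _ _
          · exact abs_real_inner_le_norm a ξ
      _ = ‖a‖ := by field_simp

/-- The smoothly truncated convolutions have explicit multipliers bounded by 1. Multipliers and
convolutions both converge pointwise, so the limit theorem in L² applies. -/
theorem HasFT.riesz_real {g : 𝔼 → ℝ} {u : 𝔼 → ℂ} (h : HasFT (fun x => (g x : ℂ)) u) (j : Fin d)
    (hH : ∀ᵐ x ∂(volume : Measure 𝔼), LocHolder g x) :
    HasFT (fun x => ((riesz j g x : ℝ) : ℂ)) (fun ξ => -Complex.I * ((ξ j / ‖ξ‖ : ℝ) : ℂ) * u ξ) := by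
  have hg : MemLp g 2 volume := by
    have := h.choose.re
    simpa using this
  have hu : MemLp u 2 volume := h.choose_spec.choose
  set a : 𝔼 := EuclideanSpace.single j (1 : ℝ)
  have ha : ‖a‖ = 1 := by simp [a]
  have hin : ∀ ξ : 𝔼, inner ℝ a ξ = ξ j := fun ξ => by
    rw [EuclideanSpace.inner_single_left]; simp
  have := Fin.pos j
  refine HasFT.of_tendsto (w := fun n x => ∫ y, (truncKernel a n y : ℂ) * (g (x - y) : ℂ))
    (p := fun n => 𝓕 (fun v => (truncKernel a n v : ℂ))) (C := 1)
    (fun n => h.convolution (integrable_truncKernel a n) (memLp_truncKernel a n)) hu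
    (fun n => (fourier_continuous (integrable_truncKernel a n).ofReal).aestronglyMeasurable) ?_ ?_ ?_
  · intro n ξ
    rw [fourier_truncKernel, norm_mul, norm_neg, Complex.norm_I, one_mul, Complex.norm_real,
      Real.norm_eq_abs]
    exact (abs_inner_mul_truncProfile_le a ξ n).trans ha.le
  · refine Eventually.of_forall fun ξ => ?_
    simp only [fourier_truncKernel]
    refine Tendsto.const_mul _ ?_
    refine (Complex.continuous_ofReal.tendsto _).comp ?_
    rcases eq_or_ne ξ 0 with rfl | hξ
    · simp
    · have h0 : 0 < ‖ξ‖ := norm_pos_iff.2 hξ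
      have h1 := (tendsto_truncProfile 0 h0).const_mul (ξ j)
      rw [rieszKernelConst_zero, zero_add, pow_one, mul_one_div] at h1
      simpa only [hin] using h1
  · filter_upwards [hH] with x hx
    refine ((Complex.continuous_ofReal.tendsto _).comp (hx.tendsto_trunc hg j)).congr fun n => ?_
    simp only [Function.comp, ← Complex.ofReal_mul]
    rw [integral_complex_ofReal]

theorem rieszPow_succ {X : Type*} [NormedAddCommGroup X] [NormedSpace ℝ X] (j : Fin d) (k : ℕ)
    (g : 𝔼 → X) : rieszPow j (k + 1) g = riesz j (rieszPow j k g) :=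
  Function.iterate_succ_apply' _ _ _

/-- The multiplier, square integrability and local regularity feed each other at the next power, so
one induction carries all three, with the same full-measure set U throughout. -/
theorem HasFT.rieszPow_real {g : 𝔼 → ℝ} {u : 𝔼 → ℂ} (h : HasFT (fun x => (g x : ℂ)) u) (j : Fin d)
    {U : Set 𝔼} (hU : ∀ᵐ x ∂(volume : Measure 𝔼), x ∈ U) (hH : ∀ x ∈ U, LocHolder g x) (k : ℕ) :
    HasFT (fun x => ((rieszPow j k g x : ℝ) : ℂ))
      (fun ξ => (-Complex.I * ((ξ j / ‖ξ‖ : ℝ) : ℂ)) ^ k * u ξ) ∧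
    MemLp (rieszPow j k g) 2 volume ∧ ∀ x ∈ U, LocHolder (rieszPow j k g) x := by
  have hreal : ∀ {g : 𝔼 → ℝ} {u : 𝔼 → ℂ}, HasFT (fun x => (g x : ℂ)) u → MemLp g 2 volume := by
    intro g u h
    have := h.choose.re
    simpa using this
  induction k with
  | zero => exact ⟨by simpa [rieszPow] using h, hreal h, hH⟩
  | succ k ih =>
    obtain ⟨h1, h2, h3⟩ := ih
    have h4 := h1.riesz_real j (hU.mono h3)
    rw [rieszPow_succ]
    refine ⟨?_, hreal h4, fun x hx => (h3 x hx).riesz h2 j⟩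
    refine h4.congr (ae_of_all _ fun x => rfl) (ae_of_all _ fun ξ => ?_)
    simp only
    ring

variable {X : Type*} [NormedAddCommGroup X] [NormedSpace ℝ X] [CompleteSpace X]

/-- Truncated integrals ignore null sets, so F need only match almost everywhere. This matters in
iteration, where off the good set a principal value is an arbitrary default. -/
theorem riesz_sum_smul (j : Fin d) {N : ℕ} {g : Fin N → 𝔼 → ℝ} (v : Fin N → X) {F : 𝔼 → X}
    (hF : F =ᵐ[volume] fun x => ∑ i, g i x • v i) (hg : ∀ i, MemLp (g i) 2 volume) {x : 𝔼}
    (hx : ∀ i, LocHolder (g i) x) : riesz j F x = ∑ i, riesz j (g i) x • v i := by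
  have hlim : Tendsto (fun ε : ℝ => ∑ i, (∫ y in {y : 𝔼 | ε < dist y 0}, rieszKernel j y * g i (x - y)) • v i)
      (𝓝[>] 0) (𝓝 (∑ i, (1 / 2 * ∫ y, rieszKernel j y * (g i (x - y) - g i (x + y))) • v i)) :=
    tendsto_finsetSum _ fun i _ => ((hx i).tendsto_pv (hg i) j).smul_const _
  have hlim2 : Tendsto (fun ε : ℝ => ∫ y in {y : 𝔼 | ε < dist y 0}, (y j / ‖y‖ ^ (d + 1)) • F (x - y))
      (𝓝[>] 0) (𝓝 (∑ i, (1 / 2 * ∫ y, rieszKernel j y * (g i (x - y) - g i (x + y))) • v i)) := by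
    refine hlim.congr' ?_
    filter_upwards [self_mem_nhdsWithin] with ε hε
    have hε0 : 0 < ε := hε
    have hF' : ∀ᵐ y ∂(volume : Measure 𝔼), F (x - y) = ∑ i, g i (x - y) • v i :=
      (Measure.measurePreserving_sub_left volume x).quasiMeasurePreserving.ae hF
    have e1 : ∫ y in {y : 𝔼 | ε < dist y 0}, (y j / ‖y‖ ^ (d + 1)) • F (x - y) =
        ∫ y in {y : 𝔼 | ε < dist y 0}, ∑ i, (rieszKernel j y * g i (x - y)) • v i := by
      refine integral_congr_ae (ae_restrict_of_ae ?_)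
      filter_upwards [hF'] with y hy
      rw [hy, Finset.smul_sum]
      simp only [smul_smul, rieszKernel]
    rw [e1, integral_finsetSum]
    · simp only [integral_smul_const]
    · intro i _
      exact (integrableOn_rieszKernel_mul (hg i) j x hε0).smul_const _
  have hr : riesz j F x = rieszKernelConst d •
      ∑ i, (1 / 2 * ∫ y, rieszKernel j y * (g i (x - y) - g i (x + y))) • v i := by
    unfold riesz pvIntegral
    congr 1
    exact hlim2.limUnder_eq
  rw [hr, Finset.smul_sum]
  refine Finset.sum_congr rfl fun i _ => ?_
  rw [(hx i).riesz_eq (hg i) j, smul_smul]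

theorem rieszPow_sum_smul (j : Fin d) {N : ℕ} {g : Fin N → 𝔼 → ℝ} (v : Fin N → X) {F : 𝔼 → X}
    (hF : F =ᵐ[volume] fun x => ∑ i, g i x • v i) {u : Fin N → 𝔼 → ℂ}
    (hg : ∀ i, HasFT (fun x => (g i x : ℂ)) (u i)) {U : Set 𝔼}
    (hU : ∀ᵐ x ∂(volume : Measure 𝔼), x ∈ U) (hx : ∀ i, ∀ x ∈ U, LocHolder (g i) x) (k : ℕ) :
    rieszPow j k F =ᵐ[volume] fun x => ∑ i, rieszPow j k (g i) x • v i := by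
  induction k with
  | zero => simpa [rieszPow] using hF
  | succ k ih =>
    rw [rieszPow_succ]
    filter_upwards [hU] with x hxU
    rw [riesz_sum_smul j v ih (fun i => ((hg i).rieszPow_real j hU (hx i) k).2.1)
      (fun i => ((hg i).rieszPow_real j hU (hx i) k).2.2 x hxU)]
    exact Finset.sum_congr rfl fun i _ => by rw [rieszPow_succ]

/-! ### Rectangles and bounded convex sets. -/

/-- The rectangle with sides `I i`. -/
def rect (I : Fin d → Set ℝ) : Set (EuclideanSpace ℝ (Fin d)) := {y | ∀ i, y i ∈ I i}

theorem isBounded_of_ordConnected {I : Set ℝ} (h : I.OrdConnected) (hv : volume I < ∞) :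
    Bornology.IsBounded I := by
  rcases I.eq_empty_or_nonempty with rfl | ⟨a, ha⟩
  · exact Bornology.isBounded_empty
  rw [isBounded_iff_bddBelow_bddAbove]
  constructor
  · by_contra hb
    have : Set.Iic a ⊆ I := by
      intro x hx
      rw [not_bddBelow_iff] at hb
      obtain ⟨y, hy, hyx⟩ := hb x
      exact h.out hy ha ⟨hyx.le, hx⟩
    have h2 := measure_mono (μ := volume) this
    rw [Real.volume_Iic] at h2
    exact absurd (lt_of_le_of_lt h2 hv) (lt_irrefl _)
  · by_contra hb
    have : Set.Ici a ⊆ I := by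
      intro x hx
      rw [not_bddAbove_iff] at hb
      obtain ⟨y, hy, hyx⟩ := hb x
      exact h.out ha hy ⟨hx, hyx.le⟩
    have h2 := measure_mono (μ := volume) this
    rw [Real.volume_Ici] at h2
    exact absurd (lt_of_le_of_lt h2 hv) (lt_irrefl _)

theorem rect_convex {I : Fin d → Set ℝ} (h : ∀ i, (I i).OrdConnected) : Convex ℝ (rect I) := by
  intro x hx y hy a b ha hb hab i
  have := (h i).convex (hx i) (hy i) ha hb hab
  simpa using this

theorem rect_measurable {I : Fin d → Set ℝ} (h : ∀ i, (I i).OrdConnected) :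
    MeasurableSet (rect I) := by
  have : rect I = ⋂ i, {y : 𝔼 | y i ∈ I i} := by ext; simp [rect]
  rw [this]
  refine MeasurableSet.iInter fun i => ?_
  exact (h i).measurableSet.preimage (by fun_prop : Measurable fun y : 𝔼 => y i)

theorem rect_isBounded {I : Fin d → Set ℝ} (h : ∀ i, (I i).OrdConnected)
    (hv : ∀ i, volume (I i) < ∞) : Bornology.IsBounded (rect I) := by
  choose R hR using fun i => (isBounded_of_ordConnected (h i) (hv i)).exists_norm_le
  rw [isBounded_iff_forall_norm_le]
  refine ⟨√(∑ i, R i ^ 2), fun x hx => ?_⟩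
  rw [EuclideanSpace.norm_eq]
  refine Real.sqrt_le_sqrt (Finset.sum_le_sum fun i _ => ?_)
  exact pow_le_pow_left₀ (norm_nonneg _) (hR i _ (hx i)) 2

/-- A bounded convex measurable set. -/
structure IsBody (Q : Set (EuclideanSpace ℝ (Fin d))) : Prop where
  convex : Convex ℝ Q
  measurable : MeasurableSet Q
  bounded : Bornology.IsBounded Q

/-- Convex sets have null frontier; this is the only exceptional set for an indicator and all powers
of its Riesz transform. -/
theorem IsBody.ae_notMem_frontier {Q : Set 𝔼} (h : IsBody Q) :
    ∀ᵐ x ∂(volume : Measure 𝔼), x ∉ frontier Q :=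
  measure_eq_zero_iff_ae_notMem.1 (h.convex.addHaar_frontier volume)

/-- The indicator function of a set, as a real function. -/
noncomputable def ind (Q : Set (EuclideanSpace ℝ (Fin d))) : EuclideanSpace ℝ (Fin d) → ℝ :=
  Q.indicator fun _ => 1

theorem exists_ball_ind_const {Q : Set 𝔼} {x : 𝔼} (hx : x ∉ frontier Q) :
    ∃ r > 0, ∀ y ∈ Metric.ball x r, ind Q y = ind Q x := by
  have h : x ∈ interior Q ∪ interior Qᶜ := by
    by_contra hc
    rw [Set.mem_union, not_or] at hc
    refine hx ⟨?_, hc.1⟩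
    rw [interior_compl, Set.mem_compl_iff, not_not] at hc
    exact hc.2
  rcases h with h | h
  · obtain ⟨r, hr, hs⟩ := Metric.mem_nhds_iff.1 (mem_interior_iff_mem_nhds.1 h)
    refine ⟨r, hr, fun y hy => ?_⟩
    rw [ind, Set.indicator_of_mem (hs hy), Set.indicator_of_mem (hs (Metric.mem_ball_self hr))]
  · obtain ⟨r, hr, hs⟩ := Metric.mem_nhds_iff.1 (mem_interior_iff_mem_nhds.1 h)
    refine ⟨r, hr, fun y hy => ?_⟩
    rw [ind, Set.indicator_of_notMem (hs hy), Set.indicator_of_notMem (hs (Metric.mem_ball_self hr))]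

theorem locHolder_ind {Q : Set 𝔼} {x : 𝔼} (hx : x ∉ frontier Q) : LocHolder (ind Q) x := by
  obtain ⟨r, hr, h⟩ := exists_ball_ind_const hx
  refine ⟨r, 0, 1, hr, le_rfl, one_pos, le_rfl, fun y hy z hz => ?_⟩
  rw [h y hy, h z hz]; simp

theorem IsBody.integrable_ind {Q : Set 𝔼} (h : IsBody Q) : Integrable (ind Q) :=
  (integrable_indicator_iff h.measurable).2 (integrableOn_const h.bounded.measure_lt_top.ne)

theorem IsBody.hasFT_ind {Q : Set 𝔼} (h : IsBody Q) :
    HasFT (fun x => (ind Q x : ℂ)) (𝓕 fun x => (ind Q x : ℂ)) := by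
  refine hasFT_fourierIntegral h.integrable_ind.ofReal ?_
  have : MemLp (ind Q) 2 volume :=
    memLp_indicator_const 2 h.measurable 1 (Or.inr h.bounded.measure_lt_top.ne)
  exact this.ofReal

end Iteration

end RieszPowers

namespace RieszPowers

/-! ### Directional Hilbert transforms and their averages. -/

section Directional

open FourierTransform

variable {d : ℕ}

local notation "𝔼" => EuclideanSpace ℝ (Fin d)

section Superposition

variable {S : Type*} [MeasurableSpace S] {ν : Measure S} [SFinite ν] {w : S → ℝ}
  {τ : S → EuclideanSpace ℝ (Fin d)} {f : EuclideanSpace ℝ (Fin d) → ℝ}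

theorem integrable_prod_translate (hw : Integrable w ν) (hτ : Measurable τ) (hfm : Measurable f)
    (hf : Integrable f) :
    Integrable (fun p : 𝔼 × S => w p.2 * f (p.1 - τ p.2)) ((volume : Measure 𝔼).prod ν) := by
  have hm : AEStronglyMeasurable (fun p : 𝔼 × S => w p.2 * f (p.1 - τ p.2))
      ((volume : Measure 𝔼).prod ν) :=
    (hw.1.comp_quasiMeasurePreserving Measure.quasiMeasurePreserving_snd).mul
      (hfm.comp (measurable_fst.sub (hτ.comp measurable_snd))).aestronglyMeasurable
  rw [integrable_prod_iff' hm]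
  refine ⟨Eventually.of_forall fun s => (hf.comp_sub_right (τ s)).const_mul (w s), ?_⟩
  have : (fun s => ∫ x, ‖w s * f (x - τ s)‖) = fun s => ‖w s‖ * ∫ x, ‖f x‖ := by
    funext s
    simp only [norm_mul]
    rw [integral_const_mul, integral_sub_right_eq_self (fun x => ‖f x‖) (τ s)]
  rw [this]
  exact hw.norm.mul_const _

/-- The Fourier transform of a superposition of translates. -/
theorem fourier_superposition (hw : Integrable w ν) (hτ : Measurable τ) (hfm : Measurable f)
    (hf : Integrable f) (ξ : 𝔼) :
    𝓕 (fun x => ((∫ s, w s * f (x - τ s) ∂ν : ℝ) : ℂ)) ξ =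
      (∫ s, (w s : ℂ) * (Real.fourierChar (-inner ℝ (τ s) ξ) : ℂ) ∂ν) * 𝓕 (fun x => (f x : ℂ)) ξ := by
  have hi := (integrable_prod_translate hw hτ hfm hf).ofReal (𝕜 := ℂ)
  have hi2 : Integrable (fun p : 𝔼 × S => (Real.fourierChar (-inner ℝ p.1 ξ) : ℂ) *
      ((w p.2 * f (p.1 - τ p.2) : ℝ) : ℂ)) ((volume : Measure 𝔼).prod ν) := by
    refine hi.bdd_mul (c := 1) ?_ (Eventually.of_forall fun p => (Circle.norm_coe _).le)
    have : Continuous fun x : 𝔼 => (Real.fourierChar (-inner ℝ x ξ) : ℂ) :=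
      continuous_subtype_val.comp (Real.continuous_fourierChar.comp (by fun_prop))
    exact (this.measurable.comp measurable_fst).aestronglyMeasurable
  have hswap := integral_integral_swap (f := fun (x : 𝔼) (s : S) =>
    (Real.fourierChar (-inner ℝ x ξ) : ℂ) * ((w s * f (x - τ s) : ℝ) : ℂ)) hi2
  rw [Real.fourier_eq, ← integral_mul_const]
  have e1 : ∫ x : 𝔼, Real.fourierChar (-inner ℝ x ξ) • ((∫ s, w s * f (x - τ s) ∂ν : ℝ) : ℂ) =
      ∫ x : 𝔼, ∫ s, (Real.fourierChar (-inner ℝ x ξ) : ℂ) * ((w s * f (x - τ s) : ℝ) : ℂ) ∂ν := by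
    refine integral_congr_ae (Eventually.of_forall fun x => ?_)
    simp only [Circle.smul_def, smul_eq_mul]
    rw [integral_const_mul, integral_complex_ofReal]
  rw [e1, hswap]
  refine integral_congr_ae (Eventually.of_forall fun s => ?_)
  simp only
  rw [Real.fourier_eq, ← integral_const_mul,
    ← integral_add_right_eq_self _ (τ s)]
  refine integral_congr_ae (Eventually.of_forall fun x => ?_)
  simp only [add_sub_cancel_right, Circle.smul_def, smul_eq_mul, Complex.ofReal_mul]
  rw [inner_add_left, neg_add, AddChar.map_add_eq_mul, Circle.coe_mul]
  ring

theorem hasFT_superposition (hw : Integrable w ν) (hτ : Measurable τ) (hfm : Measurable f)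
    (hf : Integrable f) {B : ℝ} (hB : ∀ x, |f x| ≤ B) :
    HasFT (fun x => ((∫ s, w s * f (x - τ s) ∂ν : ℝ) : ℂ))
      (fun ξ => (∫ s, (w s : ℂ) * (Real.fourierChar (-inner ℝ (τ s) ξ) : ℂ) ∂ν) *
        𝓕 (fun x => (f x : ℂ)) ξ) := by
  have hi : Integrable (fun x => ∫ s, w s * f (x - τ s) ∂ν) :=
    (integrable_prod_translate hw hτ hfm hf).integral_prod_left
  have hbd : MemLp (fun x => ∫ s, w s * f (x - τ s) ∂ν) ⊤ volume := by
    refine memLp_top_of_bound hi.1 (∫ s, ‖w s‖ * B ∂ν) (Eventually.of_forall fun x => ?_)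
    refine norm_integral_le_of_norm_le (hw.norm.mul_const B) (Eventually.of_forall fun s => ?_)
    rw [norm_mul]
    gcongr
    exact hB _
  have h2 : MemLp (fun x => ∫ s, w s * f (x - τ s) ∂ν) 2 volume := by
    rw [memLp_two_iff_integrable_sq hi.1]
    have := hi.mul_of_top_right hbd
    refine this.congr (Eventually.of_forall fun x => ?_)
    simp only [Pi.mul_apply]; ring
  have h3 := hasFT_fourierIntegral hi.ofReal h2.ofReal
  refine h3.congr (ae_of_all _ fun x => rfl) (ae_of_all _ fun ξ => ?_)
  exact fourier_superposition hw hτ hfm hf ξ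

end Superposition

/-- The Hilbert transform of a real function along the direction `g`, as an absolutely convergent
symmetrized integral. -/
noncomputable def dirHilbert (f : EuclideanSpace ℝ (Fin d) → ℝ) (x g : EuclideanSpace ℝ (Fin d)) : ℝ :=
  1 / Real.pi * (1 / 2 * ∫ t : ℝ, 1 / t * (f (x - t • g) - f (x + t • g)))

theorem stronglyMeasurable_dirHilbert {f : 𝔼 → ℝ} (hf : Measurable f) :
    StronglyMeasurable fun p : 𝔼 × 𝔼 => dirHilbert f p.1 p.2 := by
  unfold dirHilbert
  refine (StronglyMeasurable.const_mul ?_ _).const_mul _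
  refine StronglyMeasurable.integral_prod_right' (f := fun q : (𝔼 × 𝔼) × ℝ =>
    1 / q.2 * (f (q.1.1 - q.2 • q.1.2) - f (q.1.1 + q.2 • q.1.2))) ?_
  exact Measurable.stronglyMeasurable (by fun_prop)

/-- Off the frontier of a bounded set, the symmetrized difference quotients along all directions are
dominated by integrable functions of uniformly bounded mass. -/
theorem IsBody.exists_bound {Q : Set 𝔼} (h : IsBody Q) {x : 𝔼} (hx : x ∉ frontier Q) :
    ∃ B, 0 ≤ B ∧ ∀ g, Integrable (fun t : ℝ => 1 / t * (ind Q (x - t • g) - ind Q (x + t • g))) ∧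
      ∫ t : ℝ, ‖1 / t * (ind Q (x - t • g) - ind Q (x + t • g))‖ ≤ B := by
  obtain ⟨r, hr, hconst⟩ := exists_ball_ind_const hx
  obtain ⟨R, hR⟩ := h.bounded.exists_norm_le
  have hmeas : Measurable (ind Q) := measurable_const.indicator h.measurable
  -- The integrand vanishes for |t||g| < r and for |t||g| > |R| + |x|. Between, it is at most |g|/r
  -- on an interval of length 2(|R| + |x|)/|g|; the factor |g| cancels, so the bound is uniform in
  -- direction.
  refine ⟨1 / r * (2 * (|R| + ‖x‖)), by positivity, fun g => ?_⟩
  rcases eq_or_ne g 0 with rfl | hg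
  · simp only [smul_zero, sub_zero, add_zero, sub_self, mul_zero, norm_zero, integral_zero]
    exact ⟨integrable_zero _ _ _, by positivity⟩
  have hg0 : 0 < ‖g‖ := norm_pos_iff.2 hg
  set A : ℝ := (|R| + ‖x‖) / ‖g‖ with hA
  have hA0 : 0 ≤ A := by positivity
  have hdom : ∀ t : ℝ, ‖1 / t * (ind Q (x - t • g) - ind Q (x + t • g))‖ ≤
      (Set.Icc (-A) A).indicator (fun _ => ‖g‖ / r) t := by
    intro t
    have hd : ∀ y z, |ind Q y - ind Q z| ≤ 1 := by
      intro y z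
      unfold ind Set.indicator
      split_ifs <;> norm_num
    by_cases ht : |t| * ‖g‖ < r
    · have e1 : ind Q (x - t • g) = ind Q x := hconst _ (by
        rw [Metric.mem_ball, dist_eq_norm]; simpa [norm_smul] using ht)
      have e2 : ind Q (x + t • g) = ind Q x := hconst _ (by
        rw [Metric.mem_ball, dist_eq_norm]; simpa [norm_smul] using ht)
      rw [e1, e2, sub_self, mul_zero, norm_zero]
      exact Set.indicator_nonneg (fun _ _ => by positivity) _
    rw [not_lt] at ht
    by_cases hta : t ∈ Set.Icc (-A) A
    · rw [Set.indicator_of_mem hta, norm_mul, Real.norm_eq_abs, Real.norm_eq_abs]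
      have ht0 : 0 < |t| := by
        by_contra hc
        have : |t| = 0 := le_antisymm (not_lt.1 hc) (abs_nonneg t)
        rw [this, zero_mul] at ht
        linarith
      have h1 : |1 / t| ≤ ‖g‖ / r := by
        rw [abs_div, abs_one, div_le_div_iff₀ ht0 hr]
        linarith
      calc _ ≤ ‖g‖ / r * 1 := by gcongr; exact hd _ _
        _ = _ := mul_one _
    · have hbig : |R| + ‖x‖ < ‖t • g‖ := by
        rw [norm_smul, Real.norm_eq_abs]
        have : A < |t| := by
          by_contra hc
          exact hta (abs_le.1 (not_lt.1 hc))
        exact (div_lt_iff₀ hg0).1 this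
      have hn : ∀ y, |R| < ‖y‖ → ind Q y = 0 := by
        intro y hy
        refine Set.indicator_of_notMem (fun hc => ?_) _
        exact absurd (hR y hc) (not_le.2 ((le_abs_self R).trans_lt hy))
      have e1 : ind Q (x - t • g) = 0 := hn _ (by
        have := norm_sub_norm_le (t • g) x
        rw [norm_sub_rev]
        linarith)
      have e2 : ind Q (x + t • g) = 0 := hn _ (by
        have := norm_sub_norm_le (t • g) (-x)
        rw [norm_neg, sub_neg_eq_add, add_comm] at this
        linarith)
      rw [e1, e2, Set.indicator_of_notMem hta]
      simp
  have hdomi : Integrable ((Set.Icc (-A) A).indicator (fun _ => ‖g‖ / r)) :=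
    (integrable_indicator_iff measurableSet_Icc).2 (integrableOn_const (by simp))
  refine ⟨hdomi.mono' (Measurable.aestronglyMeasurable (by fun_prop)) (Eventually.of_forall hdom), ?_⟩
  refine (integral_mono_of_nonneg (Eventually.of_forall fun t => norm_nonneg _) hdomi
    (Eventually.of_forall hdom)).trans ?_
  rw [integral_indicator measurableSet_Icc, setIntegral_const, Real.volume_real_Icc_of_le (by linarith),
    smul_eq_mul, hA]
  apply le_of_eq
  field_simp
  ring

theorem IsBody.abs_dirHilbert_le {Q : Set 𝔼} (h : IsBody Q) {x : 𝔼} (hx : x ∉ frontier Q) :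
    ∃ B, 0 ≤ B ∧ ∀ g, |dirHilbert (ind Q) x g| ≤ B := by
  obtain ⟨B, hB, hb⟩ := h.exists_bound hx
  refine ⟨1 / Real.pi * (1 / 2 * B), by have := Real.pi_pos; positivity, fun g => ?_⟩
  have hpi := Real.pi_pos
  rw [dirHilbert, abs_mul, abs_mul, abs_of_pos (a := 1 / Real.pi) (by positivity),
    abs_of_pos (a := (1 : ℝ) / 2) (by norm_num)]
  gcongr
  rw [← Real.norm_eq_abs]
  exact (norm_integral_le_integral_norm _).trans (hb g).2

theorem integral_odd_mul {k φ : ℝ → ℝ} (hk : ∀ t, k (-t) = -k t)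
    (hi : Integrable fun t => k t * φ t) :
    ∫ t, k t * φ t = 1 / 2 * ∫ t, k t * (φ t - φ (-t)) := by
  have h1 : Integrable fun t => k t * φ (-t) := by
    refine hi.comp_neg.neg.congr (Eventually.of_forall fun t => ?_)
    simp [hk]
  have h2 : ∫ t, k t * φ (-t) = -∫ t, k t * φ t := by
    rw [← integral_neg, ← integral_neg_eq_self]
    simp [hk]
  simp only [mul_sub]
  rw [integral_sub hi h1, h2]
  ring

theorem rieszKernelConst_one : rieszKernelConst 1 = 1 / Real.pi := by
  simp only [rieszKernelConst, Nat.cast_one]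
  norm_num

theorem truncKernel_real (n : ℕ) (t : ℝ) : truncKernel (1 : ℝ) n t = t * truncProfile 1 n |t| := by
  simp [truncKernel]

theorem truncKernel_real_neg (n : ℕ) (t : ℝ) : truncKernel (1 : ℝ) n (-t) = -truncKernel (1 : ℝ) n t := by
  simp [truncKernel_real]

theorem abs_truncKernel_real_le (n : ℕ) (t : ℝ) : |truncKernel (1 : ℝ) n t| ≤ 1 / Real.pi * |1 / t| := by
  rw [truncKernel_real, abs_mul, abs_of_nonneg (truncProfile_nonneg _ _ _)]
  rcases eq_or_ne t 0 with rfl | ht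
  · simp
  · have h0 : 0 < |t| := abs_pos.2 ht
    have h1 := truncProfile_le 1 n h0
    rw [rieszKernelConst_one] at h1
    calc _ ≤ |t| * (1 / Real.pi / |t| ^ (1 + 1)) := by gcongr
      _ = _ := by rw [abs_div, abs_one]; field_simp

theorem tendsto_truncKernel_real (t : ℝ) :
    Tendsto (fun n => truncKernel (1 : ℝ) n t) atTop (𝓝 (1 / Real.pi * (1 / t))) := by
  simp only [truncKernel_real]
  rcases eq_or_ne t 0 with rfl | ht
  · simp
  · have h0 : 0 < |t| := abs_pos.2 ht
    have h1 := (tendsto_truncProfile 1 h0).const_mul t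
    rw [rieszKernelConst_one] at h1
    convert h1 using 2
    rw [one_add_one_eq_two, sq_abs]
    field_simp

theorem integral_truncKernel_real_mul {f : 𝔼 → ℝ} (hf : Measurable f) {C : ℝ} (hC : ∀ x, |f x| ≤ C)
    (n : ℕ) (x g : 𝔼) :
    ∫ t, truncKernel (1 : ℝ) n t * f (x - t • g) =
      1 / 2 * ∫ t, truncKernel (1 : ℝ) n t * (f (x - t • g) - f (x + t • g)) := by
  have hi : Integrable (fun t => truncKernel (1 : ℝ) n t * f (x - t • g)) :=
    (integrable_truncKernel (1 : ℝ) n).mul_bdd (c := C)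
      (Measurable.aestronglyMeasurable (by fun_prop)) (Eventually.of_forall fun t => hC _)
  have h1 := integral_odd_mul (truncKernel_real_neg n) hi
  simpa using h1

theorem measurable_ind {Q : Set 𝔼} (h : MeasurableSet Q) : Measurable (ind Q) :=
  measurable_const.indicator h

theorem abs_ind_le (Q : Set 𝔼) (x : 𝔼) : |ind Q x| ≤ 1 := by
  unfold ind Set.indicator
  split_ifs <;> simp

/-- The smoothly truncated Hilbert transform along a direction converges. -/
theorem IsBody.tendsto_trunc_dirHilbert {Q : Set 𝔼} (h : IsBody Q) {x : 𝔼} (hx : x ∉ frontier Q)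
    (g : 𝔼) :
    Tendsto (fun n => ∫ t, truncKernel (1 : ℝ) n t * ind Q (x - t • g)) atTop
      (𝓝 (dirHilbert (ind Q) x g)) := by
  obtain ⟨B, hB, hb⟩ := h.exists_bound hx
  have hm := measurable_ind h.measurable
  have e : dirHilbert (ind Q) x g = 1 / 2 * ∫ t : ℝ, 1 / Real.pi * (1 / t) *
      (ind Q (x - t • g) - ind Q (x + t • g)) := by
    simp only [mul_assoc]
    rw [integral_const_mul, dirHilbert]
    ring
  simp only [integral_truncKernel_real_mul hm (abs_ind_le Q)]
  rw [e]
  refine Tendsto.const_mul _ ?_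
  refine tendsto_integral_of_dominated_convergence
    (fun t => 1 / Real.pi * ‖1 / t * (ind Q (x - t • g) - ind Q (x + t • g))‖) ?_
    ((hb g).1.norm.const_mul _) ?_ ?_
  · intro n
    exact (integrable_truncKernel (1 : ℝ) n).1.mul (Measurable.aestronglyMeasurable (by fun_prop))
  · intro n
    refine Eventually.of_forall fun t => ?_
    rw [norm_mul, norm_mul, ← mul_assoc]
    gcongr
    exact abs_truncKernel_real_le n t
  · exact Eventually.of_forall fun t => (tendsto_truncKernel_real t).mul_const _

theorem IsBody.abs_trunc_dirHilbert_le {Q : Set 𝔼} (h : IsBody Q) {x : 𝔼} (hx : x ∉ frontier Q) :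
    ∃ B, 0 ≤ B ∧ ∀ n g, |∫ t, truncKernel (1 : ℝ) n t * ind Q (x - t • g)| ≤ B := by
  obtain ⟨B, hB, hb⟩ := h.exists_bound hx
  have hpi := Real.pi_pos
  refine ⟨1 / 2 * (1 / Real.pi * B), by positivity, fun n g => ?_⟩
  rw [integral_truncKernel_real_mul (measurable_ind h.measurable) (abs_ind_le Q), abs_mul,
    abs_of_pos (a := (1 : ℝ) / 2) (by norm_num)]
  gcongr
  calc _ ≤ ∫ t, 1 / Real.pi * ‖1 / t * (ind Q (x - t • g) - ind Q (x + t • g))‖ := by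
        rw [← Real.norm_eq_abs]
        refine norm_integral_le_of_norm_le ((hb g).1.norm.const_mul _) (Eventually.of_forall fun t => ?_)
        rw [norm_mul, norm_mul, ← mul_assoc]
        gcongr
        exact abs_truncKernel_real_le n t
    _ ≤ _ := by
        rw [integral_const_mul]
        gcongr
        exact (hb g).2

variable {γ : Measure (EuclideanSpace ℝ (Fin d))} [SFinite γ]

/-- The average of directional Hilbert transforms with weight `H` has the multiplier
`-i ∫ H(g) sgn⟨g, ξ⟩ dγ(g)`. -/
theorem IsBody.hasFT_average {Q : Set 𝔼} (h : IsBody Q) {H : 𝔼 → ℝ} (hH : Integrable H γ) :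
    HasFT (fun x => ((∫ g, H g * dirHilbert (ind Q) x g ∂γ : ℝ) : ℂ))
      (fun ξ => (-Complex.I * ((∫ g, H g * (inner ℝ g ξ / |inner ℝ g ξ|) ∂γ : ℝ) : ℂ)) *
        𝓕 (fun x => (ind Q x : ℂ)) ξ) := by
  have hm := measurable_ind h.measurable
  -- After truncation the average is a superposition of translates by t • g over pairs (g, t) with
  -- an integrable weight, so its multiplier is a Fourier integral.
  have hw : ∀ n : ℕ, Integrable (fun s : 𝔼 × ℝ => H s.1 * truncKernel (1 : ℝ) n s.2)
      (γ.prod volume) := fun n => hH.mul_prod (integrable_truncKernel (1 : ℝ) n)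
  have hτ : Measurable fun s : 𝔼 × ℝ => s.2 • s.1 := by fun_prop
  have hFTn := fun n => hasFT_superposition (hw n) hτ hm h.integrable_ind (abs_ind_le Q)
  have hmult : ∀ n (ξ : 𝔼), ∫ s : 𝔼 × ℝ, ((H s.1 * truncKernel (1 : ℝ) n s.2 : ℝ) : ℂ) *
      (Real.fourierChar (-inner ℝ (s.2 • s.1) ξ) : ℂ) ∂(γ.prod volume) =
      -Complex.I * ((∫ g, H g * (inner ℝ g ξ * truncProfile 0 n |inner ℝ g ξ|) ∂γ : ℝ) : ℂ) := by
    intro n ξ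
    rw [integral_prod]
    · rw [← integral_complex_ofReal, ← integral_const_mul]
      refine integral_congr_ae (Eventually.of_forall fun g => ?_)
      simp only
      have h1 := fourier_truncKernel (1 : ℝ) n (inner ℝ g ξ)
      rw [Real.fourier_eq] at h1
      have h2 : ∫ t : ℝ, ((H g * truncKernel (1 : ℝ) n t : ℝ) : ℂ) *
          (Real.fourierChar (-inner ℝ (t • g) ξ) : ℂ) = (H g : ℂ) *
          ∫ t : ℝ, Real.fourierChar (-inner ℝ t (inner ℝ g ξ)) • (truncKernel (1 : ℝ) n t : ℂ) := by
        rw [← integral_const_mul]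
        refine integral_congr_ae (Eventually.of_forall fun t => ?_)
        simp only [Circle.smul_def, smul_eq_mul, Complex.ofReal_mul]
        have : inner ℝ (t • g) ξ = inner ℝ t (inner ℝ g ξ) := by
          rw [real_inner_smul_left]; simp [mul_comm]
        rw [this]
        ring
      rw [h2, h1]
      simp only [Real.norm_eq_abs]
      push_cast
      simp
      ring
    · refine ((hw n).ofReal (𝕜 := ℂ)).mul_bdd (c := 1) ?_ (Eventually.of_forall fun p => (Circle.norm_coe _).le)
      have : Continuous fun s : 𝔼 × ℝ => (Real.fourierChar (-inner ℝ (s.2 • s.1) ξ) : ℂ) :=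
        continuous_subtype_val.comp (Real.continuous_fourierChar.comp (by fun_prop))
      exact this.aestronglyMeasurable
  have hsgn : ∀ n (η : ℝ), |η * truncProfile 0 n (|η|)| ≤ 1 := by
    intro n η
    rcases eq_or_ne η 0 with rfl | hη
    · simp
    · have h0 : 0 < |η| := abs_pos.2 hη
      have h1 := truncProfile_le 0 n h0
      rw [rieszKernelConst_zero, zero_add, pow_one] at h1
      rw [abs_mul, abs_of_nonneg (truncProfile_nonneg _ _ _)]
      calc _ ≤ |η| * (1 / |η|) := by gcongr
        _ = 1 := by field_simp
  have hsgnlim : ∀ η : ℝ, Tendsto (fun n => η * truncProfile 0 n (|η|)) atTop (𝓝 (η / |η|)) := by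
    intro η
    rcases eq_or_ne η 0 with rfl | hη
    · simp
    · have h0 : 0 < |η| := abs_pos.2 hη
      have h1 := (tendsto_truncProfile 0 h0).const_mul η
      rwa [rieszKernelConst_zero, zero_add, pow_one, mul_one_div] at h1
  have hmp : ∀ n, Measurable (truncProfile 0 n) := by
    intro n
    have : StronglyMeasurable (truncProfile 0 n) := by
      refine StronglyMeasurable.integral_prod_right' (f := fun p : ℝ × ℝ =>
        2 * p.2 ^ 0 * Real.exp (-(Real.pi * p.2 ^ 2 * p.1 ^ 2))) ?_
      exact Continuous.stronglyMeasurable (by fun_prop)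
    exact this.measurable
  obtain ⟨-, hu, -⟩ := h.hasFT_ind
  refine HasFT.of_tendsto (C := ∫ g, ‖H g‖ ∂γ) hFTn hu ?_ ?_ ?_ ?_
  · intro n
    simp only [hmult]
    have : StronglyMeasurable fun ξ : 𝔼 => ∫ s : 𝔼 × ℝ, ((H s.1 * truncKernel (1 : ℝ) n s.2 : ℝ) : ℂ) *
      (Real.fourierChar (-inner ℝ (s.2 • s.1) ξ) : ℂ) ∂(γ.prod volume) := by
      refine Continuous.stronglyMeasurable ?_
      refine continuous_of_dominated (bound := fun s => ‖H s.1 * truncKernel (1 : ℝ) n s.2‖) ?_ ?_ (hw n).norm ?_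
      · intro ξ
        refine ((hw n).ofReal (𝕜 := ℂ)).1.mul ?_
        have : Continuous fun s : 𝔼 × ℝ => (Real.fourierChar (-inner ℝ (s.2 • s.1) ξ) : ℂ) :=
          continuous_subtype_val.comp (Real.continuous_fourierChar.comp (by fun_prop))
        exact this.aestronglyMeasurable
      · intro ξ
        refine Eventually.of_forall fun s => ?_
        rw [norm_mul, Circle.norm_coe, mul_one, Complex.norm_real]
      · refine Eventually.of_forall fun s => ?_
        refine continuous_const.mul ?_
        exact continuous_subtype_val.comp (Real.continuous_fourierChar.comp (by fun_prop))
    simp only [hmult] at this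
    exact this.aestronglyMeasurable
  · intro n ξ
    rw [hmult, norm_mul, norm_neg, Complex.norm_I, one_mul, Complex.norm_real]
    refine norm_integral_le_of_norm_le hH.norm (Eventually.of_forall fun g => ?_)
    rw [norm_mul]
    exact mul_le_of_le_one_right (norm_nonneg _) (hsgn n _)
  · refine Eventually.of_forall fun ξ => ?_
    simp only [hmult]
    refine Tendsto.const_mul _ ((Complex.continuous_ofReal.tendsto _).comp ?_)
    refine tendsto_integral_of_dominated_convergence (fun g => ‖H g‖) ?_ hH.norm ?_ ?_
    · intro n
      refine hH.1.mul (Measurable.aestronglyMeasurable ?_)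
      have := hmp n
      fun_prop
    · intro n
      refine Eventually.of_forall fun g => ?_
      rw [norm_mul]
      exact mul_le_of_le_one_right (norm_nonneg _) (hsgn n _)
    · exact Eventually.of_forall fun g => (hsgnlim _).const_mul _
  · filter_upwards [h.ae_notMem_frontier] with x hx
    refine (Complex.continuous_ofReal.tendsto _).comp ?_
    obtain ⟨B, hB, hb⟩ := h.abs_trunc_dirHilbert_le hx
    have e : ∀ n, ∫ s : 𝔼 × ℝ, H s.1 * truncKernel (1 : ℝ) n s.2 * ind Q (x - s.2 • s.1) ∂(γ.prod volume) =
        ∫ g, H g * (∫ t, truncKernel (1 : ℝ) n t * ind Q (x - t • g)) ∂γ := by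
      intro n
      rw [integral_prod]
      · simp only [mul_assoc, integral_const_mul]
      · exact (hw n).mul_bdd (c := 1) (Measurable.aestronglyMeasurable (by fun_prop))
          (Eventually.of_forall fun s => abs_ind_le Q _)
    simp only [e]
    refine tendsto_integral_of_dominated_convergence (fun g => ‖H g‖ * B) ?_ (hH.norm.mul_const B) ?_ ?_
    · intro n
      refine hH.1.mul ?_
      have : StronglyMeasurable fun g : 𝔼 => ∫ t, truncKernel (1 : ℝ) n t * ind Q (x - t • g) := by
        refine StronglyMeasurable.integral_prod_right' (f := fun p : 𝔼 × ℝ =>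
          truncKernel (1 : ℝ) n p.2 * ind Q (x - p.2 • p.1)) ?_
        have hk : Measurable (truncKernel (1 : ℝ) n) := by
          have h1 : StronglyMeasurable (truncProfile 1 n) := by
            refine StronglyMeasurable.integral_prod_right' (f := fun p : ℝ × ℝ =>
              2 * p.2 ^ 1 * Real.exp (-(Real.pi * p.2 ^ 2 * p.1 ^ 2))) ?_
            exact Continuous.stronglyMeasurable (by fun_prop)
          have h2 := h1.measurable
          have h3 : truncKernel (1 : ℝ) n = fun t => t * truncProfile 1 n |t| :=
            funext (truncKernel_real n)
          rw [h3]
          fun_prop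
        exact Measurable.stronglyMeasurable (by fun_prop)
      exact this.aestronglyMeasurable
    · intro n
      refine Eventually.of_forall fun g => ?_
      rw [norm_mul]
      gcongr
      exact hb n g
    · exact Eventually.of_forall fun g => (h.tendsto_trunc_dirHilbert hx g).const_mul _

/-- An odd power of the Riesz transform is an average of directional Hilbert transforms as soon as
the multipliers agree. -/
theorem IsBody.rieszPow_ae_eq_average {Q : Set 𝔼} (h : IsBody Q) {H : 𝔼 → ℝ} (hH : Integrable H γ)
    (j : Fin d) (n : ℕ) (hmul : ∀ ξ : 𝔼, ξ ≠ 0 →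
      ∫ g, H g * (inner ℝ g ξ / |inner ℝ g ξ|) ∂γ = (-1) ^ n * (ξ j / ‖ξ‖) ^ (2 * n + 1)) :
    rieszPow j (2 * n + 1) (ind Q) =ᵐ[volume] fun x => ∫ g, H g * dirHilbert (ind Q) x g ∂γ := by
  have h1 := (h.hasFT_ind.rieszPow_real j (U := (frontier Q)ᶜ) h.ae_notMem_frontier
    (fun x hx => locHolder_ind hx) (2 * n + 1)).1
  have h2 := h.hasFT_average hH
  have := Fin.pos j
  have : Nonempty (Fin d) := ⟨j⟩
  have hne : ∀ᵐ ξ ∂(volume : Measure 𝔼), ξ ≠ 0 := Measure.ae_ne volume 0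
  -- Here (-i)^(2n+1) = (-1)^n (-i), which is why oddness of the power is needed and where the sign
  -- in the hypothesis comes from.
  have h3 := h2.congr (ae_of_all _ fun x => rfl) (u' := fun ξ =>
    (-Complex.I * ((ξ j / ‖ξ‖ : ℝ) : ℂ)) ^ (2 * n + 1) * 𝓕 (fun x => (ind Q x : ℂ)) ξ) (by
      filter_upwards [hne] with ξ hξ
      rw [hmul ξ hξ, mul_pow, pow_succ (-Complex.I), pow_mul, neg_sq, Complex.I_sq]
      push_cast
      ring)
  filter_upwards [h1.ae_eq h3] with x hx
  exact_mod_cast hx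

theorem IsBody.integrable_line {Q : Set 𝔼} (h : IsBody Q) (x : 𝔼) {g : 𝔼} (hg : g ≠ 0) :
    Integrable fun t : ℝ => ind Q (x - t • g) := by
  obtain ⟨R, hR⟩ := h.bounded.exists_norm_le
  have hg0 : 0 < ‖g‖ := norm_pos_iff.2 hg
  set A : ℝ := (R + ‖x‖) / ‖g‖ with hA
  have hm := measurable_ind h.measurable
  have hdomi : Integrable ((Set.Icc (-A) A).indicator (fun _ => (1 : ℝ))) :=
    (integrable_indicator_iff measurableSet_Icc).2 (integrableOn_const (by simp))
  refine hdomi.mono' (Measurable.aestronglyMeasurable (by fun_prop)) (Eventually.of_forall fun t => ?_)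
  by_cases ht : x - t • g ∈ Q
  · have h1 := hR _ ht
    have h2 := norm_sub_norm_le (t • g) x
    rw [norm_sub_rev, norm_smul, Real.norm_eq_abs] at h2
    have : |t| ≤ A := by rw [hA, le_div_iff₀ hg0]; linarith
    rw [Set.indicator_of_mem (Set.mem_Icc.2 (abs_le.1 this))]
    exact abs_ind_le _ _
  · rw [ind, Set.indicator_of_notMem ht, norm_zero]
    exact Set.indicator_nonneg (fun _ _ => zero_le_one) _

theorem IsBody.integrableOn_hilbert {Q : Set 𝔼} (h : IsBody Q) (x : 𝔼) {g : 𝔼} (hg : g ≠ 0)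
    {ε : ℝ} (hε : 0 < ε) :
    Integrable fun t : ℝ => {t : ℝ | ε < |t|}.indicator (fun t => 1 / t) t * ind Q (x - t • g) := by
  refine (h.integrable_line x hg).bdd_mul (c := 1 / ε) ?_ (Eventually.of_forall fun t => ?_)
  · refine (Measurable.indicator (by fun_prop) ?_).aestronglyMeasurable
    exact measurableSet_lt measurable_const (by fun_prop)
  · by_cases ht : t ∈ {t : ℝ | ε < |t|}
    · rw [Set.indicator_of_mem ht, norm_div, norm_one, Real.norm_eq_abs]
      have : ε < |t| := ht
      gcongr
    · rw [Set.indicator_of_notMem ht, norm_zero]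
      positivity

/-- Connects the symmetrized integral with the principal value on a line, again by oddness of 1/t
and dominated convergence. -/
theorem IsBody.tendsto_pv_line {Q : Set 𝔼} (h : IsBody Q) {x g : 𝔼} (hg : g ≠ 0)
    (hx : x ∉ frontier Q) :
    Tendsto (fun ε : ℝ => ∫ t, {t : ℝ | ε < |t|}.indicator (fun t => 1 / t) t * ind Q (x - t • g))
      (𝓝[>] 0) (𝓝 (Real.pi * dirHilbert (ind Q) x g)) := by
  obtain ⟨B, hB, hb⟩ := h.exists_bound hx
  have hpi := Real.pi_pos
  have hm := measurable_ind h.measurable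
  have hset : ∀ ε : ℝ, MeasurableSet {t : ℝ | ε < |t|} := fun ε =>
    measurableSet_lt measurable_const (by fun_prop)
  have e : Real.pi * dirHilbert (ind Q) x g =
      1 / 2 * ∫ t : ℝ, 1 / t * (ind Q (x - t • g) - ind Q (x + t • g)) := by
    rw [dirHilbert]; field_simp
  rw [e]
  have hlim : Tendsto (fun ε : ℝ => 1 / 2 * ∫ t, {t : ℝ | ε < |t|}.indicator (fun t => 1 / t) t *
      (ind Q (x - t • g) - ind Q (x + t • g))) (𝓝[>] 0)
      (𝓝 (1 / 2 * ∫ t : ℝ, 1 / t * (ind Q (x - t • g) - ind Q (x + t • g)))) := by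
    refine Tendsto.const_mul _ ?_
    refine tendsto_integral_filter_of_dominated_convergence
      (fun t => ‖1 / t * (ind Q (x - t • g) - ind Q (x + t • g))‖) ?_ ?_ (hb g).1.norm ?_
    · refine Eventually.of_forall fun ε => Measurable.aestronglyMeasurable ?_
      refine (Measurable.indicator (by fun_prop) (hset ε)).mul (by fun_prop)
    · refine Eventually.of_forall fun ε => Eventually.of_forall fun t => ?_
      rw [norm_mul, norm_mul]
      gcongr
      simp only [Set.indicator]
      split_ifs
      · exact le_rfl
      · simp
    · refine Eventually.of_forall fun t => Tendsto.mul_const _ ?_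
      rcases eq_or_ne t 0 with rfl | ht
      · simp [Set.indicator]
      · refine tendsto_const_nhds.congr' ?_
        filter_upwards [Ioo_mem_nhdsGT (abs_pos.2 ht)] with ε hε
        rw [Set.indicator_of_mem]
        exact hε.2
  refine hlim.congr' ?_
  filter_upwards [self_mem_nhdsWithin] with ε hε
  rw [integral_odd_mul _ (h.integrableOn_hilbert x hg hε)]
  · simp
  · intro t
    simp only [Set.indicator, Set.mem_ofPred_eq, abs_neg]
    split_ifs
    · rw [div_neg]
    · simp

/-- The Hilbert transform along a line of a vector-valued step function. -/
theorem hilbertR_line_eq {X : Type*} [NormedAddCommGroup X] [NormedSpace ℝ X] [CompleteSpace X]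
    {N : ℕ} {Q : Fin N → Set 𝔼} (hQ : ∀ i, IsBody (Q i)) (v : Fin N → X) {x' g : 𝔼} (hg : g ≠ 0) (t₀ : ℝ)
    (hx : ∀ i, x' + t₀ • g ∉ frontier (Q i)) :
    hilbertR (fun t => ∑ i, ind (Q i) (x' + t • g) • v i) t₀ =
      ∑ i, dirHilbert (ind (Q i)) (x' + t₀ • g) g • v i := by
  have hlim : Tendsto (fun ε : ℝ => ∫ s in {s : ℝ | ε < dist s t₀}, (1 / (t₀ - s)) •
      ∑ i, ind (Q i) (x' + s • g) • v i) (𝓝[>] 0)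
      (𝓝 (∑ i, (Real.pi * dirHilbert (ind (Q i)) (x' + t₀ • g) g) • v i)) := by
    have h1 := tendsto_finsetSum (s := Finset.univ) fun i (_ : i ∈ Finset.univ) =>
      ((hQ i).tendsto_pv_line hg (hx i)).smul_const (v i)
    refine h1.congr' ?_
    filter_upwards [self_mem_nhdsWithin] with ε hε
    have hset : MeasurableSet {s : ℝ | ε < dist s t₀} := measurableSet_lt measurable_const (by fun_prop)
    rw [← integral_indicator hset, ← integral_sub_left_eq_self _ volume t₀]
    have e : ∀ t, {s : ℝ | ε < dist s t₀}.indicator (fun s => (1 / (t₀ - s)) •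
        ∑ i, ind (Q i) (x' + s • g) • v i) (t₀ - t) =
        ∑ i, ({t : ℝ | ε < |t|}.indicator (fun t => 1 / t) t * ind (Q i) (x' + t₀ • g - t • g)) • v i := by
      intro t
      have hd : dist (t₀ - t) t₀ = |t| := by rw [Real.dist_eq]; simp
      simp only [Set.indicator, Set.mem_ofPred_eq, hd]
      split_ifs
      · rw [Finset.smul_sum]
        refine Finset.sum_congr rfl fun i _ => ?_
        rw [smul_smul, sub_sub_cancel, sub_smul, add_sub_assoc]
      · simp
    simp only [e]
    rw [integral_finsetSum]
    · simp only [integral_smul_const]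
    · intro i _
      exact ((hQ i).integrableOn_hilbert _ hg hε).smul_const _
  unfold hilbertR pvIntegral
  rw [hlim.limUnder_eq, Finset.smul_sum]
  refine Finset.sum_congr rfl fun i _ => ?_
  rw [smul_smul]
  congr 1
  have := Real.pi_ne_zero
  field_simp

end Directional

end RieszPowers

namespace RieszPowers

/-! ### One-dimensional Gaussian integrals of polynomials. -/

section Gaussian

open ProbabilityTheory Polynomial Set

local notation "γ₁" => gaussianReal 0 1

theorem integrable_pow_gaussian (k : ℕ) : Integrable (fun x : ℝ => x ^ k) γ₁ := by
  rcases Nat.eq_zero_or_pos k with rfl | hk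
  · simp
  · have h := (memLp_id_gaussianReal (μ := 0) (v := 1) (k : NNReal)).integrable_norm_pow
      (p := k) (by exact_mod_cast hk.ne')
    rw [← integrable_norm_iff (by fun_prop)]
    simpa [norm_pow] using h

theorem integrable_eval_gaussian (p : ℝ[X]) : Integrable (fun x : ℝ => p.eval x) γ₁ := by
  simp_rw [eval_eq_sum_range]
  exact integrable_finsetSum _ fun i _ => (integrable_pow_gaussian i).const_mul _

theorem integrable_of_eval (p : ℝ[X]) {f : ℝ → ℝ} (h : ∀ x, p.eval x = f x) :
    Integrable f γ₁ :=
  (integrable_eval_gaussian p).congr (Eventually.of_forall h)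

/-- The standard Gaussian density. -/
noncomputable def gaussDensity (x : ℝ) : ℝ := gaussianPDFReal 0 1 x

theorem gaussDensity_eq (x : ℝ) :
    gaussDensity x = (√(2 * Real.pi))⁻¹ * Real.exp (-x ^ 2 / 2) := by
  simp [gaussDensity, gaussianPDFReal]

theorem hasDerivAt_gaussDensity (x : ℝ) : HasDerivAt gaussDensity (-x * gaussDensity x) x := by
  have h : HasDerivAt (fun x : ℝ => -x ^ 2 / 2) (-x) x := by
    have := ((hasDerivAt_pow 2 x).neg).div_const 2
    refine this.congr_deriv ?_
    norm_num
    ring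
  have h2 := h.exp.const_mul (√(2 * Real.pi))⁻¹
  rw [show gaussDensity = fun x => (√(2 * Real.pi))⁻¹ * Real.exp (-x ^ 2 / 2) from
    funext gaussDensity_eq]
  refine h2.congr_deriv ?_
  ring

theorem integral_gaussian_eq (f : ℝ → ℝ) : ∫ x, f x ∂γ₁ = ∫ x, f x * gaussDensity x := by
  rw [integral_gaussianReal_eq_integral_smul one_ne_zero]
  simp [gaussDensity, mul_comm]

theorem integrable_gaussian_iff (f : ℝ → ℝ) :
    Integrable f γ₁ ↔ Integrable fun x => f x * gaussDensity x := by
  rw [gaussianReal_of_var_ne_zero _ one_ne_zero,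
    integrable_withDensity_iff_integrable_smul₀' (measurable_gaussianPDF 0 1).aemeasurable
      (Eventually.of_forall fun _ => gaussianPDF_lt_top)]
  simp [gaussDensity, toReal_gaussianPDF, mul_comm]

theorem integrable_eval_mul_gaussDensity (p : ℝ[X]) :
    Integrable fun x => p.eval x * gaussDensity x :=
  (integrable_gaussian_iff _).1 (integrable_eval_gaussian p)

theorem hasDerivAt_eval_mul_gaussDensity (p : ℝ[X]) (x : ℝ) :
    HasDerivAt (fun x => p.eval x * gaussDensity x)
      ((derivative p - X * p).eval x * gaussDensity x) x := by
  refine ((p.hasDerivAt x).mul (hasDerivAt_gaussDensity x)).congr_deriv ?_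
  simp
  ring

/-- Gaussian integration by parts. -/
theorem integral_X_mul_gaussian (p : ℝ[X]) :
    ∫ x, x * p.eval x ∂γ₁ = ∫ x, (derivative p).eval x ∂γ₁ := by
  have h := integral_eq_zero_of_hasDerivAt_of_integrable
    (hasDerivAt_eval_mul_gaussDensity p) (integrable_eval_mul_gaussDensity _)
    (integrable_eval_mul_gaussDensity p)
  rw [← integral_gaussian_eq] at h
  simp only [eval_sub, eval_mul, eval_X] at h
  rw [integral_sub (integrable_eval_gaussian _)
    (integrable_of_eval (X * p) fun x => by simp)] at h
  linarith

/-- The integrand is the derivative of -p times the density, so only the boundary value at 0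
remains. -/
theorem integral_Ioi_gaussDensity (p : ℝ[X]) :
    ∫ x in Ioi 0, (X * p - derivative p).eval x * gaussDensity x = p.eval 0 * gaussDensity 0 := by
  have hd := fun x (_ : x ∈ Ici (0:ℝ)) => hasDerivAt_eval_mul_gaussDensity p x
  have h := integral_Ioi_of_hasDerivAt_of_tendsto' hd
    (integrable_eval_mul_gaussDensity _).integrableOn
    (tendsto_zero_of_hasDerivAt_of_integrableOn_Ioi
      (fun x (_ : x ∈ Ioi (0:ℝ)) => hasDerivAt_eval_mul_gaussDensity p x)
      (integrable_eval_mul_gaussDensity _).integrableOn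
      (integrable_eval_mul_gaussDensity p).integrableOn)
  rw [zero_sub] at h
  rw [← neg_neg (p.eval 0 * gaussDensity 0), ← h, ← integral_neg]
  congr 1
  funext x
  simp only [eval_sub]
  ring

theorem gaussDensity_neg (x : ℝ) : gaussDensity (-x) = gaussDensity x := by
  simp [gaussDensity_eq]

theorem integral_Iic_gaussDensity (p : ℝ[X]) :
    ∫ x in Iic 0, (X * p - derivative p).eval x * gaussDensity x =
      -(p.eval 0 * gaussDensity 0) := by
  have h := integral_eq_zero_of_hasDerivAt_of_integrable
    (hasDerivAt_eval_mul_gaussDensity p) (integrable_eval_mul_gaussDensity _)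
    (integrable_eval_mul_gaussDensity p)
  have h2 : ∫ x, (X * p - derivative p).eval x * gaussDensity x = 0 := by
    rw [← neg_eq_zero, ← integral_neg, ← h]
    congr 1
    funext x
    simp only [eval_sub]
    ring
  have h3 := integral_add_compl (measurableSet_Ioi (a := (0:ℝ)))
    (integrable_eval_mul_gaussDensity (X * p - derivative p))
  rw [integral_Ioi_gaussDensity, compl_Ioi, h2] at h3
  linarith

theorem gaussDensity_zero : gaussDensity 0 = (√(2 * Real.pi))⁻¹ := by simp [gaussDensity_eq]

theorem gaussDensity_nonneg (x : ℝ) : 0 ≤ gaussDensity x := gaussianPDFReal_nonneg _ _ _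

/-- The boundary terms at 0 from the two half-lines have opposite signs, so against the sign
function they add up instead of cancelling. -/
theorem integral_sign_gaussian (p : ℝ[X]) :
    ∫ x, (X * p - derivative p).eval x * (x / |x|) ∂γ₁ = 2 * (p.eval 0 * gaussDensity 0) := by
  have hi : Integrable fun x => (X * p - derivative p).eval x * (x / |x|) * gaussDensity x := by
    have := (integrable_eval_mul_gaussDensity (X * p - derivative p)).bdd_mul
      (f := fun x => x / |x|) (c := 1) (measurable_id.div measurable_id.abs).aestronglyMeasurable
      (Eventually.of_forall fun x => by
        rw [norm_div, Real.norm_eq_abs, Real.norm_eq_abs, abs_abs]; exact div_self_le_one _)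
    refine this.congr (Eventually.of_forall fun x => ?_)
    simp only
    ring
  rw [integral_gaussian_eq, ← integral_add_compl (measurableSet_Ioi (a := (0:ℝ))) hi, compl_Ioi,
    integral_Iic_eq_integral_Iio]
  have h1 : ∫ x in Ioi 0, (X * p - derivative p).eval x * (x / |x|) * gaussDensity x =
      p.eval 0 * gaussDensity 0 := by
    rw [← integral_Ioi_gaussDensity]
    refine setIntegral_congr_fun measurableSet_Ioi fun x (hx : 0 < x) => ?_
    rw [abs_of_pos hx, div_self hx.ne', mul_one]
  have h2 : ∫ x in Iio 0, (X * p - derivative p).eval x * (x / |x|) * gaussDensity x =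
      p.eval 0 * gaussDensity 0 := by
    rw [← neg_eq_iff_eq_neg.2 (integral_Iic_gaussDensity p), integral_Iic_eq_integral_Iio,
      ← integral_neg]
    refine setIntegral_congr_fun measurableSet_Iio fun x (hx : x < 0) => ?_
    rw [abs_of_neg hx, div_neg, div_self hx.ne]
    ring
  rw [h1, h2]
  ring

/-! ### Hermite polynomials and Mehler's formula. -/

/-- The probabilists' Hermite polynomial with real coefficients. -/
noncomputable def realHermite (n : ℕ) : ℝ[X] := (hermite n).map (Int.castRingHom ℝ)

theorem realHermite_zero : realHermite 0 = 1 := by simp [realHermite]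

theorem realHermite_succ (n : ℕ) :
    realHermite (n + 1) = X * realHermite n - derivative (realHermite n) := by
  simp [realHermite, hermite_succ, derivative_map]

theorem derivative_realHermite_succ (n : ℕ) :
    derivative (realHermite (n + 1)) = C ((n : ℝ) + 1) * realHermite n := by
  induction n with
  | zero => simp [realHermite_succ 0, realHermite_zero]
  | succ n ih =>
    rw [realHermite_succ (n + 1), derivative_sub, derivative_mul, ih, derivative_X,
      derivative_mul, derivative_C]
    conv_rhs => rw [realHermite_succ n]
    rw [realHermite_succ n]
    simp only [map_add, map_one, map_natCast, Nat.cast_add, Nat.cast_one]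
    ring

theorem realHermite_add_two (n : ℕ) :
    realHermite (n + 2) = X * realHermite (n + 1) - C ((n : ℝ) + 1) * realHermite n := by
  rw [realHermite_succ (n + 1), derivative_realHermite_succ]

/-- Gaussian integration by parts makes p ↦ Xp - p' the adjoint of differentiation; iterating it
gives the norm n!. -/
theorem integral_realHermite_succ_mul (n : ℕ) (p : ℝ[X]) :
    ∫ x, (realHermite (n + 1)).eval x * p.eval x ∂γ₁ =
      ∫ x, (realHermite n).eval x * (derivative p).eval x ∂γ₁ := by
  have h := integral_X_mul_gaussian (realHermite n * p)
  have i1 : Integrable (fun x => x * (realHermite n * p).eval x) γ₁ := 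
    integrable_of_eval (X * (realHermite n * p)) fun x => by simp
  have i2 := integrable_eval_gaussian (derivative (realHermite n) * p)
  have i3 := integrable_eval_gaussian (realHermite n * derivative p)
  rw [derivative_mul] at h
  simp only [eval_add] at h
  rw [integral_add i2 i3] at h
  have e : ∀ x, (realHermite (n + 1)).eval x * p.eval x =
      x * (realHermite n * p).eval x - (derivative (realHermite n) * p).eval x := by
    intro x
    rw [realHermite_succ]
    simp
    ring
  simp_rw [e]
  rw [integral_sub i1 i2, h]
  simp

theorem integral_realHermite_sq (n : ℕ) :
    ∫ x, (realHermite n).eval x * (realHermite n).eval x ∂γ₁ = n.factorial := by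
  induction n with
  | zero => simp [realHermite_zero]
  | succ n ih =>
    rw [integral_realHermite_succ_mul, derivative_realHermite_succ, Nat.factorial_succ]
    push_cast
    rw [← ih, ← integral_const_mul]
    congr 1
    funext x
    simp
    ring

/-- Averaging a Hermite polynomial over an independent Gaussian variable. -/
theorem integral_realHermite_add {t s : ℝ} (hts : t ^ 2 + s ^ 2 = 1) (n : ℕ) (z : ℝ) :
    ∫ x, (realHermite n).eval (t * z + s * x) ∂γ₁ = t ^ n * (realHermite n).eval z := by
  have hint : ∀ p : ℝ[X], Integrable (fun x => p.eval (t * z + s * x)) γ₁ := fun p => integrable_of_eval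
    (p.comp (C (t * z) + C s * X)) fun x => by simp
  have stein : ∀ p : ℝ[X], ∫ x, x * p.eval (t * z + s * x) ∂γ₁ =
      s * ∫ x, (derivative p).eval (t * z + s * x) ∂γ₁ := fun p => by
    have h := integral_X_mul_gaussian (p.comp (C (t * z) + C s * X))
    rw [derivative_comp] at h
    simp only [eval_comp, eval_mul, eval_add, eval_C, eval_X, derivative_add, derivative_C,
      derivative_mul, derivative_X, zero_mul, zero_add, mul_one] at h
    rw [h, integral_const_mul]
  -- Two consecutive degrees are carried for the three-term recursion. Integration by parts turns
  -- the term s·x into s²(n+1) times the lower integral, and s² - 1 = -t² supplies the two missing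
  -- powers of t.
  have key : ∀ n, (∫ x, (realHermite n).eval (t * z + s * x) ∂γ₁ =
      t ^ n * (realHermite n).eval z) ∧ (∫ x, (realHermite (n + 1)).eval (t * z + s * x) ∂γ₁ =
      t ^ (n + 1) * (realHermite (n + 1)).eval z) := by
    intro n
    induction n with
    | zero =>
      refine ⟨by simp [realHermite_zero], ?_⟩
      have h1 := stein 1
      simp only [eval_one, mul_one, derivative_one, eval_zero, integral_zero, mul_zero] at h1
      have i1 : Integrable (fun x : ℝ => x) γ₁ := by
        simpa only [eval_X] using integrable_eval_gaussian X
      simp only [realHermite_succ 0, realHermite_zero, mul_one, derivative_one, sub_zero, eval_X,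
        zero_add, pow_one]
      rw [integral_add (integrable_const _) (i1.const_mul s), integral_const_mul s, h1]
      simp
    | succ n ih =>
      refine ⟨ih.2, ?_⟩
      have h1 := stein (realHermite (n + 1))
      rw [derivative_realHermite_succ] at h1
      simp only [eval_mul, eval_C] at h1
      rw [integral_const_mul, ih.1] at h1
      have i1 : Integrable (fun x => x * (realHermite (n + 1)).eval (t * z + s * x)) γ₁ := by
        exact integrable_of_eval
          (X * (realHermite (n + 1)).comp (C (t * z) + C s * X)) fun x => by simp
      have e : ∀ x, (realHermite (n + 2)).eval (t * z + s * x) =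
          t * z * (realHermite (n + 1)).eval (t * z + s * x) +
          s * (x * (realHermite (n + 1)).eval (t * z + s * x)) -
          (n + 1) * (realHermite n).eval (t * z + s * x) := by
        intro x
        rw [realHermite_add_two]
        simp
        ring
      simp_rw [e]
      rw [integral_sub (by exact ((hint _).const_mul _).add (i1.const_mul s))
        ((hint _).const_mul _), integral_add ((hint _).const_mul _) (i1.const_mul s), integral_const_mul,
        integral_const_mul, integral_const_mul, h1, ih.1, ih.2, realHermite_add_two]
      simp only [eval_sub, eval_mul, eval_X, eval_C]
      have : s ^ 2 = 1 - t ^ 2 := by linarith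
      linear_combination (t ^ n * (n + 1) * (realHermite n).eval z) * this
  exact (key n).1

/-- The product of the first `n` odd numbers. -/
noncomputable def oddFactorial (n : ℕ) : ℝ := ∏ i ∈ Finset.range n, (2 * (i : ℝ) + 1)

theorem oddFactorial_pos (n : ℕ) : 0 < oddFactorial n :=
  Finset.prod_pos fun i _ => by positivity

theorem oddFactorial_succ (n : ℕ) : oddFactorial (n + 1) = oddFactorial n * (2 * n + 1) := by
  simp [oddFactorial, Finset.prod_range_succ]

theorem realHermite_eval_zero (n : ℕ) :
    (realHermite (2 * n)).eval 0 = (-1) ^ n * oddFactorial n := by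
  induction n with
  | zero => simp [realHermite_zero, oddFactorial]
  | succ n ih =>
    rw [show 2 * (n + 1) = 2 * n + 2 by ring, realHermite_add_two, oddFactorial_succ]
    simp only [eval_sub, eval_mul, eval_X, zero_mul, eval_C, ih]
    push_cast
    ring

/-! ### The normalized Hermite weight and its mass. -/

/-- The density on the line whose Gaussian average against the sign function is `(-1)ⁿ`. -/
noncomputable def hermiteWeight (n : ℕ) (x : ℝ) : ℝ :=
  √(Real.pi / 2) / oddFactorial n * (realHermite (2 * n + 1)).eval x

theorem sqrt_mul_gaussDensity_zero : √(Real.pi / 2) * (2 * gaussDensity 0) = 1 := by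
  rw [gaussDensity_zero, show 2 * Real.pi = 2 ^ 2 * (Real.pi / 2) by ring,
    Real.sqrt_mul (by positivity), Real.sqrt_sq (by norm_num)]
  have : √(Real.pi / 2) ≠ 0 := (Real.sqrt_pos.2 (by positivity)).ne'
  field_simp

/-- Since He_{2n+1} = X He_{2n} - He_{2n}', the sign average of He_{2n+1} is twice He_{2n}(0) times
the density at 0; the factor in the weight cancels all but (-1)^n. -/
theorem integral_hermiteWeight_sign (n : ℕ) :
    ∫ x, hermiteWeight n x * (x / |x|) ∂γ₁ = (-1) ^ n := by
  simp_rw [hermiteWeight, mul_assoc]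
  rw [integral_const_mul, realHermite_succ, integral_sign_gaussian, realHermite_eval_zero]
  have h := sqrt_mul_gaussDensity_zero
  have h0 := (oddFactorial_pos n).ne'
  field_simp
  linear_combination h

theorem integral_hermiteWeight_add {t s : ℝ} (hts : t ^ 2 + s ^ 2 = 1) (n : ℕ) (z : ℝ) :
    ∫ x, hermiteWeight n (t * z + s * x) ∂γ₁ = t ^ (2 * n + 1) * hermiteWeight n z := by
  simp_rw [hermiteWeight]
  rw [integral_const_mul, integral_realHermite_add hts]
  ring

theorem integrable_hermiteWeight (n : ℕ) : Integrable (hermiteWeight n) γ₁ :=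
  (integrable_eval_gaussian _).const_mul _

theorem continuous_hermiteWeight (n : ℕ) : Continuous (hermiteWeight n) := by
  unfold hermiteWeight
  fun_prop

theorem hermiteWeight_neg (n : ℕ) (x : ℝ) : |hermiteWeight n (-x)| = |hermiteWeight n x| := by
  have key : ∀ n : ℕ, (realHermite n).eval (-x) = (-1) ^ n * (realHermite n).eval x ∧
      (realHermite (n + 1)).eval (-x) = (-1) ^ (n + 1) * (realHermite (n + 1)).eval x := by
    intro n
    induction n with
    | zero => simp [realHermite_succ 0, realHermite_zero]
    | succ n ih =>
      refine ⟨ih.2, ?_⟩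
      rw [realHermite_add_two]
      simp only [eval_sub, eval_mul, eval_X, eval_C, ih.1, ih.2]
      ring
  rw [hermiteWeight, (key _).1, hermiteWeight, abs_mul, abs_mul, abs_mul]
  simp

theorem integral_abs_hermiteWeight_eq (n : ℕ) : ∫ x, |hermiteWeight n x| ∂γ₁ =
    2 * ∫ x in Ioi 0, |hermiteWeight n x| * gaussDensity x := by
  have h : ∀ x, |hermiteWeight n x| * gaussDensity x =
      |hermiteWeight n (abs x)| * gaussDensity (abs x) := by
    intro x
    rcases abs_choice x with h | h <;> rw [h]
    rw [hermiteWeight_neg, gaussDensity_neg]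
  rw [integral_gaussian_eq]
  rw [integral_congr_ae (Eventually.of_forall h), integral_comp_abs (f := fun x => |hermiteWeight n x| * gaussDensity x)]

theorem integral_abs_hermiteWeight_zero : ∫ x, |hermiteWeight 0 x| ∂γ₁ = 1 := by
  rw [integral_abs_hermiteWeight_eq]
  have h := integral_Ioi_gaussDensity 1
  have e : ∫ x in Ioi 0, |hermiteWeight 0 x| * gaussDensity x =
      √(Real.pi / 2) * ∫ x in Ioi 0, (X * 1 - derivative (1 : ℝ[X])).eval x * gaussDensity x := by
    rw [← integral_const_mul]
    refine setIntegral_congr_fun measurableSet_Ioi fun x (hx : 0 < x) => ?_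
    simp only [hermiteWeight, oddFactorial, realHermite_succ 0, realHermite_zero, mul_zero,
      zero_add, Finset.range_zero, Finset.prod_empty, div_one]
    rw [abs_mul, abs_of_nonneg (Real.sqrt_nonneg _)]
    simp [abs_of_pos hx, mul_assoc]
  rw [e, h, ← sqrt_mul_gaussDensity_zero]
  simp
  ring

/-- Cauchy–Schwarz only yields √(3π) > 3 here, so |x² - 3| ≤ (x² - 3)²/4 + 1 is integrated over the
half-line instead. -/
theorem integral_abs_hermiteWeight_one_le : ∫ x, |hermiteWeight 1 x| ∂γ₁ ≤ 3 := by
  rw [integral_abs_hermiteWeight_eq]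
  -- This p solves Xp - p' = X((X² - 3)²/4 + 1). Its value at 0 is 9/4, which bounds the mass by
  -- 9/4.
  have h := integral_Ioi_gaussDensity (C (1 / 4) * (X ^ 4 - C 2 * X ^ 2 + C 5) + 1)
  have e : ∫ x in Ioi 0, |hermiteWeight 1 x| * gaussDensity x ≤
      ∫ x in Ioi 0, √(Real.pi / 2) *
        ((X * (C (1 / 4) * (X ^ 4 - C 2 * X ^ 2 + C 5) + 1) -
          derivative (C (1 / 4) * (X ^ 4 - C 2 * X ^ 2 + C 5) + 1 : ℝ[X])).eval x *
          gaussDensity x) := by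
    refine setIntegral_mono_on ?_ ((integrable_eval_mul_gaussDensity _).const_mul _).integrableOn
      measurableSet_Ioi fun x (hx : 0 < x) => ?_
    · exact ((integrable_gaussian_iff _).1 (integrable_hermiteWeight 1).abs).integrableOn
    have e1 : hermiteWeight 1 x = √(Real.pi / 2) * (x * (x ^ 2 - 3)) := by
      have e2 : (realHermite (2 * 1 + 1)).eval x = x * (x ^ 2 - 3) := by
        rw [show 2 * 1 + 1 = 1 + 2 by rfl, realHermite_add_two 1, realHermite_succ 1,
          realHermite_succ 0, realHermite_zero]
        simp
        ring
      rw [hermiteWeight, e2]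
      simp [oddFactorial]
    rw [e1, abs_mul, abs_mul, abs_of_pos hx, abs_of_nonneg (Real.sqrt_nonneg _), mul_assoc]
    refine mul_le_mul_of_nonneg_left ?_ (Real.sqrt_nonneg _)
    refine mul_le_mul_of_nonneg_right ?_ (gaussDensity_nonneg x)
    simp only [eval_sub, eval_mul, eval_add, eval_X, eval_C, eval_pow, eval_one, derivative_add,
      derivative_mul, derivative_C, derivative_sub, derivative_X_pow, derivative_one]
    norm_num
    have h2 : |x ^ 2 - 3| ≤ (x ^ 2 - 3) ^ 2 / 4 + 1 := by
      nlinarith [sq_abs (x ^ 2 - 3), sq_nonneg (|x ^ 2 - 3| - 2)]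
    nlinarith [mul_le_mul_of_nonneg_left h2 hx.le]
  rw [integral_const_mul, h] at e
  have := sqrt_mul_gaussDensity_zero
  simp only [eval_sub, eval_mul, eval_add, eval_X, eval_C, eval_pow, eval_one] at e
  norm_num at e this
  linarith

/-- Equivalent to the second moment of the weight being at most (2n+1)². It fails for n = 0 and n =
1; from 2 on, the inductive step is (2n+3)(2n+2) ≤ (2n+3)². -/
theorem pi_mul_factorial_le {n : ℕ} (hn : 2 ≤ n) :
    Real.pi / 2 * (2 * n + 1).factorial ≤ (oddFactorial n * (2 * n + 1)) ^ 2 := by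
  induction n, hn using Nat.le_induction with
  | base =>
    have : oddFactorial 2 = 3 := by norm_num [oddFactorial, Finset.prod_range_succ]
    rw [this]
    norm_num [Nat.factorial]
    linarith [Real.pi_lt_d2]
  | succ n hn ih =>
    rw [oddFactorial_succ, show 2 * (n + 1) + 1 = 2 * n + 1 + 1 + 1 by ring, Nat.factorial_succ,
      Nat.factorial_succ]
    push_cast at ih ⊢
    have h0 : 0 ≤ (2 * (n : ℝ) + 1 + 1 + 1) * (2 * n + 1 + 1) := by positivity
    have h1 := mul_le_mul_of_nonneg_left ih h0
    calc _ = (2 * (n : ℝ) + 1 + 1 + 1) * (2 * n + 1 + 1) *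
          (Real.pi / 2 * ((2 * n + 1).factorial : ℝ)) := by ring
      _ ≤ _ := h1
      _ ≤ _ := by
        have : 0 ≤ (oddFactorial n * (2 * n + 1)) ^ 2 := sq_nonneg _
        have h3 : (2 * (n : ℝ) + 1 + 1 + 1) * (2 * n + 1 + 1) ≤ (2 * (n + 1) + 1) ^ 2 := by
          nlinarith [(n.cast_nonneg : (0:ℝ) ≤ n)]
        calc _ ≤ (2 * ((n : ℝ) + 1) + 1) ^ 2 * (oddFactorial n * (2 * n + 1)) ^ 2 :=
              mul_le_mul_of_nonneg_right h3 this
          _ = _ := by ring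

theorem integral_abs_hermiteWeight_le (n : ℕ) :
    ∫ x, |hermiteWeight n x| ∂γ₁ ≤ 2 * n + 1 := by
  rcases Nat.lt_or_ge n 2 with hn | hn
  · interval_cases n
    · simpa using integral_abs_hermiteWeight_zero.le
    · refine integral_abs_hermiteWeight_one_le.trans (by norm_num)
  have hm : (0 : ℝ) < 2 * n + 1 := by positivity
  have h0 := oddFactorial_pos n
  have hsq : ∫ x, hermiteWeight n x ^ 2 ∂γ₁ ≤ (2 * n + 1) ^ 2 := by
    have e : ∀ x, hermiteWeight n x ^ 2 = Real.pi / 2 / oddFactorial n ^ 2 *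
        ((realHermite (2 * n + 1)).eval x * (realHermite (2 * n + 1)).eval x) := by
      intro x
      rw [hermiteWeight, mul_pow, div_pow, Real.sq_sqrt (by positivity)]
      ring
    simp_rw [e]
    rw [integral_const_mul, integral_realHermite_sq, div_mul_eq_mul_div, div_le_iff₀ (by positivity)]
    exact (pi_mul_factorial_le hn).trans (le_of_eq (by ring))
  have hint : Integrable (fun x => hermiteWeight n x ^ 2) γ₁ := by
    have := (integrable_eval_gaussian (realHermite (2 * n + 1) ^ 2)).const_mul
      ((√(Real.pi / 2) / oddFactorial n) ^ 2)
    refine this.congr (Eventually.of_forall fun x => ?_)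
    simp [hermiteWeight, mul_pow]
  -- Cauchy–Schwarz in the form |h| ≤ M/2 + h²/(2M) with M = 2n + 1.
  calc ∫ x, |hermiteWeight n x| ∂γ₁
      ≤ ∫ x, ((2 * n + 1) / 2 + 1 / (2 * (2 * n + 1)) * hermiteWeight n x ^ 2) ∂γ₁ := by
        refine integral_mono (integrable_hermiteWeight n).abs
          ((integrable_const _).add (hint.const_mul _)) fun x => ?_
        simp only
        rw [← sq_abs (hermiteWeight n x), ← sub_nonneg]
        have : (2 * (n : ℝ) + 1) / 2 + 1 / (2 * (2 * n + 1)) * |hermiteWeight n x| ^ 2 -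
            |hermiteWeight n x| = (|hermiteWeight n x| - (2 * n + 1)) ^ 2 / (2 * (2 * n + 1)) := by
          field_simp
          ring
        rw [this]
        positivity
    _ = (2 * n + 1) / 2 + 1 / (2 * (2 * n + 1)) * ∫ x, hermiteWeight n x ^ 2 ∂γ₁ := by
        rw [integral_add (integrable_const _) (hint.const_mul _), integral_const_mul]
        simp
    _ ≤ (2 * n + 1) / 2 + 1 / (2 * (2 * n + 1)) * (2 * n + 1) ^ 2 := by gcongr
    _ = 2 * n + 1 := by field_simp; ring

end Gaussian

end RieszPowers

namespace RieszPowers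

/-! ### The weight on ℝᵈ whose averaged sign is the Riesz multiplier. -/

section GaussianMultiplier

open ProbabilityTheory

variable {d : ℕ}

local notation "𝔼" => EuclideanSpace ℝ (Fin d)

/-- The joint law of two unit directions under the standard Gaussian measure. -/
theorem map_stdGaussian_prod {e f : EuclideanSpace ℝ (Fin d)} {t s : ℝ} (he : ‖e‖ = 1)
    (hf : ‖f‖ = 1) (ht : inner ℝ e f = t) (hts : t ^ 2 + s ^ 2 = 1) :
    (stdGaussian 𝔼).map (fun g => (inner ℝ e g, inner ℝ f g)) =
      ((gaussianReal 0 1).prod (gaussianReal 0 1)).map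
        (fun p : ℝ × ℝ => (p.1, t * p.1 + s * p.2)) := by
  let A : 𝔼 →L[ℝ] ℝ × ℝ := (innerSL ℝ e).prod (innerSL ℝ f)
  let B : ℝ × ℝ →L[ℝ] ℝ × ℝ := (ContinuousLinearMap.fst ℝ ℝ ℝ).prod
    (t • ContinuousLinearMap.fst ℝ ℝ ℝ + s • ContinuousLinearMap.snd ℝ ℝ ℝ)
  change (stdGaussian 𝔼).map A = ((gaussianReal 0 1).prod (gaussianReal 0 1)).map B
  -- Both laws are centred Gaussian, so comparing characteristic functions amounts to comparing
  -- variances of L; they agree because t² + s² = 1.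
  apply Measure.ext_of_charFunDual
  ext L
  rw [charFunDual_map, charFunDual_map, charFunDual_stdGaussian, charFunDual_prod]
  set a := L (1, 0) with ha
  set b := L (0, 1) with hb
  have hL : ∀ x y : ℝ, L (x, y) = a * x + b * y := by
    intro x y
    have : ((x, y) : ℝ × ℝ) = x • (1, 0) + y • (0, 1) := by simp
    rw [this, map_add, map_smul, map_smul, smul_eq_mul, smul_eq_mul]
    ring
  have h1 : L.comp A = innerSL ℝ (a • e + b • f) := by
    ext g
    simp [A, hL]
  have hn : ‖L.comp A‖ ^ 2 = (a + b * t) ^ 2 + (b * s) ^ 2 := by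
    rw [h1, innerSL_apply_norm, norm_add_sq_real, norm_smul, norm_smul, he, hf, inner_smul_left,
      inner_smul_right, ht]
    simp
    linear_combination (-b ^ 2) * hts
  have hc : ∀ (M : StrongDual ℝ ℝ), charFunDual (gaussianReal 0 1) M =
      Complex.exp (-((M 1 ^ 2 : ℝ) : ℂ) / 2) := by
    intro M
    have hM : M = M 1 • ContinuousLinearMap.id ℝ ℝ := by
      ext
      simp
    conv_lhs => rw [hM, ← charFun_map_eq_charFunDual_smul, ContinuousLinearMap.coe_id',
      Measure.map_id, charFun_gaussianReal]
    simp [neg_div]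
  rw [hc, hc, ← Complex.exp_add]
  congr 1
  have e1 : ((L.comp B).comp (ContinuousLinearMap.inl ℝ ℝ ℝ)) 1 = a + b * t := by
    simp [B, hL]
  have e2 : ((L.comp B).comp (ContinuousLinearMap.inr ℝ ℝ ℝ)) 1 = b * s := by
    simp [B, hL]
  rw [e1, e2, ← Complex.ofReal_pow, hn]
  push_cast
  ring

theorem map_inner_stdGaussian {e : EuclideanSpace ℝ (Fin d)} (he : ‖e‖ = 1) :
    (stdGaussian 𝔼).map (fun g => inner ℝ e g) = gaussianReal 0 1 := by
  have h := IsGaussian.map_eq_gaussianReal (μ := stdGaussian 𝔼) (innerSL ℝ e)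
  rw [integral_strongDual_stdGaussian, variance_dual_stdGaussian, innerSL_apply_norm, he] at h
  simpa using h

/-- The zero vector defines no line and must be negligible among the directions. -/
theorem stdGaussian_singleton_zero (hd : 1 ≤ d) : stdGaussian 𝔼 {0} = 0 := by
  have := map_inner_stdGaussian (d := d) (e := EuclideanSpace.single ⟨0, hd⟩ 1) (by simp)
  have h := nullSingletonClass_gaussianReal (μ := 0) (v := 1) one_ne_zero
  have h2 := h.measure_singleton 0
  rw [← this, Measure.map_apply (by fun_prop) (measurableSet_singleton _)] at h2
  exact measure_mono_null (by rintro x rfl; simp) h2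

/-- The weight depends on g only through g_j, so its mass is one-dimensional and independent of d.
Conditioning on ⟨ξ/|ξ|, g⟩ multiplies it by t^(2n+1), by Mehler's formula, and leaves the sign
average on the line. -/
theorem exists_gaussian_multiplier (j : Fin d) (n : ℕ) :
    ∃ H : EuclideanSpace ℝ (Fin d) → ℝ, Integrable H (stdGaussian 𝔼) ∧
      ∫ g, |H g| ∂stdGaussian 𝔼 ≤ 2 * n + 1 ∧
      (n = 0 → ∫ g, |H g| ∂stdGaussian 𝔼 ≤ 1) ∧
      ∀ ξ ≠ 0, ∫ g, H g * (inner ℝ g ξ / |inner ℝ g ξ|) ∂stdGaussian 𝔼 =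
        (-1) ^ n * (ξ j / ‖ξ‖) ^ (2 * n + 1) := by
  set f : 𝔼 := EuclideanSpace.single j 1 with hf
  have hf1 : ‖f‖ = 1 := by simp [hf]
  have hlaw := map_inner_stdGaussian hf1
  have hmeas : Measurable fun g : 𝔼 => (inner ℝ f g : ℝ) := by fun_prop
  have habs : ∫ g, |hermiteWeight n (inner ℝ f g)| ∂stdGaussian 𝔼 =
      ∫ x, |hermiteWeight n x| ∂gaussianReal 0 1 := by
    rw [← hlaw, integral_map hmeas.aemeasurable
      (continuous_hermiteWeight n).abs.aestronglyMeasurable]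
  refine ⟨fun g => hermiteWeight n (inner ℝ f g), ?_, ?_, ?_, ?_⟩
  · have := integrable_hermiteWeight n
    rw [← hlaw] at this
    exact this.comp_measurable hmeas
  · exact habs.trans_le (integral_abs_hermiteWeight_le n)
  · rintro rfl
    exact habs.trans_le integral_abs_hermiteWeight_zero.le
  intro ξ hξ
  have hξ0 : 0 < ‖ξ‖ := norm_pos_iff.2 hξ
  set e : 𝔼 := ‖ξ‖⁻¹ • ξ with he
  have he1 : ‖e‖ = 1 := norm_smul_inv_norm hξ
  have hsgn : ∀ g : 𝔼, inner ℝ g ξ / |inner ℝ g ξ| = inner ℝ e g / |inner ℝ e g| := by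
    intro g
    rw [he, inner_smul_left, real_inner_comm, abs_mul]
    simp only [conj_trivial, abs_inv, abs_norm]
    rw [mul_div_mul_left _ _ (inv_ne_zero hξ0.ne')]
  simp_rw [hsgn]
  have hte : inner ℝ e f = ξ j / ‖ξ‖ := by
    simp [he, hf, inner_smul_left, EuclideanSpace.inner_single_right]
    ring
  set t := ξ j / ‖ξ‖ with ht
  have ht1 : t ^ 2 ≤ 1 := by
    have := abs_real_inner_le_norm e f
    rw [hte, he1, hf1, one_mul] at this
    rw [← sq_abs]
    exact pow_le_one₀ (abs_nonneg _) this
  have hts : t ^ 2 + √(1 - t ^ 2) ^ 2 = 1 := by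
    rw [Real.sq_sqrt (by linarith)]
    ring
  set s := √(1 - t ^ 2)
  have hjoint := map_stdGaussian_prod he1 hf1 hte hts
  have hm2 : Measurable fun p : ℝ × ℝ => hermiteWeight n p.2 * (p.1 / |p.1|) :=
    ((continuous_hermiteWeight n).measurable.comp measurable_snd).mul
      (measurable_fst.div measurable_fst.abs)
  have hm3 : Measurable fun p : ℝ × ℝ => (p.1, t * p.1 + s * p.2) := by fun_prop
  have hi : Integrable (fun p : ℝ × ℝ => hermiteWeight n p.2 * (p.1 / |p.1|))
      ((stdGaussian 𝔼).map (fun g => (inner ℝ e g, inner ℝ f g))) := by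
    rw [integrable_map_measure hm2.aestronglyMeasurable (by fun_prop)]
    have h1 := integrable_hermiteWeight n
    rw [← hlaw] at h1
    refine (h1.comp_measurable hmeas).mul_bdd (c := 1) ?_ (Eventually.of_forall fun g => ?_)
    · exact ((measurable_id.div measurable_id.abs).comp
        (by fun_prop : Measurable fun g : 𝔼 => (inner ℝ e g : ℝ))).aestronglyMeasurable
    · rw [Real.norm_eq_abs, abs_div, abs_abs]
      exact div_self_le_one _
  have hi2 := hi
  rw [hjoint, integrable_map_measure hm2.aestronglyMeasurable hm3.aemeasurable] at hi2
  calc ∫ g, hermiteWeight n (inner ℝ f g) * (inner ℝ e g / |inner ℝ e g|) ∂stdGaussian 𝔼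
      = ∫ p, hermiteWeight n p.2 * (p.1 / |p.1|)
          ∂((stdGaussian 𝔼).map (fun g => (inner ℝ e g, inner ℝ f g))) := by
        rw [integral_map (by fun_prop) hm2.aestronglyMeasurable]
    -- x stands for the coordinate along ξ, and g_j is realized as t x + s y with y independent of
    -- x.
    _ = ∫ x, ∫ y, hermiteWeight n (t * x + s * y) * (x / |x|)
          ∂gaussianReal 0 1 ∂gaussianReal 0 1 := by
        rw [hjoint, integral_map hm3.aemeasurable hm2.aestronglyMeasurable]
        exact integral_prod _ hi2
    _ = ∫ x, t ^ (2 * n + 1) * (hermiteWeight n x * (x / |x|)) ∂gaussianReal 0 1 := by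
        congr 1
        funext x
        rw [integral_mul_const, integral_hermiteWeight_add hts]
        ring
    _ = (-1) ^ n * t ^ (2 * n + 1) := by
        rw [integral_const_mul, integral_hermiteWeight_sign]
        ring

/-- On the line ξ_j/|ξ| = ±1, so every odd power has the multiplier of the first up to the sign
(-1)^n. The general bound 2n + 1 would be too large here, since c_{m,1} only grows like √m. -/
theorem exists_gaussian_multiplier_line (j : Fin 1) (n : ℕ) :
    ∃ H : EuclideanSpace ℝ (Fin 1) → ℝ, Integrable H (stdGaussian (EuclideanSpace ℝ (Fin 1))) ∧
      ∫ g, |H g| ∂stdGaussian (EuclideanSpace ℝ (Fin 1)) ≤ 1 ∧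
      ∀ ξ ≠ 0, ∫ g, H g * (inner ℝ g ξ / |inner ℝ g ξ|) ∂stdGaussian (EuclideanSpace ℝ (Fin 1)) =
        (-1) ^ n * (ξ j / ‖ξ‖) ^ (2 * n + 1) := by
  obtain ⟨H, h1, -, h2, h3⟩ := exists_gaussian_multiplier j 0
  refine ⟨fun g => (-1) ^ n * H g, h1.const_mul _, ?_, fun ξ hξ => ?_⟩
  · simpa [abs_mul] using h2 rfl
  · simp_rw [mul_assoc]
    rw [integral_const_mul, h3 ξ hξ]
    have hj : (ξ j / ‖ξ‖) ^ 2 = 1 := by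
      have : ‖ξ‖ ^ 2 = ξ j ^ 2 := by
        rw [EuclideanSpace.real_norm_sq_eq]
        simp [Subsingleton.elim j 0]
      rw [div_pow, this, div_self]
      rw [← this]
      exact pow_ne_zero _ (norm_ne_zero_iff.2 hξ)
    rw [pow_succ _ (2 * n), pow_mul, hj]
    simp

end GaussianMultiplier

end RieszPowers

namespace RieszPowers

/-! ### Lower bounds and growth of the constants c_{m,d}. -/

section Constants

open Asymptotics

theorem rieszConst_add_two_right {m d : ℕ} (hm : 1 ≤ m) (hd : 1 ≤ d) :
    rieszConst m (d + 2) = rieszConst m d * (((m : ℝ) + d) / d) := by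
  have hm' : (0 : ℝ) < m := by exact_mod_cast hm
  have hd' : (0 : ℝ) < d := by exact_mod_cast hd
  have h1 := (Real.Gamma_pos_of_pos (half_pos hm')).ne'
  have h2 := (Real.Gamma_pos_of_pos (half_pos hd')).ne'
  unfold rieszConst
  rw [show ((m : ℝ) + (d + 2 : ℕ)) / 2 = (m + d) / 2 + 1 by push_cast; ring,
    show ((d + 2 : ℕ) : ℝ) / 2 = d / 2 + 1 by push_cast; ring,
    Real.Gamma_add_one (by positivity), Real.Gamma_add_one (by positivity)]
  field_simp

theorem rieszConst_comm (m d : ℕ) : rieszConst m d = rieszConst d m := by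
  unfold rieszConst
  rw [add_comm (m : ℝ), mul_comm (Real.Gamma ((d : ℝ) / 2))]

theorem rieszConst_add_two_left {m d : ℕ} (hm : 1 ≤ m) (hd : 1 ≤ d) :
    rieszConst (m + 2) d = rieszConst m d * (((m : ℝ) + d) / m) := by
  rw [rieszConst_comm, rieszConst_add_two_right hd hm, rieszConst_comm, add_comm (d : ℝ)]

theorem rieszConst_two_right {m : ℕ} (hm : 1 ≤ m) : rieszConst m 2 = m := by
  have hm' : (0 : ℝ) < m := by exact_mod_cast hm
  have h1 := (Real.Gamma_pos_of_pos (half_pos hm')).ne'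
  unfold rieszConst
  rw [show ((m : ℝ) + (2 : ℕ)) / 2 = m / 2 + 1 by push_cast; ring,
    Real.Gamma_add_one (by positivity)]
  norm_num
  field_simp

theorem rieszConst_one_three : rieszConst 1 3 = 4 / Real.pi := by
  have hG : Real.Gamma (3 / 2) = 1 / 2 * √Real.pi := by
    rw [show (3 / 2 : ℝ) = 1 / 2 + 1 by norm_num, Real.Gamma_add_one (by norm_num),
      Real.Gamma_one_half_eq]
  have hp : √Real.pi ≠ 0 := (Real.sqrt_pos.2 Real.pi_pos).ne'
  unfold rieszConst
  norm_num
  rw [hG, Real.Gamma_one_half_eq]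
  have h3 : (1 / 2 * √Real.pi * √Real.pi) = Real.pi / 2 := by
    rw [mul_assoc, Real.mul_self_sqrt Real.pi_pos.le]
    ring
  rw [h3]
  field_simp
  norm_num

theorem one_le_four_div_pi : 1 ≤ 4 / Real.pi := by
  rw [le_div_iff₀ Real.pi_pos]
  linarith [Real.pi_le_four]

/-- True at m = 1 since 4/π ≥ 1; passing from m to m + 2 multiplies the constant by (m+3)/m, more
than the ratio (m+2)/m required. -/
theorem le_rieszConst_three (n : ℕ) : ((2 * n + 1 : ℕ) : ℝ) ≤ rieszConst (2 * n + 1) 3 := by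
  induction n with
  | zero => simpa [rieszConst_one_three] using one_le_four_div_pi
  | succ n ih =>
    rw [show 2 * (n + 1) + 1 = 2 * n + 1 + 2 by ring, rieszConst_add_two_left (by omega) (by omega)]
    have h : (0 : ℝ) < (2 * n + 1 : ℕ) := by positivity
    calc ((2 * n + 1 + 2 : ℕ) : ℝ)
        ≤ ((2 * n + 1 : ℕ) : ℝ) * (((2 * n + 1 : ℕ) + (3 : ℕ)) / (2 * n + 1 : ℕ)) := by
          rw [mul_div_cancel₀ _ h.ne']
          push_cast
          linarith
      _ ≤ _ := mul_le_mul_of_nonneg_right ih (by positivity)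

/-- Passing from d to d + 2 multiplies the constant by (m+d)/d ≥ 1, so d = 2, where it equals m, and
d = 3 suffice. -/
theorem le_rieszConst (n : ℕ) {d : ℕ} (hd : 2 ≤ d) :
    ((2 * n + 1 : ℕ) : ℝ) ≤ rieszConst (2 * n + 1) d := by
  obtain ⟨k, rfl⟩ := Nat.exists_eq_add_of_le' hd
  clear hd
  induction k using Nat.twoStepInduction with
  | zero => rw [rieszConst_two_right (by omega)]
  | one => exact le_rieszConst_three n
  | more k ih _ =>
    rw [rieszConst_add_two_right (by omega) (by omega)]
    refine ih.trans (le_mul_of_one_le_right ((Nat.cast_nonneg _).trans ih) ?_)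
    rw [one_le_div (by positivity)]
    simp
    positivity

/-- Starts at c_{3,1} = c_{1,3} = 4/π; for n = 0 the value 2/π is below 1. -/
theorem one_le_rieszConst_one (n : ℕ) (hn : 1 ≤ n) : 1 ≤ rieszConst (2 * n + 1) 1 := by
  induction n, hn using Nat.le_induction with
  | base =>
    rw [rieszConst_comm, rieszConst_one_three]
    exact one_le_four_div_pi
  | succ n hn ih =>
    rw [show 2 * (n + 1) + 1 = 2 * n + 1 + 2 by ring, rieszConst_add_two_left (by omega) (by omega)]
    refine ih.trans (le_mul_of_one_le_right (zero_le_one.trans ih) ?_)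
    rw [one_le_div (by positivity)]
    simp

/-- Logarithmic convexity of Γ at the midpoint of x and x + 1. -/
theorem Gamma_add_half_le {x : ℝ} (hx : 0 < x) :
    Real.Gamma (x + 1 / 2) ≤ Real.Gamma x * √x := by
  have h := Real.Gamma_mul_add_mul_le_rpow_Gamma_mul_rpow_Gamma hx (by linarith : 0 < x + 1)
    (a := 1 / 2) (b := 1 / 2) (by norm_num) (by norm_num) (by norm_num)
  have hG := Real.Gamma_pos_of_pos hx
  rw [show 1 / 2 * x + 1 / 2 * (x + 1) = x + 1 / 2 by ring, Real.Gamma_add_one hx.ne',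
    ← Real.sqrt_eq_rpow, ← Real.sqrt_eq_rpow, Real.sqrt_mul hx.le] at h
  calc _ ≤ _ := h
    _ = √(Real.Gamma x) * √(Real.Gamma x) * √x := by ring
    _ = _ := by rw [Real.mul_self_sqrt hG.le]

theorem isTheta_rieszConst_one :
    (fun m : ℕ => rieszConst m 1) =Θ[atTop] fun m : ℕ => (m : ℝ) ^ ((1 : ℝ) / 2) := by
  have hc : ∀ m : ℕ, 1 ≤ m → rieszConst m 1 =
      2 / √Real.pi * (Real.Gamma ((m : ℝ) / 2 + 1 / 2) / Real.Gamma ((m : ℝ) / 2)) := by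
    intro m hm
    unfold rieszConst
    rw [Nat.cast_one, Real.Gamma_one_half_eq, add_div]
    field_simp
  have hp : 0 < √Real.pi := Real.sqrt_pos.2 Real.pi_pos
  have hpos : ∀ m : ℕ, 1 ≤ m → 0 ≤ rieszConst m 1 := by
    intro m hm
    have hm' : (0 : ℝ) < m := by exact_mod_cast hm
    have h1 := Real.Gamma_pos_of_pos (half_pos hm')
    have h2 := Real.Gamma_pos_of_pos (by positivity : 0 < (m : ℝ) / 2 + 1 / 2)
    rw [hc m hm]
    positivity
  constructor
  · refine IsBigO.of_bound (2 / √Real.pi) ?_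
    filter_upwards [eventually_ge_atTop 1] with m hm
    have hm' : (0 : ℝ) < m := by exact_mod_cast hm
    rw [Real.norm_of_nonneg (hpos m hm), Real.norm_of_nonneg (by positivity), hc m hm,
      ← Real.sqrt_eq_rpow]
    refine mul_le_mul_of_nonneg_left ?_ (by positivity)
    rw [div_le_iff₀ (Real.Gamma_pos_of_pos (half_pos hm')), mul_comm]
    refine (Gamma_add_half_le (half_pos hm')).trans ?_
    refine mul_le_mul_of_nonneg_left (Real.sqrt_le_sqrt (by linarith))
      (Real.Gamma_pos_of_pos (half_pos hm')).le
  · refine IsBigO.of_bound √Real.pi ?_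
    filter_upwards [eventually_ge_atTop 1] with m hm
    have hm' : (1 : ℝ) ≤ m := by exact_mod_cast hm
    have hx : (0 : ℝ) < (m : ℝ) / 2 := by positivity
    rw [Real.norm_of_nonneg (hpos m hm), Real.norm_of_nonneg (by positivity), hc m hm,
      ← Real.sqrt_eq_rpow, ← mul_assoc, mul_div_cancel₀ _ hp.ne']
    have hG := Real.Gamma_pos_of_pos hx
    -- Shifting the half-step estimate by 1/2 bounds Γ(m/2 + 1), hence Γ(m/2), from above by Γ(m/2 +
    -- 1/2), which is the reverse bound.
    have h := Gamma_add_half_le (by positivity : 0 < (m : ℝ) / 2 + 1 / 2)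
    rw [add_assoc, show (1 / 2 + 1 / 2 : ℝ) = 1 by norm_num, Real.Gamma_add_one hx.ne'] at h
    rw [← mul_div_assoc, le_div_iff₀ hG]
    have hG2 := Real.Gamma_pos_of_pos (by positivity : 0 < (m : ℝ) / 2 + 1 / 2)
    have hs : √((m : ℝ) / 2 + 1 / 2) ≤ √m := Real.sqrt_le_sqrt (by linarith)
    have hs0 : 0 < √(m : ℝ) := Real.sqrt_pos.2 (by linarith)
    have h2 := h.trans (mul_le_mul_of_nonneg_left hs hG2.le)
    have h3 : √(m : ℝ) * √m = m := Real.mul_self_sqrt (by linarith)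
    refine le_of_mul_le_mul_right ?_ hs0
    calc √(m : ℝ) * Real.Gamma ((m : ℝ) / 2) * √m
        = 2 * ((m : ℝ) / 2 * Real.Gamma ((m : ℝ) / 2)) := by
          linear_combination Real.Gamma ((m : ℝ) / 2) * h3
      _ ≤ 2 * (Real.Gamma ((m : ℝ) / 2 + 1 / 2) * √m) := by gcongr
      _ = _ := by ring

/-- Induction on d in steps of two: each step multiplies by (m+d)/d, which is of exact order m. -/
theorem isTheta_rieszConst {d : ℕ} (hd : 1 ≤ d) :
    (fun m : ℕ => rieszConst m d) =Θ[atTop] fun m : ℕ => (m : ℝ) ^ ((d : ℝ) / 2) := by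
  obtain ⟨k, rfl⟩ := Nat.exists_eq_add_of_le' hd
  clear hd
  induction k using Nat.twoStepInduction with
  | zero => simpa using isTheta_rieszConst_one
  | one =>
    refine EventuallyEq.isTheta ?_
    filter_upwards [eventually_ge_atTop 1] with m hm
    rw [rieszConst_two_right hm]
    norm_num
  | more k ih _ =>
    have hlin : (fun m : ℕ => ((m : ℝ) + (k + 1 : ℕ)) / (k + 1 : ℕ)) =Θ[atTop]
        fun m : ℕ => (m : ℝ) := by
      have hk : (1 : ℝ) ≤ (k + 1 : ℕ) := by simp
      constructor
      · refine IsBigO.of_bound (k + 2 : ℕ) ?_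
        filter_upwards [eventually_ge_atTop 1] with m hm
        have hm' : (1 : ℝ) ≤ m := by exact_mod_cast hm
        rw [Real.norm_of_nonneg (by positivity), Real.norm_of_nonneg (by positivity)]
        refine (div_le_self (by positivity) hk).trans ?_
        push_cast
        nlinarith [(Nat.cast_nonneg k : (0 : ℝ) ≤ k)]
      · refine IsBigO.of_bound (k + 1 : ℕ) (Eventually.of_forall fun m => ?_)
        rw [Real.norm_of_nonneg (by positivity), Real.norm_of_nonneg (by positivity),
          mul_div_cancel₀ _ (by positivity)]
        simp
        positivity
    refine ((EventuallyEq.isTheta ?_).trans (ih.mul hlin)).trans (EventuallyEq.isTheta ?_)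
    · filter_upwards [eventually_ge_atTop 1] with m hm
      rw [show k + 2 + 1 = k + 1 + 2 by ring, rieszConst_add_two_right hm (by omega)]
    · filter_upwards [eventually_ge_atTop 1] with m hm
      have hm' : (0 : ℝ) < m := by exact_mod_cast hm
      rw [← Real.rpow_add_one hm'.ne']
      congr 1
      push_cast
      ring

end Constants

end RieszPowers

namespace RieszPowers

/-! ### Integration over lines and transference from dimension one. -/

section Transference

open FourierTransform

variable {d : ℕ} {X : Type*} [NormedAddCommGroup X] [NormedSpace ℝ X]

local notation "𝔼" => EuclideanSpace ℝ (Fin d)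

/-- Integration over space as an iterated integral over the lines with direction `g`. -/
theorem exists_lintegral_lines {g : EuclideanSpace ℝ (Fin d)} (hg : g ≠ 0) :
    ∃ (W : Submodule ℝ (EuclideanSpace ℝ (Fin d))) (μ : Measure W) (c : ℝ≥0∞), c ≠ 0 ∧
      SFinite μ ∧ ∀ G : 𝔼 → ℝ≥0∞, Measurable G →
        ∫⁻ x, G x = c * ∫⁻ w, (∫⁻ t : ℝ, G (w + t • g)) ∂μ := by
  let φ := innerSL ℝ g
  let W := LinearMap.ker (φ : 𝔼 →ₗ[ℝ] ℝ)
  have hgg : φ g ≠ 0 := by simpa [φ] using hg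
  let A : W × ℝ →ₗ[ℝ] 𝔼 := (W.subtype).coprod (LinearMap.toSpanSingleton ℝ 𝔼 g)
  have hA : ∀ p, A p = p.1 + p.2 • g := fun p => by simp [A]
  have hker : ∀ w : W, φ w = 0 := fun w => w.2
  have hbij : Function.Bijective A := by
    constructor
    · rw [injective_iff_map_eq_zero]
      rintro ⟨w, t⟩ h
      rw [hA] at h
      have h1 := congrArg φ h
      rw [map_add, map_smul, hker, map_zero, zero_add, smul_eq_mul] at h1
      have ht : t = 0 := (mul_eq_zero.1 h1).resolve_right hgg
      subst ht
      simpa using h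
    · intro x
      refine ⟨(⟨x - (φ x / φ g) • g, ?_⟩, φ x / φ g), ?_⟩
      · change φ (x - (φ x / φ g) • g) = 0
        rw [map_sub, map_smul, smul_eq_mul, div_mul_cancel₀ _ hgg, sub_self]
      · rw [hA]
        simp
  let e : (W × ℝ) ≃L[ℝ] 𝔼 := (LinearEquiv.ofBijective A hbij).toContinuousLinearEquiv
  let μ : Measure W := Measure.addHaar
  have hmap : ((μ.prod (volume : Measure ℝ)).map e).IsAddHaarMeasure :=
    e.isAddHaarMeasure_map _
  obtain ⟨c, hc0, hc⟩ : ∃ c : NNReal, 0 < c ∧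
      (volume : Measure 𝔼) = c • (μ.prod (volume : Measure ℝ)).map e :=
    ⟨_, Measure.addHaarScalarFactor_pos_of_isAddHaarMeasure _ _,
      Measure.isAddLeftInvariant_eq_smul _ _⟩
  refine ⟨W, μ, c, ENNReal.coe_ne_zero.2 hc0.ne', inferInstance, fun G hG => ?_⟩
  rw [hc, lintegral_smul_measure, ENNReal.smul_def, smul_eq_mul, lintegral_map hG e.continuous.measurable,
    lintegral_prod (fun p => G (e p)) (hG.comp e.continuous.measurable).aemeasurable]
  rfl

theorem ind_smul (Q : Set (EuclideanSpace ℝ (Fin d))) (v : X) (x : EuclideanSpace ℝ (Fin d)) :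
    ind Q x • v = Q.indicator (fun _ => v) x := by
  by_cases h : x ∈ Q <;> simp [ind, h]

/-- A line in any direction meets a convex set in an interval, which has finite length when the set
is bounded and g ≠ 0. -/
theorem isStepR_line {N : ℕ} {Q : Fin N → Set (EuclideanSpace ℝ (Fin d))} (hQ : ∀ i, IsBody (Q i))
    (v : Fin N → X) (w : EuclideanSpace ℝ (Fin d)) {g : EuclideanSpace ℝ (Fin d)} (hg : g ≠ 0) :
    IsStepR fun t : ℝ => ∑ i, ind (Q i) (w + t • g) • v i := by
  refine ⟨N, v, fun i => {t | w + t • g ∈ Q i}, fun i => ⟨?_, ?_⟩, fun t => ?_⟩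
  · refine Convex.ordConnected ?_
    intro s hs t ht a b ha hb hab
    have h := (hQ i).convex hs ht ha hb hab
    have e : a • (w + s • g) + b • (w + t • g) = w + (a • s + b • t) • g := by
      have : w = (a + b) • w := by rw [hab, one_smul]
      conv_rhs => rw [this]
      simp only [smul_eq_mul]
      module
    rwa [e] at h
  · have h := (hQ i).integrable_line w (neg_ne_zero.2 hg)
    have hm : MeasurableSet {t : ℝ | w + t • g ∈ Q i} :=
      (hQ i).measurable.preimage (by fun_prop : Measurable fun t : ℝ => w + t • g)
    simp only [smul_neg, sub_neg_eq_add] at h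
    have e : (fun t : ℝ => ind (Q i) (w + t • g)) =
        {t : ℝ | w + t • g ∈ Q i}.indicator fun _ => (1 : ℝ) := by
      funext t
      simp only [ind, Set.indicator, Set.mem_ofPred_eq]
    rw [e, integrable_indicator_iff hm, integrableOn_const_iff] at h
    simpa using h
  · refine Finset.sum_congr rfl fun i _ => ?_
    rw [ind_smul]
    rfl

/-- The one-dimensional inequality, integrated over all lines with direction `g`. -/
theorem lintegral_dirHilbert_le [CompleteSpace X] {Φ Ψ : X → ℝ} (hΦc : Continuous Φ)
    (hΨc : Continuous Ψ) {c : ℝ} {C : ℝ≥0∞}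
    (hC : ∀ f : ℝ → X, IsStepR f → ∫⁻ t, ENNReal.ofReal (Ψ (c • hilbertR f t)) ≤
      C * ∫⁻ t, ENNReal.ofReal (Φ (f t)))
    {N : ℕ} {Q : Fin N → Set (EuclideanSpace ℝ (Fin d))} (hQ : ∀ i, IsBody (Q i))
    (v : Fin N → X) {g : EuclideanSpace ℝ (Fin d)} (hg : g ≠ 0) :
    ∫⁻ x, ENNReal.ofReal (Ψ (c • ∑ i, dirHilbert (ind (Q i)) x g • v i)) ≤
      C * ∫⁻ x, ENNReal.ofReal (Φ (∑ i, ind (Q i) x • v i)) := by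
  obtain ⟨W, μ, a, ha, hμ, h⟩ := exists_lintegral_lines hg
  have hF : StronglyMeasurable fun x : 𝔼 => ∑ i, dirHilbert (ind (Q i)) x g • v i := by
    refine Finset.stronglyMeasurable_fun_sum _ fun i _ => ?_
    exact ((stronglyMeasurable_dirHilbert (measurable_ind (hQ i).measurable)).comp_measurable
      (by fun_prop : Measurable fun x : 𝔼 => (x, g))).smul_const (v i)
  have hf : StronglyMeasurable fun x : 𝔼 => ∑ i, ind (Q i) x • v i := by
    refine Finset.stronglyMeasurable_fun_sum _ fun i _ => ?_
    exact (measurable_ind (hQ i).measurable).stronglyMeasurable.smul_const (v i)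
  have hG1 : Measurable fun x : 𝔼 =>
      ENNReal.ofReal (Ψ (c • ∑ i, dirHilbert (ind (Q i)) x g • v i)) :=
    (hΨc.comp_stronglyMeasurable (hF.const_smul c)).measurable.ennreal_ofReal
  have hG2 : Measurable fun x : 𝔼 => ENNReal.ofReal (Φ (∑ i, ind (Q i) x • v i)) :=
    (hΦc.comp_stronglyMeasurable hf).measurable.ennreal_ofReal
  have hline : ∀ G : 𝔼 → ℝ≥0∞, Measurable G →
      Measurable fun w : W => ∫⁻ t : ℝ, G (w + t • g) := by
    intro G hG
    exact Measurable.lintegral_prod_right' (f := fun p : W × ℝ => G (p.1 + p.2 • g))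
      (hG.comp (by fun_prop))
  rw [h _ hG1, h _ hG2]
  -- The disintegration applied to the null union of the frontiers: almost every line meets it in a
  -- null set, which is all the one-dimensional formula needs. This uses that the disintegration
  -- constant is nonzero.
  have hae : ∀ᵐ w : W ∂μ, ∀ᵐ t : ℝ, ∀ i, (w : 𝔼) + t • g ∉ frontier (Q i) := by
    set S : Set 𝔼 := ⋃ i, frontier (Q i) with hS
    have hSm : MeasurableSet S := MeasurableSet.iUnion fun i => isClosed_frontier.measurableSet
    have hS0 : (volume : Measure 𝔼) S = 0 := measure_iUnion_null fun i =>
      measure_eq_zero_iff_ae_notMem.2 (hQ i).ae_notMem_frontier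
    have hi : Measurable (S.indicator fun _ => (1 : ℝ≥0∞)) := measurable_const.indicator hSm
    have h0 := h _ hi
    rw [lintegral_indicator_const hSm, hS0, mul_zero, eq_comm, mul_eq_zero, or_iff_right ha,
      lintegral_eq_zero_iff (hline _ hi)] at h0
    filter_upwards [h0] with w hw
    have hm : Measurable fun t : ℝ => (w : 𝔼) + t • g := by fun_prop
    have hw := (lintegral_eq_zero_iff (hi.comp hm)).1 hw
    filter_upwards [hw] with t ht i hmem
    have : (w : 𝔼) + t • g ∈ S := Set.mem_iUnion.2 ⟨i, hmem⟩
    simp [this] at ht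
  calc a * ∫⁻ w : W, (∫⁻ t : ℝ, ENNReal.ofReal
        (Ψ (c • ∑ i, dirHilbert (ind (Q i)) (w + t • g) g • v i))) ∂μ
      ≤ a * ∫⁻ w : W, (C * ∫⁻ t : ℝ,
          ENNReal.ofReal (Φ (∑ i, ind (Q i) (w + t • g) • v i))) ∂μ := by
        gcongr 1
        refine lintegral_mono_ae ?_
        filter_upwards [hae] with w hw
        refine le_trans (le_of_eq ?_) (hC _ (isStepR_line hQ v w hg))
        refine lintegral_congr_ae ?_
        filter_upwards [hw] with t ht
        rw [hilbertR_line_eq hQ v hg t ht]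
    _ = _ := by
        rw [lintegral_const_mul _ (hline _ hG2)]
        ring

/-- s • x lies on the segment between c • x and -(c • x), where Ψ takes equal values. -/
theorem ConvexOn.smul_le_of_even {Ψ : X → ℝ} (hΨ : ConvexOn ℝ Set.univ Ψ)
    (heven : ∀ x, Ψ (-x) = Ψ x) {s c : ℝ} (h : |s| ≤ c) (x : X) : Ψ (s • x) ≤ Ψ (c • x) := by
  rcases (abs_nonneg s |>.trans h).eq_or_lt with hc | hc
  · rw [← hc, abs_nonpos_iff] at h
    rw [h, ← hc]
  · obtain ⟨h1, h2⟩ := abs_le.1 h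
    have ha : 0 ≤ (1 + s / c) / 2 := by
      have : -1 ≤ s / c := by rw [le_div_iff₀ hc]; linarith
      linarith
    have hb : 0 ≤ (1 - s / c) / 2 := by
      have : s / c ≤ 1 := by rw [div_le_iff₀ hc]; linarith
      linarith
    have := hΨ.2 (Set.mem_univ (c • x)) (Set.mem_univ (-(c • x))) ha hb (by ring)
    rw [heven] at this
    have e : ((1 + s / c) / 2) • c • x + ((1 - s / c) / 2) • -(c • x) = s • x := by
      rw [smul_neg, smul_smul, smul_smul, ← neg_smul, ← add_smul]
      congr 1
      field_simp
      ring
    rw [e] at this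
    refine this.trans (le_of_eq ?_)
    simp only [smul_eq_mul]
    ring

variable {S : Type*} [MeasurableSpace S] {γ : Measure S}

/-- Jensen's inequality for a signed weight of mass at most `c` and an even convex function. -/
theorem ofReal_integral_smul_le [CompleteSpace X] {Ψ : X → ℝ} (hΨ0 : ∀ x, 0 ≤ Ψ x)
    (hΨ : ConvexOn ℝ Set.univ Ψ) (hΨc : Continuous Ψ) (heven : ∀ x, Ψ (-x) = Ψ x)
    {H : S → ℝ} (hH : Integrable H γ) (hA : 0 < ∫ g, |H g| ∂γ) {c : ℝ} (hc : ∫ g, |H g| ∂γ ≤ c)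
    {F : S → X} (hF : StronglyMeasurable F) (hHF : Integrable (fun g => H g • F g) γ) :
    ENNReal.ofReal (Ψ (∫ g, H g • F g ∂γ)) ≤
      ∫⁻ g, ENNReal.ofReal (|H g| / ∫ g, |H g| ∂γ) * ENNReal.ofReal (Ψ (c • F g)) ∂γ := by
  set A := ∫ g, |H g| ∂γ with hAdef
  have hρ : AEMeasurable (fun g => ENNReal.ofReal (|H g| / A)) γ :=
    (hH.abs.div_const A).1.aemeasurable.ennreal_ofReal
  set ν := γ.withDensity fun g => ENNReal.ofReal (|H g| / A) with hν
  have hνp : IsProbabilityMeasure ν := by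
    constructor
    rw [hν, withDensity_apply _ MeasurableSet.univ, Measure.restrict_univ,
      ← ofReal_integral_eq_lintegral_ofReal (hH.abs.div_const A)
        (Eventually.of_forall fun g => div_nonneg (abs_nonneg _) hA.le), integral_div, ← hAdef,
      div_self hA.ne', ENNReal.ofReal_one]
  have hG : Measurable fun g => ENNReal.ofReal (Ψ (c • F g)) :=
    (hΨc.comp_stronglyMeasurable (hF.const_smul c)).measurable.ennreal_ofReal
  have hrhs : ∫⁻ g, ENNReal.ofReal (|H g| / A) * ENNReal.ofReal (Ψ (c • F g)) ∂γ =
      ∫⁻ g, ENNReal.ofReal (Ψ (c • F g)) ∂ν :=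
    (lintegral_withDensity_eq_lintegral_mul₀ hρ hG.aemeasurable).symm
  rw [hrhs]
  by_cases htop : ∫⁻ g, ENNReal.ofReal (Ψ (c • F g)) ∂ν = ∞
  · rw [htop]; exact le_top
  let sg : S → ℝ := fun g => H g / |H g|
  have hsg : ∀ g, |sg g| ≤ 1 := fun g => by
    simp only [sg, abs_div, abs_abs]
    exact div_self_le_one _
  have hsgm : AEMeasurable sg γ := hH.1.aemeasurable.div hH.abs.1.aemeasurable
  -- Under the probability |H|/A the signed integral becomes the plain mean of Y; the scalar A·sgn H
  -- has modulus at most c, so Ψ(Y) ≤ Ψ(c F).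
  let Y : S → X := fun g => (A * sg g) • F g
  have hYm : AEStronglyMeasurable Y ν :=
    ((hsgm.mono_ac (withDensity_absolutelyContinuous _ _)).const_mul A).aestronglyMeasurable.smul
      hF.aestronglyMeasurable
  have hpt : ∀ g, (ENNReal.ofReal (|H g| / A)).toReal • Y g = H g • F g := fun g => by
    rw [ENNReal.toReal_ofReal (div_nonneg (abs_nonneg _) hA.le), smul_smul]
    congr 1
    rcases eq_or_ne (H g) 0 with h | h
    · simp [h]
    · have := abs_ne_zero.2 h
      simp only [sg]
      field_simp
  have hlt : ∀ᵐ g ∂γ, ENNReal.ofReal (|H g| / A) < ∞ :=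
    Eventually.of_forall fun g => ENNReal.ofReal_lt_top
  have hYi : Integrable Y ν := by
    rw [hν, integrable_withDensity_iff_integrable_smul₀' hρ hlt]
    exact hHF.congr (Eventually.of_forall fun g => (hpt g).symm)
  have hYeq : ∫ g, H g • F g ∂γ = ∫ g, Y g ∂ν := by
    rw [hν, integral_withDensity_eq_integral_toReal_smul₀ hρ hlt]
    exact integral_congr_ae (Eventually.of_forall fun g => (hpt g).symm)
  have hle : ∀ g, Ψ (Y g) ≤ Ψ (c • F g) := fun g => by
    refine ConvexOn.smul_le_of_even hΨ heven ?_ _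
    rw [abs_mul, abs_of_pos hA]
    exact (mul_le_of_le_one_right hA.le (hsg g)).trans hc
  have hΨm : AEStronglyMeasurable (Ψ ∘ Y) ν := hΨc.comp_aestronglyMeasurable hYm
  have hΨi : Integrable (Ψ ∘ Y) ν := by
    refine ⟨hΨm, ?_⟩
    rw [hasFiniteIntegral_iff_ofReal (f := Ψ ∘ Y) (Eventually.of_forall fun g => hΨ0 _)]
    exact (lintegral_mono fun g => ENNReal.ofReal_le_ofReal (hle g)).trans_lt (lt_top_iff_ne_top.2 htop)
  have hJ := hΨ.map_integral_le hΨc.continuousOn isClosed_univ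
    (Eventually.of_forall fun g => Set.mem_univ _) hYi hΨi
  rw [hYeq]
  calc ENNReal.ofReal (Ψ (∫ g, Y g ∂ν)) ≤ ENNReal.ofReal (∫ g, Ψ (Y g) ∂ν) :=
        ENNReal.ofReal_le_ofReal hJ
    _ = ∫⁻ g, ENNReal.ofReal (Ψ (Y g)) ∂ν :=
        ofReal_integral_eq_lintegral_ofReal hΨi (Eventually.of_forall fun g => hΨ0 _)
    _ ≤ _ := lintegral_mono fun g => ENNReal.ofReal_le_ofReal (hle g)

/-- Tonelli: a bound uniform over directions survives averaging with weights of total mass one. -/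
theorem lintegral_le_of_weighted_average {E : Type*} [MeasurableSpace E] {μ : Measure E}
    [SFinite μ] [SFinite γ] {G : E → S → ℝ≥0∞} (hG : Measurable (Function.uncurry G))
    {ρ : S → ℝ≥0∞} (hρ : AEMeasurable ρ γ) (hone : ∫⁻ g, ρ g ∂γ = 1) {B : ℝ≥0∞}
    (hdir : ∀ᵐ g ∂γ, ∫⁻ x, G x g ∂μ ≤ B) {L : E → ℝ≥0∞}
    (hL : ∀ᵐ x ∂μ, L x ≤ ∫⁻ g, ρ g * G x g ∂γ) : ∫⁻ x, L x ∂μ ≤ B := by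
  have hρ2 : AEMeasurable (fun p : E × S => ρ p.2) (μ.prod γ) :=
    hρ.comp_quasiMeasurePreserving Measure.quasiMeasurePreserving_snd
  calc ∫⁻ x, L x ∂μ ≤ ∫⁻ x, ∫⁻ g, ρ g * G x g ∂γ ∂μ := lintegral_mono_ae hL
    _ = ∫⁻ g, ∫⁻ x, ρ g * G x g ∂μ ∂γ := lintegral_lintegral_swap (hρ2.mul hG.aemeasurable)
    _ ≤ ∫⁻ g, ρ g * B ∂γ := by
        refine lintegral_mono_ae ?_
        filter_upwards [hdir] with g hg
        rw [lintegral_const_mul _ hG.of_uncurry_right]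
        gcongr
    _ = B := by rw [lintegral_mul_const'' _ hρ, hone, one_mul]

section Core

variable {γ : Measure (EuclideanSpace ℝ (Fin d))}

/-- Test the multiplier identity at ξ = e_j, where the right side is ±1. The mass is then positive
and |H| can be normalized. -/
theorem one_le_integral_abs_of_multiplier {H : EuclideanSpace ℝ (Fin d) → ℝ} (hH : Integrable H γ)
    (j : Fin d) (n : ℕ) (hmul : ∀ ξ : 𝔼, ξ ≠ 0 →
      ∫ g, H g * (inner ℝ g ξ / |inner ℝ g ξ|) ∂γ = (-1) ^ n * (ξ j / ‖ξ‖) ^ (2 * n + 1)) :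
    1 ≤ ∫ g, |H g| ∂γ := by
  have h := hmul (EuclideanSpace.single j 1) (by simp)
  have h1 : ‖∫ g, H g * (inner ℝ g (EuclideanSpace.single j (1 : ℝ)) /
      |inner ℝ g (EuclideanSpace.single j (1 : ℝ))|) ∂γ‖ ≤ ∫ g, |H g| ∂γ := by
    refine norm_integral_le_of_norm_le hH.abs (Eventually.of_forall fun g => ?_)
    rw [norm_mul, Real.norm_eq_abs, Real.norm_eq_abs, abs_div, abs_abs]
    exact mul_le_of_le_one_right (abs_nonneg _) (div_self_le_one _)
  rw [h] at h1
  simpa using h1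

/-- The transference inequality: a one-dimensional `Φ,Ψ`-estimate for `c` times the Hilbert
transform carries over to an odd power of the Riesz transform that is an average of directional
Hilbert transforms with total mass at most `c`. -/
theorem lintegral_rieszPow_body_le [CompleteSpace X] {Φ Ψ : X → ℝ} (hΨ0 : ∀ x, 0 ≤ Ψ x)
    (hΨ : ConvexOn ℝ Set.univ Ψ) (hΦc : Continuous Φ) (hΨc : Continuous Ψ)
    (heven : ∀ x, Ψ (-x) = Ψ x) [SFinite γ] (h0 : γ {0} = 0) {H : EuclideanSpace ℝ (Fin d) → ℝ}
    (hH : Integrable H γ) (j : Fin d) (n : ℕ) (hmul : ∀ ξ : 𝔼, ξ ≠ 0 →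
      ∫ g, H g * (inner ℝ g ξ / |inner ℝ g ξ|) ∂γ = (-1) ^ n * (ξ j / ‖ξ‖) ^ (2 * n + 1))
    {c : ℝ} (hc : ∫ g, |H g| ∂γ ≤ c) {C : ℝ≥0∞}
    (hC : ∀ f : ℝ → X, IsStepR f → ∫⁻ t, ENNReal.ofReal (Ψ (c • hilbertR f t)) ≤
      C * ∫⁻ t, ENNReal.ofReal (Φ (f t)))
    {N : ℕ} {Q : Fin N → Set (EuclideanSpace ℝ (Fin d))} (hQ : ∀ i, IsBody (Q i))
    (v : Fin N → X) {f : EuclideanSpace ℝ (Fin d) → X}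
    (hfeq : f = fun x => ∑ i, ind (Q i) x • v i) :
    ∫⁻ x, ENNReal.ofReal (Ψ (rieszPow j (2 * n + 1) f x)) ≤
      C * ∫⁻ x, ENNReal.ofReal (Φ (f x)) := by
  have hA : 0 < ∫ g, |H g| ∂γ :=
    zero_lt_one.trans_le (one_le_integral_abs_of_multiplier hH j n hmul)
  set A := ∫ g, |H g| ∂γ with hAdef
  have hUae : ∀ᵐ x ∂(volume : Measure 𝔼), x ∈ ⋂ i, (frontier (Q i))ᶜ := by
    simp only [Set.mem_iInter, Set.mem_compl_iff]
    exact ae_all_iff.2 fun i => (hQ i).ae_notMem_frontier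
  have hsum := rieszPow_sum_smul j v (F := f) (by rw [hfeq]) (fun i => (hQ i).hasFT_ind) hUae
    (fun i x hx => locHolder_ind (Set.mem_iInter.1 hx i)) (2 * n + 1)
  have hav : ∀ᵐ x ∂(volume : Measure 𝔼), ∀ i, rieszPow j (2 * n + 1) (ind (Q i)) x =
      ∫ g, H g * dirHilbert (ind (Q i)) x g ∂γ :=
    ae_all_iff.2 fun i => (hQ i).rieszPow_ae_eq_average hH j n hmul
  have hFm : StronglyMeasurable fun p : 𝔼 × 𝔼 => ∑ i, dirHilbert (ind (Q i)) p.1 p.2 • v i :=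
    Finset.stronglyMeasurable_fun_sum _ fun i _ =>
      (stronglyMeasurable_dirHilbert (measurable_ind (hQ i).measurable)).smul_const (v i)
  have hGm : Measurable fun p : 𝔼 × 𝔼 =>
      ENNReal.ofReal (Ψ (c • ∑ i, dirHilbert (ind (Q i)) p.1 p.2 • v i)) :=
    (hΨc.comp_stronglyMeasurable (hFm.const_smul c)).measurable.ennreal_ofReal
  have hρ : AEMeasurable (fun g => ENNReal.ofReal (|H g| / A)) γ :=
    (hH.abs.div_const A).1.aemeasurable.ennreal_ofReal
  have hpt : ∀ᵐ x ∂(volume : Measure 𝔼), ENNReal.ofReal (Ψ (rieszPow j (2 * n + 1) f x)) ≤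
      ∫⁻ g, ENNReal.ofReal (|H g| / A) *
        ENNReal.ofReal (Ψ (c • ∑ i, dirHilbert (ind (Q i)) x g • v i)) ∂γ := by
    filter_upwards [hsum, hav, hUae] with x h1 h2 h3
    have hm : Measurable fun g : 𝔼 => (x, g) := by fun_prop
    have hDx : ∀ i, StronglyMeasurable fun g => dirHilbert (ind (Q i)) x g := fun i => by
      have := (stronglyMeasurable_dirHilbert (measurable_ind (hQ i).measurable)).comp_measurable hm
      exact this
    have hint : ∀ i, Integrable (fun g => H g * dirHilbert (ind (Q i)) x g) γ := by
      intro i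
      obtain ⟨B, hB, hb⟩ := (hQ i).abs_dirHilbert_le (Set.mem_iInter.1 h3 i)
      exact hH.mul_bdd (c := B)
        (hDx i).aestronglyMeasurable
        (Eventually.of_forall hb)
    have e : ∀ g, H g • ∑ i, dirHilbert (ind (Q i)) x g • v i =
        ∑ i, (H g * dirHilbert (ind (Q i)) x g) • v i := fun g => by
      rw [Finset.smul_sum]
      simp only [smul_smul]
    have hx : rieszPow j (2 * n + 1) f x =
        ∫ g, H g • ∑ i, dirHilbert (ind (Q i)) x g • v i ∂γ := by
      simp only [e]
      rw [h1, integral_finsetSum _ fun i _ => (hint i).smul_const _]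
      exact Finset.sum_congr rfl fun i _ => by rw [h2, integral_smul_const]
    rw [hx]
    have hFx : StronglyMeasurable fun g => ∑ i, dirHilbert (ind (Q i)) x g • v i :=
      Finset.stronglyMeasurable_fun_sum _ fun i _ => (hDx i).smul_const (v i)
    refine ofReal_integral_smul_le hΨ0 hΨ hΨc heven hH hA hc hFx ?_
    refine Integrable.congr ?_ (Eventually.of_forall fun g => (e g).symm)
    exact integrable_finsetSum _ fun i _ => (hint i).smul_const _
  have hne : ∀ᵐ g ∂γ, g ≠ 0 := measure_eq_zero_iff_ae_notMem.1 h0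
  have hdir : ∀ g : 𝔼, g ≠ 0 →
      ∫⁻ x, ENNReal.ofReal (Ψ (c • ∑ i, dirHilbert (ind (Q i)) x g • v i)) ≤
        C * ∫⁻ x, ENNReal.ofReal (Φ (f x)) := fun g hg => by
    rw [hfeq]
    exact lintegral_dirHilbert_le hΦc hΨc hC hQ v hg
  have hone : ∫⁻ g, ENNReal.ofReal (|H g| / A) ∂γ = 1 := by
    rw [← ofReal_integral_eq_lintegral_ofReal (hH.abs.div_const A)
      (Eventually.of_forall fun g => div_nonneg (abs_nonneg _) hA.le), integral_div, ← hAdef,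
      div_self hA.ne', ENNReal.ofReal_one]
  exact lintegral_le_of_weighted_average (G := fun x g =>
    ENNReal.ofReal (Ψ (c • ∑ i, dirHilbert (ind (Q i)) x g • v i))) hGm hρ hone
    (hne.mono fun g hg => hdir g hg) hpt

theorem lintegral_rieszPow_le [CompleteSpace X] {Φ Ψ : X → ℝ} (hΨ0 : ∀ x, 0 ≤ Ψ x)
    (hΨ : ConvexOn ℝ Set.univ Ψ) (hΦc : Continuous Φ) (hΨc : Continuous Ψ)
    (heven : ∀ x, Ψ (-x) = Ψ x) [SFinite γ] (h0 : γ {0} = 0) {H : EuclideanSpace ℝ (Fin d) → ℝ}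
    (hH : Integrable H γ) (j : Fin d) (n : ℕ) (hmul : ∀ ξ : 𝔼, ξ ≠ 0 →
      ∫ g, H g * (inner ℝ g ξ / |inner ℝ g ξ|) ∂γ = (-1) ^ n * (ξ j / ‖ξ‖) ^ (2 * n + 1))
    {c : ℝ} (hc : ∫ g, |H g| ∂γ ≤ c) {C : ℝ≥0∞}
    (hC : ∀ f : ℝ → X, IsStepR f → ∫⁻ t, ENNReal.ofReal (Ψ (c • hilbertR f t)) ≤
      C * ∫⁻ t, ENNReal.ofReal (Φ (f t)))
    {f : EuclideanSpace ℝ (Fin d) → X} (hf : IsStepRd d f) :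
    ∫⁻ x, ENNReal.ofReal (Ψ (rieszPow j (2 * n + 1) f x)) ≤
      C * ∫⁻ x, ENNReal.ofReal (Φ (f x)) := by
  obtain ⟨N, v, I, hI, hfI⟩ := hf
  have hQ : ∀ i, IsBody (rect (I i)) := fun i =>
    ⟨rect_convex fun k => (hI i k).1, rect_measurable fun k => (hI i k).1,
      rect_isBounded (fun k => (hI i k).1) fun k => (hI i k).2⟩
  refine lintegral_rieszPow_body_le hΨ0 hΨ hΦc hΨc heven h0 hH j n hmul hc hC hQ v ?_
  funext x
  rw [hfI]
  exact Finset.sum_congr rfl fun i _ => (ind_smul _ _ _).symm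

end Core

end Transference

end RieszPowers

namespace RieszPowers

/-! ### From the integral inequality to the two operator norms. -/

section Norms

open ProbabilityTheory

variable {d : ℕ} {X : Type*} [NormedAddCommGroup X] [NormedSpace ℝ X]

/-- Isolates what a constant must dominate: 2n + 1 for d ≥ 2 and only 1 for d = 1. Both c_{m,d} and
m^(d/2) are then tested against this. -/
theorem exists_gaussian_multiplier_le (j : Fin d) (n : ℕ) {B : ℝ}
    (h2 : 2 ≤ d → ((2 * n + 1 : ℕ) : ℝ) ≤ B) (h1 : d = 1 → 1 ≤ B) :
    ∃ H : EuclideanSpace ℝ (Fin d) → ℝ, Integrable H (stdGaussian (EuclideanSpace ℝ (Fin d))) ∧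
      ∫ g, |H g| ∂stdGaussian (EuclideanSpace ℝ (Fin d)) ≤ B ∧
      ∀ ξ ≠ 0, ∫ g, H g * (inner ℝ g ξ / |inner ℝ g ξ|) ∂stdGaussian (EuclideanSpace ℝ (Fin d)) =
        (-1) ^ n * (ξ j / ‖ξ‖) ^ (2 * n + 1) := by
  rcases Nat.lt_or_ge d 2 with hd | hd
  · obtain rfl : d = 1 := by have := Fin.pos j; omega
    obtain ⟨H, hH, hA, hm⟩ := exists_gaussian_multiplier_line j n
    exact ⟨H, hH, hA.trans (h1 rfl), hm⟩
  · obtain ⟨H, hH, hA, -, hm⟩ := exists_gaussian_multiplier j n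
    exact ⟨H, hH, hA.trans ((by push_cast; rfl : _ = ((2 * n + 1 : ℕ) : ℝ)).trans_le (h2 hd)), hm⟩

theorem rieszPow_estimate [CompleteSpace X] {Φ Ψ : X → ℝ} (hΨ0 : ∀ x, 0 ≤ Ψ x)
    (hΨ : ConvexOn ℝ Set.univ Ψ) (hΦc : Continuous Φ) (hΨc : Continuous Ψ)
    (heven : ∀ x, Ψ (-x) = Ψ x) (j : Fin d) (n : ℕ) {c : ℝ}
    (h2 : 2 ≤ d → ((2 * n + 1 : ℕ) : ℝ) ≤ c) (h1 : d = 1 → 1 ≤ c) {C : ℝ≥0∞}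
    (hC : ∀ f : ℝ → X, IsStepR f → ∫⁻ t, ENNReal.ofReal (Ψ (c • hilbertR f t)) ≤
      C * ∫⁻ t, ENNReal.ofReal (Φ (f t)))
    {f : EuclideanSpace ℝ (Fin d) → X} (hf : IsStepRd d f) :
    ∫⁻ x, ENNReal.ofReal (Ψ (rieszPow j (2 * n + 1) f x)) ≤
      C * ∫⁻ x, ENNReal.ofReal (Φ (f x)) := by
  obtain ⟨H, hH, hA, hm⟩ := exists_gaussian_multiplier_le j n h2 h1
  exact lintegral_rieszPow_le hΨ0 hΨ hΦc hΨc heven (stdGaussian_singleton_zero (Fin.pos j)) hH j n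
    hm hA hC hf

theorem phiPsiNorm_rieszPow_le [CompleteSpace X] {Φ Ψ : X → ℝ} (hΨ0 : ∀ x, 0 ≤ Ψ x)
    (hΨ : ConvexOn ℝ Set.univ Ψ) (hΦc : Continuous Φ) (hΨc : Continuous Ψ)
    (heven : ∀ x, Ψ (-x) = Ψ x) (j : Fin d) (n : ℕ) (hdn : ¬(d = 1 ∧ n = 0)) :
    phiPsiNorm (IsStepRd d) (rieszPow (X := X) j (2 * n + 1)) Φ Ψ ≤
      phiPsiNorm IsStepR (fun (f : ℝ → X) t => rieszConst (2 * n + 1) d • hilbertR f t) Φ Ψ := by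
  refine le_sInf fun C hC => sInf_le fun f hf => ?_
  refine rieszPow_estimate hΨ0 hΨ hΦc hΨc heven j n (le_rieszConst n) ?_ hC hf
  rintro rfl
  exact one_le_rieszConst_one n (by omega)

theorem lintegral_ofReal_norm_rpow {E Y : Type*} [MeasurableSpace E] {μ : Measure E}
    [NormedAddCommGroup Y] (f : E → Y)
    {p : ℝ≥0∞} (hp0 : p ≠ 0) (hp : p ≠ ∞) :
    ∫⁻ x, ENNReal.ofReal (‖f x‖ ^ p.toReal) ∂μ = eLpNorm f p μ ^ p.toReal := by
  have hq := ENNReal.toReal_pos hp0 hp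
  rw [eLpNorm_eq_lintegral_rpow_enorm_toReal hp0 hp, ← ENNReal.rpow_mul, one_div,
    inv_mul_cancel₀ hq.ne', ENNReal.rpow_one]
  refine lintegral_congr fun x => ?_
  rw [← ENNReal.ofReal_rpow_of_nonneg (norm_nonneg _) hq.le, ofReal_norm]

theorem convexOn_norm_rpow {q : ℝ} (hq : 1 ≤ q) :
    ConvexOn ℝ Set.univ fun x : X => ‖x‖ ^ q := by
  refine ⟨convex_univ, fun x _ y _ a b ha hb hab => ?_⟩
  have h := (convexOn_rpow hq).2 (norm_nonneg x) (norm_nonneg y) ha hb hab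
  refine le_trans (Real.rpow_le_rpow (norm_nonneg _) ?_ (by linarith)) h
  refine (norm_add_le _ _).trans (le_of_eq ?_)
  rw [norm_smul, norm_smul, Real.norm_of_nonneg ha, Real.norm_of_nonneg hb, smul_eq_mul,
    smul_eq_mul]

/-- The general estimate with Φ = Ψ = ‖·‖^p; the scalar c leaves the norm by homogeneity. -/
theorem lpOpNorm_rieszPow_le [CompleteSpace X] (j : Fin d) (n : ℕ) {p : ℝ≥0∞} (hp1 : 1 ≤ p)
    (hp : p ≠ ∞) {c : ℝ} (hc : 0 < c) (h2 : 2 ≤ d → ((2 * n + 1 : ℕ) : ℝ) ≤ c)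
    (h1 : d = 1 → 1 ≤ c) :
    lpOpNorm (IsStepRd d) (rieszPow (X := X) j (2 * n + 1)) p ≤
      ENNReal.ofReal c * lpOpNorm IsStepR (hilbertR (X := X)) p := by
  have hp0 : p ≠ 0 := (zero_lt_one.trans_le hp1).ne'
  have hq1 : 1 ≤ p.toReal := by
    rw [← ENNReal.toReal_one]
    exact ENNReal.toReal_mono hp hp1
  have hq0 : 0 < p.toReal := zero_lt_one.trans_le hq1
  have hc0 : ENNReal.ofReal c ≠ 0 := (ENNReal.ofReal_pos.2 hc).ne'
  -- With c moved to the left, the bound against the infimum may be checked for each admissible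
  -- one-dimensional constant C.
  rw [mul_comm (ENNReal.ofReal c), ← ENNReal.div_le_iff hc0 ENNReal.ofReal_ne_top]
  refine le_sInf fun C hC => ?_
  rw [ENNReal.div_le_iff hc0 ENNReal.ofReal_ne_top]
  refine sInf_le fun f hf => ?_
  have hcont : Continuous fun x : X => ‖x‖ ^ p.toReal :=
    continuous_norm.rpow_const fun _ => Or.inr hq0.le
  have key := rieszPow_estimate (Φ := fun x : X => ‖x‖ ^ p.toReal)
    (Ψ := fun x : X => ‖x‖ ^ p.toReal) (C := (C * ENNReal.ofReal c) ^ p.toReal)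
    (fun x => by positivity) (convexOn_norm_rpow hq1) hcont hcont (fun x => by simp) j n h2 h1
    (fun f hf => ?_) hf
  · rw [lintegral_ofReal_norm_rpow _ hp0 hp, lintegral_ofReal_norm_rpow _ hp0 hp,
      ← ENNReal.mul_rpow_of_nonneg _ _ hq0.le] at key
    exact (ENNReal.rpow_le_rpow_iff hq0).1 key
  · have e := lintegral_ofReal_norm_rpow (μ := (volume : Measure ℝ)) (c • hilbertR f) hp0 hp
    simp only [Pi.smul_apply] at e
    rw [e, lintegral_ofReal_norm_rpow _ hp0 hp, ← ENNReal.mul_rpow_of_nonneg _ _ hq0.le]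
    refine ENNReal.rpow_le_rpow ?_ hq0.le
    rw [eLpNorm_const_smul, Real.enorm_of_nonneg hc.le, mul_comm C, mul_assoc]
    gcongr
    exact hC f hf

end Norms

end RieszPowers

/-! ### The theorem. -/

theorem mainTheorem11 (d : ℕ) (hd : 1 ≤ d) :
    (∀ (m : ℕ), Odd m → ¬ (d = 1 ∧ m = 1) → ∀ (j : Fin d)
      (X : Type u) [NormedAddCommGroup X] [NormedSpace ℝ X] [CompleteSpace X] (Φ Ψ : X → ℝ),
      (∀ x, 0 ≤ Φ x) → (∀ x, 0 ≤ Ψ x) →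
      ConvexOn ℝ Set.univ Φ → ConvexOn ℝ Set.univ Ψ → Continuous Φ → Continuous Ψ →
      (∀ x, Ψ (-x) = Ψ x) →
      RieszPowers.phiPsiNorm (RieszPowers.IsStepRd d) (RieszPowers.rieszPow (X := X) j m) Φ Ψ ≤
        RieszPowers.phiPsiNorm RieszPowers.IsStepR
          (fun (f : ℝ → X) t => RieszPowers.rieszConst m d • RieszPowers.hilbertR f t) Φ Ψ) ∧
    Asymptotics.IsTheta Filter.atTop
      (fun m : ℕ => RieszPowers.rieszConst m d) (fun m : ℕ => (m : ℝ) ^ ((d : ℝ) / 2)) ∧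
    (∃ K : ℝ, 0 < K ∧ ∀ (m : ℕ), Odd m → ∀ (j : Fin d)
      (X : Type u) [NormedAddCommGroup X] [NormedSpace ℝ X] [CompleteSpace X]
      (p : ENNReal), 1 < p → p < ⊤ →
      RieszPowers.lpOpNorm (RieszPowers.IsStepRd d) (RieszPowers.rieszPow (X := X) j m) p ≤
        ENNReal.ofReal (K * (m : ℝ) ^ ((d : ℝ) / 2)) *
          RieszPowers.lpOpNorm RieszPowers.IsStepR (RieszPowers.hilbertR (X := X)) p) := by
  -- K = 1 suffices because the masses m (for d ≥ 2) and 1 (for d = 1) are already at most m^(d/2).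
  refine ⟨?_, RieszPowers.isTheta_rieszConst hd, 1, one_pos, ?_⟩
  · rintro m ⟨n, rfl⟩ hdm j X _ _ _ Φ Ψ - hΨ0 - hΨ hΦc hΨc heven
    exact RieszPowers.phiPsiNorm_rieszPow_le hΨ0 hΨ hΦc hΨc heven j n (by omega)
  · rintro m ⟨n, rfl⟩ j X _ _ _ p hp1 hp
    have hm : (1 : ℝ) ≤ (2 * n + 1 : ℕ) := by simp
    rw [one_mul]
    refine RieszPowers.lpOpNorm_rieszPow_le j n hp1.le hp.ne (by positivity) (fun h => ?_)
      fun _ => Real.one_le_rpow hm (by positivity)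
    have h' : (2 : ℝ) ≤ d := by exact_mod_cast h
    exact Real.self_le_rpow_of_one_le hm (by linarith)
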